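/- Let $n\ge 2$, let $X$ be an $n$-dimensional complex manifold with a balanced metric $\omega$ (a $C^\infty$ positive definite $(1,1)$-form with $d\omega^{n-1}=0$), and put $\omega_{n-1}:=\omega^{n-1}/(n-1)!$. Let $S$ be a compact complex manifold of dimension $d\ge n-1$ with a volume form $dV>0$ (a $C^\infty$ positive $(d,d)$-form). Let $\mathscr X$ be the set of holomorphic maps $f:S\to X$ such that $[f^\star\omega_{n-1}]_{BC}=0$ in $H^{n-1,n-1}_{BC}(S,\mathbb C)$, i.e. $f^\star\omega_{n-1}=\partial\bar\partial\gamma$ for some smooth $(n-2,n-2)$-form $\gamma$ on $S$. For a $(1,0)$-vector field $\xi$ put $L^{1,0}_\xi u:=\xi\lrcorner\partial u+\partial(\xi\lrcorner u)$, and let $\mathfrak g$ be the space of holomorphic vector fields $\xi\in H^0(S,T^{1,0}S)$ with $L^{1,0}_\xi(dV)=0$. For complex vector fields $Z_1,\dots,Z_{n-2},W_1,\dots,W_{n-2}$ on $S$ put $$B(Z,W):=\Big[\sum_{1\le r<s\le n-2}(-1)^{s+r+1}[Z_s,Z_r]\lrcorner Z_{n-2}\lrcorner\cdots\widehat{Z_s}\cdots\widehat{Z_r}\cdots\lrcorner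 Z_1\lrcorner W_{n-2}\lrcorner\cdots\lrcorner W_1$$ $$\qquad+\sum_{s,r=1}^{n-2}(-1)^{n-s+r+1}[Z_s,W_r]\lrcorner Z_{n-2}\lrcorner\cdots\widehat{Z_s}\cdots\lrcorner Z_1\lrcorner W_{n-2}\lrcorner\cdots\widehat{W_r}\cdots\lrcorner W_1\Big]\lrcorner dV .$$ Let $\mathcal P_{\mathfrak g}$ be the set of all $(\xi_1,\dots,\xi_{n-2},\bar\eta_1,\dots,\bar\eta_{n-2})$ with $\xi_j,\eta_j\in\mathfrak g$, $B(\bar\eta,\xi)=0$ and $B(\xi,\bar\eta)=0$. Suppose that $H^{n-2,n-2}_A(S,\mathbb C)=\{0\}$, i.e. every smooth $(n-2,n-2)$-form $\alpha$ on $S$ with $\partial\bar\partial\alpha=0$ is of the form $\alpha=\partial\beta+\bar\partial\gamma$ with smooth forms $\beta,\gamma$ of bidegrees $(n-3,n-2)$ and $(n-2,n-3)$ (forms of negative bidegree being $0$). Then for every $f\in\mathscr X$ and every $(\xi_1,\dots,\xi_{n-2},\bar\eta_1,\dots,\bar\eta_{n-2})\in\mathcal P_{\mathfrak g}$, the number $$\mu(f)(\xi_1,\dots,\xi_{n-2},\bar\eta_1,\dots,\bar\eta_{n-2}):=i\int_S\Gamma_f(\xi_1,\dots,\xi_{n-2},\bar\eta_1,\dots,\bar\eta_{n-2})\,dV$$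 does not depend on the choice of the smooth real $(n-2,n-2)$-form $\Gamma_f$ on $S$ with $f^\star\omega_{n-1}=i\partial\bar\partial\Gamma_f$. -/

import Mathlib

open scoped Manifold ContDiff
open MeasureTheory Module

noncomputable section

namespace BalancedMoment

/-!
Complex manifolds are charted spaces on a finite-dimensional complex normed space `E` with
holomorphic transition maps, `IsManifold 𝓘(ℂ, E) ω M`.  Mathlib's tangent space at `x : M` is `E`
itself (through the preferred chart at `x`), with complex structure `J v = I • v`.
-/

section LinearAlgebra

variable {E : Type*} [NormedAddCommGroup E] [NormedSpace ℂ E] {k l : ℕ}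

/-- The complex vector `v - i J v` over two: the element of `T^{1,0}` given by `v`.
A complex tangent vector `a + i b`, with `a`, `b` real tangent vectors, is the pair `(a, b)`. -/
def holVec (v : E) : E × E := ((1 / 2 : ℝ) • v, -((1 / 2 : ℝ) • (Complex.I • v)))

/-- Complex conjugation on the complexified tangent space: `a + i b` goes to `a - i b`. -/
def conjVec (z : E × E) : E × E := (z.1, -z.2)

/-- Contraction `z ⌟ α` of an alternating form by the complex vector `z = a + i b`
(inserted in the first slot). -/
def contractVec (z : E × E) (α : E [⋀^Fin (k + 1)]→L[ℝ] ℂ) : E [⋀^Fin k]→L[ℝ] ℂ :=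
  α.curryLeft z.1 + Complex.I • α.curryLeft z.2

/-- Value `α(z₁, …, z_k)` of the complex-multilinear extension of `α` on complex vectors. -/
def evalC : {k : ℕ} → (E [⋀^Fin k]→L[ℝ] ℂ) → (Fin k → E × E) → ℂ
  | 0, α, _ => α ![]
  | _ + 1, α, z => evalC (contractVec (z 0) α) (fun i => z i.succ)

/-- `α` is of bidegree `(p, q)`: its degree is `p + q` and its complex-multilinear extension
vanishes on vectors of pure type unless exactly `p` of them are of type `(1,0)` (hence `q` of type
`(0,1)`).  For `p < 0` or `q < 0` the only such form is `0`. -/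
def IsBidegree (p q : ℤ) (α : E [⋀^Fin k]→L[ℝ] ℂ) : Prop :=
  (k : ℤ) = p + q ∧
    ∀ (s : Finset (Fin k)) (v : Fin k → E), (s.card : ℤ) ≠ p →
      evalC α (fun i => if i ∈ s then holVec (v i) else conjVec (holVec (v i))) = 0

/-- The multilinear map `(v, w) ↦ α(v) β(w)`. -/
def tensorForm (α : E [⋀^Fin k]→L[ℝ] ℂ) (β : E [⋀^Fin l]→L[ℝ] ℂ) :
    ContinuousMultilinearMap ℝ (fun _ : Fin (k + l) => E) ℂ where
  toFun v := α (fun i => v (Fin.castAdd l i)) * β (fun j => v (Fin.natAdd k j))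
  map_update_add' := by
    intro _ v i x y
    have hd : (‹DecidableEq (Fin (k + l))›) = instDecidableEqFin (k + l) :=
      Subsingleton.elim _ _
    subst hd
    induction i using Fin.addCases with
    | left i =>
      have h1 : ∀ z, (fun a => Function.update v (Fin.castAdd l i) z (Fin.castAdd l a))
          = Function.update (fun a => v (Fin.castAdd l a)) i z := by
        intro z; ext a; by_cases h : a = i <;> simp [h]
      have h2 : ∀ z, (fun a => Function.update v (Fin.castAdd l i) z (Fin.natAdd k a))
          = (fun a => v (Fin.natAdd k a)) := by
        intro z; ext a
        rw [Function.update_of_ne]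
        intro h; have := congrArg Fin.val h; simp at this; omega
      simp only [h1, h2, ContinuousAlternatingMap.map_update_add, add_mul]
    | right i =>
      have h1 : ∀ z, (fun a => Function.update v (Fin.natAdd k i) z (Fin.natAdd k a))
          = Function.update (fun a => v (Fin.natAdd k a)) i z := by
        intro z; ext a; by_cases h : a = i <;> simp [h]
      have h2 : ∀ z, (fun a => Function.update v (Fin.natAdd k i) z (Fin.castAdd l a))
          = (fun a => v (Fin.castAdd l a)) := by
        intro z; ext a
        rw [Function.update_of_ne]
        intro h; have := congrArg Fin.val h; simp at this; omega
      simp only [h1, h2, ContinuousAlternatingMap.map_update_add, mul_add]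
  map_update_smul' := by
    intro _ v i c x
    have hd : (‹DecidableEq (Fin (k + l))›) = instDecidableEqFin (k + l) :=
      Subsingleton.elim _ _
    subst hd
    induction i using Fin.addCases with
    | left i =>
      have h1 : ∀ z, (fun a => Function.update v (Fin.castAdd l i) z (Fin.castAdd l a))
          = Function.update (fun a => v (Fin.castAdd l a)) i z := by
        intro z; ext a; by_cases h : a = i <;> simp [h]
      have h2 : ∀ z, (fun a => Function.update v (Fin.castAdd l i) z (Fin.natAdd k a))
          = (fun a => v (Fin.natAdd k a)) := by
        intro z; ext a
        rw [Function.update_of_ne]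
        intro h; have := congrArg Fin.val h; simp at this; omega
      simp only [h1, h2, ContinuousAlternatingMap.map_update_smul, smul_mul_assoc]
    | right i =>
      have h1 : ∀ z, (fun a => Function.update v (Fin.natAdd k i) z (Fin.natAdd k a))
          = Function.update (fun a => v (Fin.natAdd k a)) i z := by
        intro z; ext a; by_cases h : a = i <;> simp [h]
      have h2 : ∀ z, (fun a => Function.update v (Fin.natAdd k i) z (Fin.castAdd l a))
          = (fun a => v (Fin.castAdd l a)) := by
        intro z; ext a
        rw [Function.update_of_ne]
        intro h; have := congrArg Fin.val h; simp at this; omega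
      simp only [h1, h2, ContinuousAlternatingMap.map_update_smul, mul_smul_comm]
  cont := by
    refine Continuous.mul ?_ ?_
    · exact α.cont.comp (by fun_prop)
    · exact β.cont.comp (by fun_prop)

/-- The wedge product
`(α ∧ β)(v) = (1 / (k! l!)) ∑_σ sgn(σ) α(v_{σ 1}, …, v_{σ k}) β(v_{σ (k+1)}, …, v_{σ (k+l)})`. -/
def wedge (α : E [⋀^Fin k]→L[ℝ] ℂ) (β : E [⋀^Fin l]→L[ℝ] ℂ) : E [⋀^Fin (k + l)]→L[ℝ] ℂ :=
  ((k.factorial : ℂ) * (l.factorial : ℂ))⁻¹ •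
    ContinuousMultilinearMap.alternatization (tensorForm α β)

/-- The wedge power `w ∧ … ∧ w` (`j` factors) of a 2-form. -/
def wedgePow (w : E [⋀^Fin 2]→L[ℝ] ℂ) : (j : ℕ) → E [⋀^Fin (2 * j)]→L[ℝ] ℂ
  | 0 => ContinuousAlternatingMap.constOfIsEmpty ℝ E (Fin 0) (1 : ℂ)
  | j + 1 => wedge (wedgePow w j) w

/-- The real frame `b₁, J b₁, b₂, J b₂, …` of `E` attached to a complex frame `b₁, b₂, …`. -/
def realFrame {d : ℕ} (b : Fin d → E) (j : Fin (2 * d)) : E :=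
  if (j : ℕ) % 2 = 0 then b ⟨(j : ℕ) / 2, by omega⟩ else Complex.I • b ⟨(j : ℕ) / 2, by omega⟩

/-- Multiplication by `i` on `E`, as a real-linear map. -/
def J : E →L[ℝ] E := (Complex.I • ContinuousLinearMap.id ℂ E).restrictScalars ℝ

/-- The complex-linear part `v ↦ (D v - i D (J v)) / 2` of a real-linear map into a complex space:
`∑_j ∂/∂z_j ⊗ dz_j` when `D` is a differential. -/
def linPart {V : Type*} [NormedAddCommGroup V] [NormedSpace ℝ V] [Module ℂ V]
    [ContinuousConstSMul ℂ V] [SMulCommClass ℝ ℂ V] (D : E →L[ℝ] V) : E →L[ℝ] V :=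
  (1 / 2 : ℂ) • (D - Complex.I • D.comp J)

/-- The antilinear part `v ↦ (D v + i D (J v)) / 2`: `∑_j ∂/∂z̄_j ⊗ dz̄_j` when `D` is a
differential. -/
def antilinPart {V : Type*} [NormedAddCommGroup V] [NormedSpace ℝ V] [Module ℂ V]
    [ContinuousConstSMul ℂ V] [SMulCommClass ℝ ℂ V] (D : E →L[ℝ] V) : E →L[ℝ] V :=
  (1 / 2 : ℂ) • (D + Complex.I • D.comp J)

end LinearAlgebra

section Forms

variable {E M : Type*} [NormedAddCommGroup E] [NormedSpace ℂ E]
  [TopologicalSpace M] [ChartedSpace E M] {k : ℕ}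

/-- Complex-valued differential `k`-forms (no regularity) on a manifold modelled on `E`: the value
at `x` is an alternating form on the tangent space at `x`, which is `E` by definition. -/
abbrev DForm (E M : Type*) [NormedAddCommGroup E] [NormedSpace ℂ E] (k : ℕ) :=
  M → E [⋀^Fin k]→L[ℝ] ℂ

/-- The expression of a form in the preferred chart `φ` at `x₀`: the pullback by `φ⁻¹`
(meaningful on the target of `φ`). -/
def inChart (x₀ : M) (α : DForm E M k) (z : E) : E [⋀^Fin k]→L[ℝ] ℂ :=
  (α ((chartAt E x₀).symm z)).compContinuousLinearMap
    (mfderiv 𝓘(ℝ, E) 𝓘(ℝ, E) (chartAt E x₀).symm z : E →L[ℝ] E)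

/-- `C^∞` forms. -/
def IsSmooth (α : DForm E M k) : Prop :=
  ∀ x₀ : M, ContDiffOn ℝ ∞ (inChart x₀ α) (chartAt E x₀).target

/-- Smooth forms of bidegree `(p, q)`, the space `C^∞_{p,q}(M, ℂ)`. -/
def IsSmoothOfType (p q : ℤ) (α : DForm E M k) : Prop :=
  IsSmooth α ∧ ∀ x, IsBidegree p q (α x)

/-- Real forms. -/
def IsReal (α : DForm E M k) : Prop := ∀ x v, (α x v).im = 0

/-- The exterior derivative, computed at `x` in the preferred chart at `x` (the differential of
that chart at `x` is the identification of the tangent space with `E`). -/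
def extD (α : DForm E M k) : DForm E M (k + 1) := fun x =>
  extDeriv (inChart x α) (chartAt E x x)

/-- The operator `∂ = ∑_j dz_j ∧ ∂/∂z_j`, computed at `x` in the preferred chart at `x`. -/
def del (α : DForm E M k) : DForm E M (k + 1) := fun x =>
  .alternatizeUncurryFin (linPart (fderiv ℝ (inChart x α) (chartAt E x x)))

/-- The operator `∂̄ = ∑_j dz̄_j ∧ ∂/∂z̄_j`, computed at `x` in the preferred chart at `x`. -/
def delbar (α : DForm E M k) : DForm E M (k + 1) := fun x =>
  .alternatizeUncurryFin (antilinPart (fderiv ℝ (inChart x α) (chartAt E x x)))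

/-- `d = ∂ + ∂̄`. -/
theorem extD_eq_del_add_delbar (α : DForm E M k) : extD α = del α + delbar α := by
  funext x
  have h : linPart (fderiv ℝ (inChart x α) (chartAt E x x))
      + antilinPart (fderiv ℝ (inChart x α) (chartAt E x x))
      = fderiv ℝ (inChart x α) (chartAt E x x) := by
    rw [linPart, antilinPart, ← smul_add, sub_add_add_cancel, ← two_smul ℂ, smul_smul]
    norm_num
  simp only [extD, del, delbar, Pi.add_apply, extDeriv,
    ← ContinuousAlternatingMap.alternatizeUncurryFin_add, h]

/-- A form lies in the image of `∂ ⊕ ∂̄ : C^∞_{p-1,q} ⊕ C^∞_{p,q-1} → C^∞_{p,q}`, the space of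
Aeppli-trivial forms of bidegree `(p, q)` (in degree `0` only the zero function). -/
def IsAeppliTrivial (p q : ℤ) : {k : ℕ} → DForm E M k → Prop
  | 0, α => α = 0
  | k + 1, α => ∃ β γ : DForm E M k,
      IsSmoothOfType (p - 1) q β ∧ IsSmoothOfType p (q - 1) γ ∧ α = del β + delbar γ

/-- `H^{p,q}_A(M, ℂ) = 0`, where `H^{p,q}_A` is the space of `∂∂̄`-closed smooth `(p,q)`-forms
(of degree `k = p + q`) modulo the image of `∂` plus the image of `∂̄`. -/
def AeppliVanishes (E M : Type*) [NormedAddCommGroup E] [NormedSpace ℂ E]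
    [TopologicalSpace M] [ChartedSpace E M] (k : ℕ) (p q : ℤ) : Prop :=
  ∀ α : DForm E M k, IsSmoothOfType p q α → del (delbar α) = 0 → IsAeppliTrivial p q α

/-- A (closed) form has zero class in `H^{p,q}_{BC}(M, ℂ)`, i.e. it lies in the image of
`∂∂̄ : C^∞_{p-1,q-1} → C^∞_{p,q}`. -/
def IsBottChernTrivial (p q : ℤ) (α : DForm E M (k + 1 + 1)) : Prop :=
  ∃ γ : DForm E M k, IsSmoothOfType (p - 1) (q - 1) γ ∧ α = del (delbar γ)

/-- The `(1,1)`-form `w` of a Hermitian metric: smooth, real, of bidegree `(1,1)` and positive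
definite. -/
structure IsHermitianMetric (w : DForm E M 2) : Prop where
  smooth : IsSmoothOfType 1 1 w
  real : IsReal w
  pos : ∀ (x : M) (v : E), v ≠ 0 → 0 < (w x ![v, Complex.I • v]).re

/-- A balanced metric: a Hermitian metric `w` with `d w^{n-1} = 0`, `n` the complex dimension. -/
def IsBalancedMetric (w : DForm E M 2) : Prop :=
  IsHermitianMetric w ∧ extD (fun x => wedgePow (w x) (finrank ℂ E - 1)) = 0

/-- The form `w_j = w^j / j!`. -/
def dividedPow (w : DForm E M 2) (j : ℕ) : DForm E M (2 * j) := fun x =>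
  ((j.factorial : ℂ))⁻¹ • wedgePow (w x) j

end Forms

section VectorFields

variable {E M : Type*} [NormedAddCommGroup E] [NormedSpace ℂ E]
  [TopologicalSpace M] [ChartedSpace E M]

/-- Holomorphic vector fields of type `(1,0)`, as holomorphic sections `ξ` of the tangent bundle;
the corresponding section of `T^{1,0}M` is `x ↦ holVec (ξ x)`. -/
def IsHolomorphicField [IsManifold 𝓘(ℂ, E) ω M] (ξ : M → E) : Prop :=
  ContMDiff 𝓘(ℂ, E) 𝓘(ℂ, E).tangent ω (fun x => (⟨x, ξ x⟩ : TangentBundle 𝓘(ℂ, E) M))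

/-- The `(1,0)`-vector field `ξ` as a field of complex tangent vectors. -/
def hol (ξ : M → E) : M → E × E := fun x => holVec (ξ x)

/-- The conjugate `(0,1)`-vector field as a field of complex tangent vectors. -/
def antihol (η : M → E) : M → E × E := fun x => conjVec (holVec (η x))

/-- The Lie bracket of real vector fields. -/
def realBracket (U V : M → E) : M → E := fun x =>
  VectorField.mlieBracket 𝓘(ℝ, E)
    (fun y => (U y : TangentSpace 𝓘(ℝ, E) y)) (fun y => (V y : TangentSpace 𝓘(ℝ, E) y)) x

/-- The Lie bracket of complex vector fields: the complex-bilinear extension of the real one. -/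
def bracket (Z W : M → E × E) : M → E × E := fun x =>
  (realBracket (fun y => (Z y).1) (fun y => (W y).1) x
      - realBracket (fun y => (Z y).2) (fun y => (W y).2) x,
    realBracket (fun y => (Z y).1) (fun y => (W y).2) x
      + realBracket (fun y => (Z y).2) (fun y => (W y).1) x)

/-- Contraction `Z ⌟ u` of a form by a complex vector field. -/
def contract {k : ℕ} (Z : M → E × E) (u : DForm E M (k + 1)) : DForm E M k := fun x =>
  contractVec (Z x) (u x)

/-- The `(1,0)`-Lie derivative `L^{1,0}_Z u = Z ⌟ ∂u + ∂(Z ⌟ u)`; the second term is absent when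
`u` is a function. -/
def lieDerivOneZero (Z : M → E × E) : {k : ℕ} → DForm E M k → DForm E M k
  | 0, u => contract Z (del u)
  | _ + 1, u => contract Z (del u) + del (contract Z u)

/-- Inhomogeneous forms, given by their components of all degrees. -/
abbrev GForm (E M : Type*) [NormedAddCommGroup E] [NormedSpace ℂ E] := (k : ℕ) → DForm E M k

/-- A homogeneous form as an inhomogeneous one. -/
def ofDegree {k : ℕ} (u : DForm E M k) : GForm E M := Pi.single k u

/-- `Z₁ ⌟ Z₂ ⌟ … ⌟ Z_r ⌟ u` for a list `[Z₁, …, Z_r]` of complex vector fields. -/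
def contractList (L : List (M → E × E)) (u : GForm E M) : GForm E M :=
  L.foldr (fun Z v k => contract Z (v (k + 1))) u

/-- The list `Z_m, …, Z_2, Z_1` with the entries failing `p` omitted. -/
def descending {m : ℕ} (Z : Fin m → M → E × E) (p : Fin m → Bool) : List (M → E × E) :=
  ((List.finRange m).reverse.filter p).map Z

/-- With `Z = (Z_1, …, Z_m)`, `W = (W_1, …, W_m)` and `n = m + 2`, the form
`[ ∑_{r < s} (-1)^{s+r+1} [Z_s, Z_r] ⌟ Z_m ⌟ … (Z_s and Z_r omitted) … ⌟ Z_1 ⌟ W_m ⌟ … ⌟ W_1`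
`+ ∑_{s, r} (-1)^{n-s+r+1} [Z_s, W_r] ⌟ Z_m ⌟ … (Z_s omitted) … ⌟ Z_1`
`⌟ W_m ⌟ … (W_r omitted) … ⌟ W_1 ] ⌟ u`.
Indices in the code start at `0`. -/
def bracketForm {m : ℕ} (Z W : Fin m → M → E × E) (u : GForm E M) : GForm E M :=
  (∑ s : Fin m, ∑ r ∈ Finset.univ.filter (fun r : Fin m => r < s),
    (-1 : ℤ) ^ ((s : ℕ) + 1 + ((r : ℕ) + 1) + 1) •
      contractList (bracket (Z s) (Z r) ::
        (descending Z (fun i => i ≠ s ∧ i ≠ r) ++ descending W (fun _ => true))) u)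
  + ∑ s : Fin m, ∑ r : Fin m,
    (-1 : ℤ) ^ (m + 2 - ((s : ℕ) + 1) + ((r : ℕ) + 1) + 1) •
      contractList (bracket (Z s) (W r) ::
        (descending Z (fun i => i ≠ s) ++ descending W (fun i => i ≠ r))) u

end VectorFields

section Volume

variable {E S : Type*} [NormedAddCommGroup E] [NormedSpace ℂ E]
  [TopologicalSpace S] [ChartedSpace E S]

/-- A volume form `dV > 0`: a smooth real form of top degree `2d` (hence of bidegree `(d, d)`),
positive at every point for the orientation given by the complex structure. -/
structure IsVolumeForm (dV : DForm E S (2 * finrank ℂ E)) : Prop where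
  smooth : IsSmooth dV
  real : IsReal dV
  pos : ∀ (x : S) (b : Basis (Fin (finrank ℂ E)) ℂ E), 0 < (dV x (realFrame b)).re

/-- Lebesgue measure on `E`, normalised by the real frame of a fixed complex basis. -/
def lebesgue (E : Type*) [NormedAddCommGroup E] [NormedSpace ℂ E] [FiniteDimensional ℂ E]
    [MeasurableSpace E] [BorelSpace E] : Measure E :=
  (Complex.basisOneI.smulTower (finBasis ℂ E)).addHaar

/-- The measure of the volume form on the domain of the preferred chart `φ` at `x₀`: in the chart
it has density `dV(b₁, J b₁, …, b_d, J b_d)` with respect to Lebesgue measure. -/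
def chartMeasure [FiniteDimensional ℂ E] [MeasurableSpace E] [BorelSpace E] [MeasurableSpace S]
    (dV : DForm E S (2 * finrank ℂ E)) (x₀ : S) : Measure S :=
  (((lebesgue E).restrict (chartAt E x₀).target).withDensity
    (fun z => ENNReal.ofReal (inChart x₀ dV z (realFrame (finBasis ℂ E))).re)).map
      (chartAt E x₀).symm

/-- The measure on `S` defined by a volume form.  By the change of variables formula the chart
measures agree on overlaps of charts, so they glue to one measure, whose restrictions to the chart
domains they are; since finitely many (or countably many) charts cover `S`, the glued measure is
their supremum. The integral `∫_S g dV` of a function `g` is the integral for this measure. -/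
def volumeMeasure [FiniteDimensional ℂ E] [MeasurableSpace E] [BorelSpace E] [MeasurableSpace S]
    (dV : DForm E S (2 * finrank ℂ E)) : Measure S :=
  ⨆ x₀ : S, chartMeasure dV x₀

/-- The Lie algebra of the group of biholomorphisms preserving `dV`: holomorphic `(1,0)`-fields
`ξ` with `L^{1,0}_ξ dV = 0`. -/
def lieAlg [IsManifold 𝓘(ℂ, E) ω S] (dV : DForm E S (2 * finrank ℂ E)) : Set (S → E) :=
  {ξ | IsHolomorphicField ξ ∧ lieDerivOneZero (hol ξ) dV = 0}

/-- The set `𝒫` of `(ξ_1, …, ξ_m, η̄_1, …, η̄_m)`, recorded as the pair of tuples `(ξ, η)`. -/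
def tupleSpace [IsManifold 𝓘(ℂ, E) ω S] (dV : DForm E S (2 * finrank ℂ E)) (m : ℕ) :
    Set ((Fin m → S → E) × (Fin m → S → E)) :=
  {p | (∀ j, p.1 j ∈ lieAlg dV) ∧ (∀ j, p.2 j ∈ lieAlg dV) ∧
    bracketForm (fun j => antihol (p.2 j)) (fun j => hol (p.1 j)) (ofDegree dV) = 0 ∧
    bracketForm (fun j => hol (p.1 j)) (fun j => antihol (p.2 j)) (ofDegree dV) = 0}

/-- The function `Γ(ξ_1, …, ξ_m, η̄_1, …, η̄_m)` on `S`. -/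
def evalFields {m : ℕ} (Γ : DForm E S (2 * m)) (ξ η : Fin m → S → E) (x : S) : ℂ :=
  evalC (Γ x) (fun i =>
    if h : (i : ℕ) < m then hol (ξ ⟨i, h⟩) x
    else antihol (η ⟨(i : ℕ) - m, by omega⟩) x)

/-- `i ∫_S Γ(ξ_1, …, ξ_m, η̄_1, …, η̄_m) dV`. -/
def momentValue [FiniteDimensional ℂ E] [MeasurableSpace E] [BorelSpace E] [MeasurableSpace S]
    (dV : DForm E S (2 * finrank ℂ E)) {m : ℕ} (Γ : DForm E S (2 * m))
    (ξ η : Fin m → S → E) : ℂ :=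
  Complex.I * ∫ x, evalFields Γ ξ η x ∂(volumeMeasure dV)

end Volume

section Maps

variable {E F S X : Type*} [NormedAddCommGroup E] [NormedSpace ℂ E]
  [NormedAddCommGroup F] [NormedSpace ℂ F]
  [TopologicalSpace S] [ChartedSpace E S] [TopologicalSpace X] [ChartedSpace F X]

/-- The pullback `f^* α`. -/
def pullback {k : ℕ} (f : S → X) (α : DForm F X k) : DForm E S k := fun x =>
  (α (f x)).compContinuousLinearMap (mfderiv 𝓘(ℝ, E) 𝓘(ℝ, F) f x : E →L[ℝ] F)

/-- The space of holomorphic maps `f : S → X` with `[f^* w_{n-1}]_{BC} = 0`, where `n = m + 2`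
is the dimension of `X`. -/
def mapSpace (E : Type*) {S : Type*} [NormedAddCommGroup E] [NormedSpace ℂ E]
    [TopologicalSpace S] [ChartedSpace E S] (w : DForm F X 2) (m : ℕ) : Set (S → X) :=
  {f | ContMDiff 𝓘(ℂ, E) 𝓘(ℂ, F) ω f ∧
    IsBottChernTrivial (k := 2 * m) ((m : ℤ) + 1) ((m : ℤ) + 1)
      (pullback f (dividedPow w (m + 1)) : DForm E S (2 * (m + 1)))}

/-- `Γ` is an admissible potential for `f`: a smooth real `(n-2, n-2)`-form on `S` with
`f^* w_{n-1} = i ∂∂̄ Γ`, where `n = m + 2`. -/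
def IsRealPotential (w : DForm F X 2) (f : S → X) {m : ℕ} (Γ : DForm E S (2 * m)) : Prop :=
  IsSmoothOfType m m Γ ∧ IsReal Γ ∧
    (pullback f (dividedPow w (m + 1)) : DForm E S (2 * (m + 1)))
      = Complex.I • (del (delbar Γ) : DForm E S (2 * (m + 1)))

end Maps

end BalancedMoment

end

/-!
Two admissible potentials differ by a smooth form `Γ` with `∂∂̄Γ = 0`, and the vanishing of the
Aeppli group gives `Γ = ∂β + ∂̄γ` (in degree `0`, where `m = 0`, it gives `Γ = 0`). So it is enough
that the functions `(∂β)(ξ, η̄)` and `(∂̄γ)(ξ, η̄)` have integral zero. The two cases are conjugate,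
and both are treated at once with a sign `ε = ±1`: `typePart ε` is the part of a differential giving
`∂` or `∂̄`, and `typeVec ε v` is the vector of type `(1,0)` or `(0,1)` given by `v`. Below they are
described for `ε = 1`.

Contraction by the antiholomorphic fields `η̄_r` anticommutes with `∂`, so these fields can be moved
onto `β` (`contractList_dolbeaultG_of_opposite`). For fields of type `(1,0)` put
`L_Z = Z ⌟ ∂ + ∂ (Z ⌟ ·)`. From `[L_Z, W ⌟] = [Z, W] ⌟` one gets by induction
(`contrListG_dolbeault`) that contracting `∂b` by all the fields `Z_1, …, Z_m` is a signed sum of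
* `∂` of the full contraction of `b`, which has no component of degree `0`;
* the terms `L_{Z_s}` of the contraction of `b` by the other fields; in degree `0` these are the
  derivatives `Z_s · g_s` of smooth functions `g_s`;
* the terms `[Z_s, Z_r] ⌟ …`, which make up the operator defining the bracket form.

The bracket condition says that this last operator kills `dV`; the mixed brackets `[ξ_s, η̄_r]` in it
vanish anyway. Every form is obtained from `dV` by scaling and contracting, and contractions
commute up to sign, so the operator kills all forms (`contrListG_sum_eq_zero`). What remains is
`(∂β)(ξ, η̄) = ± ∑ ± Z_s · g_s` (`contractList_dolbeaultG`).

It remains to see that `∫ Z_s · g_s dV = 0`. In a chart, the real and imaginary parts of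
`L^{1,0}_ξ dV = 0` say that `ξ` and `J ξ` are divergence free for the density of `dV`
(`divergence_eq_zero`). The measure of `dV` restricts to the chart measures
(`volumeMeasure_restrict_source`, by the change of variables formula), so a partition of unity
reduces the claim to the divergence theorem for compactly supported functions on `E`
(`integral_dirDeriv_eq_zero`).
-/

open scoped Topology

noncomputable section

namespace BalancedMoment

/-! ### Contractions of alternating forms by complex vectors -/

section Contraction

variable {E : Type*} [NormedAddCommGroup E] [NormedSpace ℂ E] {k : ℕ}

@[simp] theorem alternating_smul_zero (c : ℂ) : c • (0 : E [⋀^Fin k]→L[ℝ] ℂ) = 0 := by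
  ext
  simp

theorem contractVec_add (z : E × E) (α β : E [⋀^Fin (k + 1)]→L[ℝ] ℂ) :
    contractVec z (α + β) = contractVec z α + contractVec z β := by
  simp only [contractVec, ContinuousAlternatingMap.curryLeft_add, add_apply,
    smul_add]
  abel

theorem curryLeft_complex_smul (c : ℂ) (α : E [⋀^Fin (k + 1)]→L[ℝ] ℂ) (v : E) :
    (c • α).curryLeft v = c • α.curryLeft v := by
  ext w
  simp

theorem contractVec_smul (z : E × E) (c : ℂ) (α : E [⋀^Fin (k + 1)]→L[ℝ] ℂ) :
    contractVec z (c • α) = c • contractVec z α := by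
  simp only [contractVec, curryLeft_complex_smul, smul_add, smul_comm c Complex.I]

theorem contractVec_add_left (z w : E × E) (α : E [⋀^Fin (k + 1)]→L[ℝ] ℂ) :
    contractVec (z + w) α = contractVec z α + contractVec w α := by
  simp only [contractVec, Prod.fst_add, Prod.snd_add, map_add, smul_add]
  abel

theorem contractVec_neg_left (z : E × E) (α : E [⋀^Fin (k + 1)]→L[ℝ] ℂ) :
    contractVec (-z) α = -contractVec z α := by
  simp only [contractVec, Prod.fst_neg, Prod.snd_neg, map_neg, smul_neg]
  abel

theorem contractVec_zero_left (α : E [⋀^Fin (k + 1)]→L[ℝ] ℂ) :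
    contractVec (0 : E × E) α = 0 := by
  simp [contractVec]

theorem contractVec_sub_left (z w : E × E) (α : E [⋀^Fin (k + 1)]→L[ℝ] ℂ) :
    contractVec (z - w) α = contractVec z α - contractVec w α := by
  rw [sub_eq_add_neg, contractVec_add_left, contractVec_neg_left, sub_eq_add_neg]

/-- Multiplication by `i` on the complexified tangent space. -/
def mulIVec (z : E × E) : E × E := (-z.2, z.1)

theorem contractVec_mulIVec (z : E × E) (α : E [⋀^Fin (k + 1)]→L[ℝ] ℂ) :
    contractVec (mulIVec z) α = Complex.I • contractVec z α := by
  simp only [contractVec, mulIVec, map_neg, smul_add, smul_smul, Complex.I_mul_I]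
  module

theorem curryLeft_comm (α : E [⋀^Fin (k + 2)]→L[ℝ] ℂ) (v w : E) :
    (α.curryLeft v).curryLeft w = -(α.curryLeft w).curryLeft v := by
  have h := α.curryLeft_same (v + w)
  simp only [map_add, ContinuousAlternatingMap.curryLeft_add, add_apply,
    ContinuousAlternatingMap.curryLeft_same, zero_add, add_zero] at h
  exact eq_neg_of_add_eq_zero_right h

theorem contractVec_contractVec (z w : E × E) (α : E [⋀^Fin (k + 2)]→L[ℝ] ℂ) :
    contractVec z (contractVec w α) = -contractVec w (contractVec z α) := by
  simp only [contractVec, ContinuousAlternatingMap.curryLeft_add, curryLeft_complex_smul,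
    add_apply, smul_add, curryLeft_comm α w.1, curryLeft_comm α w.2]
  module

/-- Contraction with a fixed complex vector as a continuous linear map. -/
def contractL (z : E × E) : (E [⋀^Fin (k + 1)]→L[ℝ] ℂ) →L[ℝ] (E [⋀^Fin k]→L[ℝ] ℂ) :=
  let c := (ContinuousAlternatingMap.curryLeftLI (𝕜 := ℝ) (E := E) (F := ℂ)
    (n := k)).toContinuousLinearMap
  (ContinuousLinearMap.apply ℝ _ z.1).comp c +
    Complex.I • (ContinuousLinearMap.apply ℝ _ z.2).comp c

@[simp] theorem contractL_apply (z : E × E) (α : E [⋀^Fin (k + 1)]→L[ℝ] ℂ) :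
    contractL z α = contractVec z α := rfl

theorem contractVec_neg (z : E × E) (α : E [⋀^Fin (k + 1)]→L[ℝ] ℂ) :
    contractVec z (-α) = -contractVec z α := by
  exact (contractL z).map_neg α

theorem contractVec_real_smul (z : E × E) (r : ℝ) (α : E [⋀^Fin (k + 1)]→L[ℝ] ℂ) :
    contractVec z (r • α) = r • contractVec z α :=
  (contractL z).map_smul r α

/-- Contraction as a continuous linear map of the complex vector. -/
def contractR (α : E [⋀^Fin (k + 1)]→L[ℝ] ℂ) : E × E →L[ℝ] (E [⋀^Fin k]→L[ℝ] ℂ) :=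
  α.curryLeft.comp (.fst ℝ E E) + Complex.I • α.curryLeft.comp (.snd ℝ E E)

@[simp] theorem contractR_apply (z : E × E) (α : E [⋀^Fin (k + 1)]→L[ℝ] ℂ) :
    contractR α z = contractVec z α := rfl

/-- Inserting a vector in the first slot of an antisymmetrisation; `D'` is `D` followed by
insertion of `v`. -/
theorem curryLeft_alternatizeUncurryFin (D : E →L[ℝ] E [⋀^Fin (k + 1)]→L[ℝ] ℂ)
    (D' : E →L[ℝ] E [⋀^Fin k]→L[ℝ] ℂ) (v : E) (hD' : ∀ w, D' w = (D w).curryLeft v) :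
    (ContinuousAlternatingMap.alternatizeUncurryFin D).curryLeft v =
      D v - ContinuousAlternatingMap.alternatizeUncurryFin D' := by
  ext w
  simp only [ContinuousAlternatingMap.curryLeft_apply_apply,
    ContinuousAlternatingMap.alternatizeUncurryFin_apply, ContinuousAlternatingMap.sub_apply]
  rw [Fin.sum_univ_succ]
  simp only [hD', ContinuousAlternatingMap.curryLeft_apply_apply]
  have h (i : Fin (k + 1)) :
      (Fin.succ i).removeNth (Matrix.vecCons v w) = Matrix.vecCons v (i.removeNth w) := by
    funext j
    refine Fin.cases ?_ (fun j => ?_) j <;> simp [Fin.removeNth]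
  have h0 : (0 : Fin (k + 2)).removeNth (Matrix.vecCons v w) = w := by
    funext j; simp [Fin.removeNth]
  simp only [h, h0, Fin.val_zero, pow_zero, one_smul, Matrix.cons_val_zero, Fin.val_succ,
    Matrix.cons_val_succ, pow_succ, mul_neg_one, neg_smul, Finset.sum_neg_distrib, sub_eq_add_neg]

/-- Contraction is an antiderivation with respect to antisymmetrisation:
`z ⌟ Alt(D) = D(z) - Alt(z ⌟ D)`. -/
theorem contractVec_alternatizeUncurryFin (D : E →L[ℝ] E [⋀^Fin (k + 1)]→L[ℝ] ℂ) (z : E × E) :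
    contractVec z (.alternatizeUncurryFin D) =
      D z.1 + Complex.I • D z.2 - .alternatizeUncurryFin ((contractL z).comp D) := by
  rw [contractVec]
  set C : (E [⋀^Fin (k + 1)]→L[ℝ] ℂ) →L[ℝ] E →L[ℝ] (E [⋀^Fin k]→L[ℝ] ℂ) :=
    (ContinuousAlternatingMap.curryLeftLI (𝕜 := ℝ) (E := E) (F := ℂ)
      (n := k)).toContinuousLinearMap
  rw [curryLeft_alternatizeUncurryFin D (((ContinuousLinearMap.apply ℝ _ z.1).comp C).comp D) z.1
      (fun w => rfl),
    curryLeft_alternatizeUncurryFin D (((ContinuousLinearMap.apply ℝ _ z.2).comp C).comp D) z.2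
      (fun w => rfl)]
  have : (contractL z).comp D = ((ContinuousLinearMap.apply ℝ _ z.1).comp C).comp D +
      Complex.I • ((ContinuousLinearMap.apply ℝ _ z.2).comp C).comp D := by
    ext w; rfl
  rw [this, ContinuousAlternatingMap.alternatizeUncurryFin_add,
    ContinuousAlternatingMap.alternatizeUncurryFin_smul, smul_sub]
  abel

theorem contractVec_alternatizeUncurryFin_zero (D : E →L[ℝ] E [⋀^Fin 0]→L[ℝ] ℂ) (z : E × E) :
    contractVec z (.alternatizeUncurryFin D) = D z.1 + Complex.I • D z.2 := by
  ext w
  simp [contractVec, ContinuousAlternatingMap.alternatizeUncurryFin_apply, Subsingleton.elim _ w]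

theorem alternatizeUncurryFin_neg (D : E →L[ℝ] E [⋀^Fin k]→L[ℝ] ℂ) :
    ContinuousAlternatingMap.alternatizeUncurryFin (-D) =
      -ContinuousAlternatingMap.alternatizeUncurryFin D := by
  rw [← neg_one_smul ℝ D, ContinuousAlternatingMap.alternatizeUncurryFin_smul, neg_one_smul]

theorem alternatizeUncurryFin_sub (D D' : E →L[ℝ] E [⋀^Fin k]→L[ℝ] ℂ) :
    ContinuousAlternatingMap.alternatizeUncurryFin (D - D') =
      ContinuousAlternatingMap.alternatizeUncurryFin D -
      ContinuousAlternatingMap.alternatizeUncurryFin D' := by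
  rw [sub_eq_add_neg D D', ContinuousAlternatingMap.alternatizeUncurryFin_add,
    alternatizeUncurryFin_neg, sub_eq_add_neg]

theorem contractVec_compContinuousLinearMap {E' : Type*} [NormedAddCommGroup E'] [NormedSpace ℂ E']
    (A : E' →L[ℝ] E) (z : E' × E') (α : E [⋀^Fin (k + 1)]→L[ℝ] ℂ) :
    contractVec z (α.compContinuousLinearMap A) =
      (contractVec (A z.1, A z.2) α).compContinuousLinearMap A := by
  simp only [contractVec, ContinuousAlternatingMap.curryLeft_compContinuousLinearMap]
  rfl

end Contraction

section GradedForms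

variable {E : Type*} [NormedAddCommGroup E] [NormedSpace ℂ E] {k : ℕ}

/-- Inhomogeneous alternating forms on a vector space: the value at a point of a `GForm`. -/
abbrev GAlt (E : Type*) [NormedAddCommGroup E] [NormedSpace ℂ E] :=
  (k : ℕ) → E [⋀^Fin k]→L[ℝ] ℂ

/-- Contraction by a complex vector on inhomogeneous forms. -/
def contrG (z : E × E) : GAlt E →ₗ[ℂ] GAlt E where
  toFun u k := contractVec z (u (k + 1))
  map_add' u v := by funext k; exact contractVec_add z _ _
  map_smul' c u := by funext k; exact contractVec_smul z c _

theorem contrG_apply (z : E × E) (u : GAlt E) (k : ℕ) : contrG z u k = contractVec z (u (k + 1)) :=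
  rfl

theorem contrG_contrG (z w : E × E) (u : GAlt E) :
    contrG z (contrG w u) = -contrG w (contrG z u) := by
  funext k
  exact contractVec_contractVec z w (u (k + 2))

theorem contrG_single (z : E × E) (α : E [⋀^Fin (k + 1)]→L[ℝ] ℂ) :
    contrG z (Pi.single (k + 1) α) = Pi.single k (contractVec z α) := by
  funext j
  rw [contrG_apply]
  by_cases h : j = k
  · subst h; simp
  · rw [Pi.single_eq_of_ne h, Pi.single_eq_of_ne (by omega)]
    exact (contractL z).map_zero

/-- Iterated contraction by a list of complex vectors, the last entry acting first. -/
def contrListG (L : List (E × E)) : GAlt E →ₗ[ℂ] GAlt E :=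
  L.foldr (fun z T => contrG z ∘ₗ T) LinearMap.id

@[simp] theorem contrListG_nil (u : GAlt E) : contrListG [] u = u := rfl

@[simp] theorem contrListG_cons (z : E × E) (L : List (E × E)) (u : GAlt E) :
    contrListG (z :: L) u = contrG z (contrListG L u) := rfl

theorem contrListG_append (L L' : List (E × E)) (u : GAlt E) :
    contrListG (L ++ L') u = contrListG L (contrListG L' u) := by
  induction L with
  | nil => rfl
  | cons z L ih => simp [ih]

theorem contrG_contrListG (z : E × E) (L : List (E × E)) (u : GAlt E) :
    contrG z (contrListG L u) = (-1 : ℤ) ^ L.length • contrListG L (contrG z u) := by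
  induction L with
  | nil => simp
  | cons w L ih =>
    rw [contrListG_cons, contrG_contrG, ih, map_zsmul, contrListG_cons, List.length_cons, pow_succ,
      mul_neg_one, neg_smul]

theorem contrListG_comm (L L' : List (E × E)) (u : GAlt E) :
    contrListG L (contrListG L' u) =
      (-1 : ℤ) ^ (L.length * L'.length) • contrListG L' (contrListG L u) := by
  induction L with
  | nil => simp
  | cons z L ih =>
    rw [contrListG_cons, ih, map_zsmul, contrG_contrListG, smul_smul, contrListG_cons,
      List.length_cons, add_mul, one_mul, pow_add]

/-- The sum `∑ₐ eₐ* ∧ (eₐ ⌟ α)` over a basis and its dual basis is `k α` for a `k`-form `α`;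
together with the antiderivation property this expresses `(N - k) α` as a sum of contractions. -/
theorem exists_eq_sum_contractVec [FiniteDimensional ℂ E] (hk : k < finrank ℝ E)
    (α : E [⋀^Fin k]→L[ℝ] ℂ) :
    ∃ (v : Fin (finrank ℝ E) → E) (β : Fin (finrank ℝ E) → E [⋀^Fin (k + 1)]→L[ℝ] ℂ),
      α = ∑ a, contractVec (v a, 0) (β a) := by
  have : FiniteDimensional ℝ E := FiniteDimensional.complexToReal E
  let e := finBasis ℝ E
  let c : Fin (finrank ℝ E) → E →L[ℝ] ℝ := fun a => (e.coord a).toContinuousLinearMap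
  have hc : ∀ v, ∑ a, c a v • e a = v := fun v => e.sum_repr v
  have hca : ∀ a, c a (e a) = 1 := fun a => by simp [c]
  have hN : (finrank ℝ E : ℝ) - k ≠ 0 := sub_ne_zero.2 (by exact_mod_cast hk.ne')
  -- `∑ₐ eₐ ⌟ (eₐ* ∧ α) = N α - ∑ₐ eₐ* ∧ (eₐ ⌟ α) = (N - k) α`
  refine ⟨e, fun a => ((finrank ℝ E : ℝ) - k)⁻¹ • .alternatizeUncurryFin ((c a).smulRight α), ?_⟩
  have key : ∑ a, contractVec (e a, 0) (.alternatizeUncurryFin ((c a).smulRight α)) =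
      ((finrank ℝ E : ℝ) - k) • α := by
    cases k with
    | zero =>
      simp [contractVec_alternatizeUncurryFin_zero, hca, ← Nat.cast_smul_eq_nsmul ℝ]
    | succ k =>
      have h (a) : (contractL (e a, 0)).comp ((c a).smulRight α) =
          (c a).smulRight (α.curryLeft (e a)) := by
        ext w v; simp [contractVec]
      have h2 : ∑ a, (c a).smulRight (α.curryLeft (e a)) = α.curryLeft := by
        ext w v
        conv_rhs => rw [← hc w]
        simp only [sum_apply, map_sum, map_smul]
        rfl
      have h3 : ∑ a, ContinuousAlternatingMap.alternatizeUncurryFin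
          ((c a).smulRight (α.curryLeft (e a))) = ((k : ℝ) + 1) • α := by
        have := ContinuousAlternatingMap.alternatizeUncurryFin_curryLeft α
        rw [← h2, ← ContinuousAlternatingMap.alternatizeUncurryFinCLM_apply, map_sum] at this
        refine Eq.trans ?_ (this.trans ?_)
        · rfl
        · rw [← Nat.cast_smul_eq_nsmul ℝ]
          push_cast
          rfl
      simp only [contractVec_alternatizeUncurryFin, h, Finset.sum_sub_distrib, h3]
      simp only [ContinuousLinearMap.smulRight_apply, hca, one_smul, map_zero, alternating_smul_zero,
        add_zero, Finset.sum_const, Finset.card_univ, Fintype.card_fin, ← Nat.cast_smul_eq_nsmul ℝ,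
        Nat.cast_add, Nat.cast_one]
      module
  simp only [contractVec_real_smul, ← Finset.smul_sum]
  rw [key, smul_smul, inv_mul_cancel₀ hN, one_smul]

/-- Forms of degree above the dimension vanish. -/
theorem eq_zero_of_finrank_lt [FiniteDimensional ℂ E] (hk : finrank ℝ E < k)
    (α : E [⋀^Fin k]→L[ℝ] ℂ) : α = 0 := by
  have : FiniteDimensional ℝ E := FiniteDimensional.complexToReal E
  ext v
  refine α.toAlternatingMap.map_linearDependent v fun h => ?_
  have := h.fintype_card_le_finrank
  simp at this
  omega

/-- Top-degree forms are proportional. -/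
theorem exists_eq_smul_of_top [FiniteDimensional ℂ E] (hk : k = finrank ℝ E)
    {u : E [⋀^Fin k]→L[ℝ] ℂ} (hu : u ≠ 0) (α : E [⋀^Fin k]→L[ℝ] ℂ) : ∃ c : ℂ, α = c • u := by
  have : FiniteDimensional ℝ E := FiniteDimensional.complexToReal E
  let e : Basis (Fin k) ℝ E := (finBasis ℝ E).reindex (finCongr hk.symm)
  have hext (β γ : E [⋀^Fin k]→L[ℝ] ℂ) (h : β e = γ e) : β = γ := by
    refine ContinuousAlternatingMap.toAlternatingMap_injective
      (Basis.ext_alternating e fun i hi => ?_)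
    let σ : Equiv.Perm (Fin k) := Equiv.ofBijective i (Finite.injective_iff_bijective.1 hi)
    change β.toAlternatingMap (e ∘ σ) = γ.toAlternatingMap (e ∘ σ)
    rw [AlternatingMap.map_perm, AlternatingMap.map_perm]
    exact congrArg _ h
  have he : u e ≠ 0 := fun h => hu (hext u 0 (by simpa using h))
  exact ⟨α e / u e, hext _ _ (by simp [he])⟩

/-- An operator on forms which is a combination of iterated contractions, all of the same length,
and kills a nonzero top-degree form, is zero: it commutes up to sign with contractions, and
contractions generate all forms from a top-degree one. -/
theorem contrListG_sum_eq_zero [FiniteDimensional ℂ E] {ι : Type*} (s : Finset ι) (c : ι → ℤ)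
    (L : ι → List (E × E)) (n : ℕ) (hL : ∀ a ∈ s, (L a).length = n)
    (hk : k = finrank ℝ E) {u : E [⋀^Fin k]→L[ℝ] ℂ} (hu : u ≠ 0)
    (h : ∑ a ∈ s, c a • contrListG (L a) (Pi.single k u) = 0) {j : ℕ} (w : E [⋀^Fin j]→L[ℝ] ℂ) :
    ∑ a ∈ s, c a • contrListG (L a) (Pi.single j w) = 0 := by
  set X : GAlt E →ₗ[ℂ] GAlt E := ∑ a ∈ s, c a • contrListG (L a) with hX
  have hXa (v : GAlt E) : X v = ∑ a ∈ s, c a • contrListG (L a) v := by simp [hX]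
  have hcomm (z : E × E) (v : GAlt E) (hv : X v = 0) : X (contrG z v) = 0 := by
    have h1 : contrG z (X v) = (-1 : ℤ) ^ n • X (contrG z v) := by
      rw [hXa, hXa, map_sum, Finset.smul_sum]
      refine Finset.sum_congr rfl fun a ha => ?_
      rw [map_zsmul, contrG_contrListG, hL a ha, smul_comm]
    rw [hv, map_zero] at h1
    have h2 := congrArg (fun t => (-1 : ℤ) ^ n • t) h1
    simp only [smul_smul, ← mul_pow, neg_mul_neg, one_mul, one_pow, one_smul] at h2
    exact h2.symm.trans (zsmul_zero _)
  rw [← hXa] at h ⊢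
  rcases lt_or_ge (finrank ℝ E) j with hj | hj
  · rw [eq_zero_of_finrank_lt hj w, Pi.single_zero, map_zero]
  -- descending induction on the degree `j`, starting from the top degree
  obtain ⟨i, hi⟩ := Nat.exists_eq_add_of_le hj
  induction i generalizing j with
  | zero =>
    obtain rfl : j = k := by omega
    obtain ⟨a, rfl⟩ := exists_eq_smul_of_top hk hu w
    have : (Pi.single j (a • u) : GAlt E) = a • (Pi.single j u : GAlt E) :=
      Pi.single_smul (f := fun k => E [⋀^Fin k]→L[ℝ] ℂ) j a u
    rw [this, map_smul, h]
    funext i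
    exact alternating_smul_zero a
  | succ i ih =>
    obtain ⟨v, β, rfl⟩ := exists_eq_sum_contractVec (by omega) w
    have : (Pi.single j (∑ a, contractVec (v a, 0) (β a)) : GAlt E) =
        ∑ a, contrG (v a, 0) (Pi.single (j + 1) (β a)) := by
      simp only [contrG_single]
      exact map_sum (AddMonoidHom.single (fun k => E [⋀^Fin k]→L[ℝ] ℂ) j) _ _
    rw [this, map_sum]
    exact Finset.sum_eq_zero fun a _ => hcomm _ _ (ih (β a) (by omega) (by omega))

end GradedForms

/-! ### Parts of pure type and the operators `∂`, `∂̄` on `E` -/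

section TypeParts

variable {E : Type*} [NormedAddCommGroup E] [NormedSpace ℂ E] {k : ℕ} {ε : ℝ}

/-- The complex-linear (`ε = 1`) or antilinear (`ε = -1`) part of a real-linear map. -/
def typePart (ε : ℝ) {V : Type*} [NormedAddCommGroup V] [NormedSpace ℝ V] [Module ℂ V]
    [ContinuousConstSMul ℂ V] [SMulCommClass ℝ ℂ V] (D : E →L[ℝ] V) : E →L[ℝ] V :=
  (1 / 2 : ℂ) • (D - ((ε : ℂ) * Complex.I) • D.comp J)

/-- The complex tangent vector of type `(1,0)` (`ε = 1`) or `(0,1)` (`ε = -1`) given by `v`. -/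
def typeVec (ε : ℝ) (v : E) : E × E := ((1 / 2 : ℝ) • v, -((ε / 2 : ℝ) • (Complex.I • v)))

theorem typeVec_one (v : E) : typeVec 1 v = holVec v := by simp [typeVec, holVec]

theorem typeVec_neg_one (v : E) : typeVec (-1) v = conjVec (holVec v) := by
  simp only [typeVec, conjVec, holVec]
  congr 2
  module

theorem typePart_one (D : E →L[ℝ] E [⋀^Fin k]→L[ℝ] ℂ) : typePart 1 D = linPart D := by
  simp [typePart, linPart]

theorem typePart_neg_one (D : E →L[ℝ] E [⋀^Fin k]→L[ℝ] ℂ) : typePart (-1) D = antilinPart D := by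
  simp [typePart, antilinPart]

/-- `typeVec ε` as a continuous linear map. -/
def typeVecL (ε : ℝ) : E →L[ℝ] E × E :=
  ((1 / 2 : ℝ) • ContinuousLinearMap.id ℝ E).prod (-((ε / 2 : ℝ) • J))

theorem typeVecL_apply (v : E) : typeVecL ε v = typeVec ε v := rfl

theorem typeVec_I_smul (hε : ε * ε = 1) (v : E) :
    typeVec ε (Complex.I • v) = ε • mulIVec (typeVec ε v) := by
  simp only [typeVec, mulIVec, Prod.smul_mk, neg_neg, smul_smul]
  congr 1
  · rw [mul_div_assoc', hε]
  · rw [Complex.I_mul_I, ← Complex.coe_smul, ← Complex.coe_smul, smul_smul, ← neg_smul]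
    congr 1
    push_cast
    ring

@[simp] theorem alternating_zero_apply (w : Fin k → E) : (0 : E [⋀^Fin k]→L[ℝ] ℂ) w = 0 := rfl

theorem alternating_coe_smul (r : ℝ) (α : E [⋀^Fin k]→L[ℝ] ℂ) : (r : ℂ) • α = r • α := by
  ext
  simp

theorem contractVec_smul_left (r : ℝ) (z : E × E) (α : E [⋀^Fin (k + 1)]→L[ℝ] ℂ) :
    contractVec (r • z) α = r • contractVec z α :=
  (contractR α).map_smul r z

theorem contractVec_typeVec_I_smul (hε : ε * ε = 1) (v : E) (α : E [⋀^Fin (k + 1)]→L[ℝ] ℂ) :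
    contractVec (typeVec ε (Complex.I • v)) α =
      ((ε : ℂ) * Complex.I) • contractVec (typeVec ε v) α := by
  rw [typeVec_I_smul hε, contractVec_smul_left, contractVec_mulIVec, mul_smul,
    alternating_coe_smul]

theorem typePart_apply (D : E →L[ℝ] E [⋀^Fin k]→L[ℝ] ℂ) (v : E) :
    typePart ε D v = (1 / 2 : ℂ) • (D v - ((ε : ℂ) * Complex.I) • D (Complex.I • v)) := rfl

theorem typePart_add (D D' : E →L[ℝ] E [⋀^Fin k]→L[ℝ] ℂ) :
    typePart ε (D + D') = typePart ε D + typePart ε D' := by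
  ext1 v
  simp only [typePart_apply, add_apply]
  module

theorem typePart_contractL (z : E × E) (D : E →L[ℝ] E [⋀^Fin (k + 1)]→L[ℝ] ℂ) :
    typePart ε ((contractL z).comp D) = (contractL z).comp (typePart ε D) := by
  ext1 v
  simp only [typePart_apply, ContinuousLinearMap.comp_apply, contractL_apply, contractVec_smul,
    sub_eq_add_neg, contractVec_add, contractVec_neg]

/-- On a vector of type `ε` a real-linear map agrees with its part of type `ε`. -/
theorem typePart_typeVec (hε : ε * ε = 1) (D : E →L[ℝ] E [⋀^Fin k]→L[ℝ] ℂ) (v : E) :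
    typePart ε D (typeVec ε v).1 + Complex.I • typePart ε D (typeVec ε v).2 =
      D (typeVec ε v).1 + Complex.I • D (typeVec ε v).2 := by
  have h : (ε : ℂ) * ε = 1 := by exact_mod_cast hε
  simp only [typeVec, map_neg, smul_neg, map_smul, typePart_apply, smul_smul Complex.I Complex.I v,
    Complex.I_mul_I, neg_one_smul]
  ext w
  simp only [ContinuousAlternatingMap.add_apply, ContinuousAlternatingMap.sub_apply,
    ContinuousAlternatingMap.neg_apply, ContinuousAlternatingMap.smul_apply, smul_eq_mul,
    Complex.real_smul]
  push_cast
  linear_combination (-(ε : ℂ) ^ 2 * D v w / 4) * Complex.I_mul_I + (D v w / 4) * h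

/-- On a vector of type `-ε` the part of type `ε` vanishes. -/
theorem typePart_typeVec_neg (hε : ε * ε = 1) (D : E →L[ℝ] E [⋀^Fin k]→L[ℝ] ℂ) (v : E) :
    typePart ε D (typeVec (-ε) v).1 + Complex.I • typePart ε D (typeVec (-ε) v).2 = 0 := by
  have h : (ε : ℂ) * ε = 1 := by exact_mod_cast hε
  simp only [typeVec, map_neg, smul_neg, map_smul, typePart_apply, smul_smul Complex.I Complex.I v,
    Complex.I_mul_I, neg_one_smul]
  ext w
  simp only [ContinuousAlternatingMap.add_apply, ContinuousAlternatingMap.sub_apply,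
    ContinuousAlternatingMap.neg_apply, ContinuousAlternatingMap.smul_apply, smul_eq_mul,
    Complex.real_smul, alternating_zero_apply]
  push_cast
  linear_combination ((ε : ℂ) ^ 2 * D v w / 4) * Complex.I_mul_I + (-D v w / 4) * h

/-- The derivative of a field of type `-ε` which is the image of a field with complex-linear
derivative has vanishing part of type `ε`. -/
theorem typePart_contractR_typeVecL (hε : ε * ε = 1) (α : E [⋀^Fin (k + 1)]→L[ℝ] ℂ)
    (L : E →L[ℂ] E) :
    typePart ε ((contractR α).comp ((typeVecL (-ε)).comp (L.restrictScalars ℝ))) = 0 := by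
  have h : (ε : ℂ) * ε = 1 := by exact_mod_cast hε
  ext1 v
  simp only [typePart_apply, ContinuousLinearMap.comp_apply, contractR_apply, typeVecL_apply,
    ContinuousLinearMap.coe_restrictScalars', map_smul]
  rw [contractVec_typeVec_I_smul (by linarith), smul_smul]
  ext w
  simp only [ContinuousAlternatingMap.sub_apply, ContinuousAlternatingMap.smul_apply, smul_eq_mul,
    zero_apply, alternating_zero_apply]
  push_cast
  linear_combination (contractVec (typeVec (-ε) (L v)) α w / 2) * ((ε : ℂ) ^ 2 * Complex.I_mul_I - h)

end TypeParts

section LocalCalculus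

variable {E : Type*} [NormedAddCommGroup E] [NormedSpace ℂ E] {k m : ℕ} {ε : ℝ}

theorem isBoundedBilinearMap_contractVec :
    IsBoundedBilinearMap ℝ
      (fun p : (E × E) × (E [⋀^Fin (k + 1)]→L[ℝ] ℂ) => contractVec p.1 p.2) where
  add_left := contractVec_add_left
  smul_left := contractVec_smul_left
  add_right := contractVec_add
  smul_right c z α := contractVec_real_smul z c α
  bound := by
    refine ⟨2, two_pos, fun z α => ?_⟩
    have h (v : E) : ‖α.curryLeft v‖ ≤ ‖α‖ * ‖v‖ := by
      have := α.curryLeft.le_opNorm v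
      rwa [α.norm_curryLeft] at this
    calc ‖contractVec z α‖ ≤ ‖α.curryLeft z.1‖ + ‖Complex.I • α.curryLeft z.2‖ := norm_add_le _ _
      _ ≤ ‖α‖ * ‖z‖ + ‖α‖ * ‖z‖ := by
        rw [norm_smul, Complex.norm_I, one_mul]
        gcongr
        · exact (h z.1).trans (by gcongr; exact norm_fst_le z)
        · exact (h z.2).trans (by gcongr; exact norm_snd_le z)
      _ = 2 * ‖z‖ * ‖α‖ := by ring

theorem hasFDerivAt_contractVec {Z : E → E × E} {β : E → E [⋀^Fin (k + 1)]→L[ℝ] ℂ} {z : E}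
    (hZ : DifferentiableAt ℝ Z z) (hβ : DifferentiableAt ℝ β z) :
    HasFDerivAt (fun y => contractVec (Z y) (β y))
      ((contractL (Z z)).comp (fderiv ℝ β z) + (contractR (β z)).comp (fderiv ℝ Z z)) z := by
  have h := (isBoundedBilinearMap_contractVec (E := E) (k := k)).hasFDerivAt (Z z, β z)
  refine (h.comp z (hZ.hasFDerivAt.prodMk hβ.hasFDerivAt)).congr_fderiv ?_
  ext v w
  simp

theorem contDiffOn_contractVec {Z : E → E × E} {β : E → E [⋀^Fin (k + 1)]→L[ℝ] ℂ} {s : Set E}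
    {n : ℕ∞ω} (hZ : ContDiffOn ℝ n Z s) (hβ : ContDiffOn ℝ n β s) :
    ContDiffOn ℝ n (fun y => contractVec (Z y) (β y)) s := by
  have h : ContDiff ℝ n (fun p : (E × E) × (E [⋀^Fin (k + 1)]→L[ℝ] ℂ) => contractVec p.1 p.2) :=
    isBoundedBilinearMap_contractVec.contDiff
  exact h.comp_contDiffOn (f := fun y => (Z y, β y)) (hZ.prodMk hβ)

/-- The operator `∂` (`ε = 1`) or `∂̄` (`ε = -1`) on inhomogeneous forms on `E`. -/
def dolbeault (ε : ℝ) (b : E → GAlt E) (z : E) : GAlt E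
  | 0 => 0
  | k + 1 => .alternatizeUncurryFin (typePart ε (fderiv ℝ (fun y => b y k) z))

/-- Contraction of an inhomogeneous form on `E` by a complex vector field. -/
def contrField (Z : E → E × E) (b : E → GAlt E) (y : E) : GAlt E := contrG (Z y) (b y)

/-- The Lie derivative `Z ⌟ ∂b + ∂(Z ⌟ b)` (or its analogue for `∂̄`). -/
def dolbeaultLie (ε : ℝ) (Z : E → E × E) (b : E → GAlt E) (z : E) : GAlt E :=
  contrG (Z z) (dolbeault ε b z) + dolbeault ε (contrField Z b) z

/-- The bracket of complex vector fields on `E`. -/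
def localBracket (Z W : E → E × E) (z : E) : E × E :=
  (fderiv ℝ W z (Z z).1 + mulIVec (fderiv ℝ W z (Z z).2)) -
    (fderiv ℝ Z z (W z).1 + mulIVec (fderiv ℝ Z z (W z).2))

theorem dolbeaultLie_zero (hε : ε * ε = 1) {Z : E → E × E} {b : E → GAlt E} {z v : E}
    (hZ : Z z = typeVec ε v) :
    dolbeaultLie ε Z b z 0 = fderiv ℝ (fun y => b y 0) z (Z z).1 +
      Complex.I • fderiv ℝ (fun y => b y 0) z (Z z).2 := by
  simp only [dolbeaultLie, Pi.add_apply, contrG_apply, dolbeault, add_zero]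
  rw [contractVec_alternatizeUncurryFin_zero, hZ, typePart_typeVec hε]

/-- `L_Z b` is the derivative of `b` along `Z` plus a term of order zero, in which the derivative
of `Z` acts on the value of `b`. -/
theorem dolbeaultLie_succ (hε : ε * ε = 1) {Z : E → E × E} {b : E → GAlt E} {z v : E}
    (hb : ∀ k, DifferentiableAt ℝ (fun y => b y k) z)
    (hZd : DifferentiableAt ℝ Z z) (hZ : Z z = typeVec ε v) (k : ℕ) :
    dolbeaultLie ε Z b z (k + 1) = fderiv ℝ (fun y => b y (k + 1)) z (Z z).1 +
      Complex.I • fderiv ℝ (fun y => b y (k + 1)) z (Z z).2 +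
      .alternatizeUncurryFin (typePart ε ((contractR (b z (k + 1))).comp (fderiv ℝ Z z))) := by
  simp only [dolbeaultLie, Pi.add_apply, contrG_apply, dolbeault, contrField]
  rw [contractVec_alternatizeUncurryFin, (hasFDerivAt_contractVec hZd (hb (k + 1))).fderiv,
    typePart_add, typePart_contractL, ContinuousAlternatingMap.alternatizeUncurryFin_add]
  have h := typePart_typeVec hε (fderiv ℝ (fun y => b y (k + 1)) z) v
  rw [← hZ] at h
  rw [h]
  abel

theorem contractVec_localBracket (Z W : E → E × E) (z : E) (α : E [⋀^Fin (k + 1)]→L[ℝ] ℂ) :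
    contractVec (localBracket Z W z) α =
      contractVec (fderiv ℝ W z (Z z).1) α + Complex.I • contractVec (fderiv ℝ W z (Z z).2) α -
      (contractVec (fderiv ℝ Z z (W z).1) α + Complex.I • contractVec (fderiv ℝ Z z (W z).2) α) := by
  rw [localBracket, contractVec_sub_left, contractVec_add_left, contractVec_add_left,
    contractVec_mulIVec, contractVec_mulIVec]

/-- The commutation rule `[L_Z, W ⌟] = [Z, W] ⌟` for fields of the same type. -/
theorem contrG_dolbeaultLie (hε : ε * ε = 1) {Z W : E → E × E} {b : E → GAlt E} {z v w : E}
    (hb : ∀ k, DifferentiableAt ℝ (fun y => b y k) z)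
    (hZd : DifferentiableAt ℝ Z z) (hZ : Z z = typeVec ε v)
    (hWd : DifferentiableAt ℝ W z) (hW : W z = typeVec ε w) :
    contrG (W z) (dolbeaultLie ε Z b z) =
      dolbeaultLie ε Z (contrField W b) z - contrG (localBracket Z W z) (b z) := by
  have hWb (k) : DifferentiableAt ℝ (fun y => contrField W b y k) z :=
    (hasFDerivAt_contractVec hWd (hb (k + 1))).differentiableAt
  funext k
  rw [contrG_apply, dolbeaultLie_succ hε hb hZd hZ, Pi.sub_apply, contrG_apply,
    contractVec_localBracket, contractVec_add, contractVec_add, contractVec_smul]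
  have hf : fderiv ℝ (fun y => contrField W b y k) z =
      (contractL (W z)).comp (fderiv ℝ (fun y => b y (k + 1)) z) +
      (contractR (b z (k + 1))).comp (fderiv ℝ W z) :=
    (hasFDerivAt_contractVec hWd (hb (k + 1))).fderiv
  cases k with
  | zero =>
    rw [dolbeaultLie_zero hε hZ, contractVec_alternatizeUncurryFin_zero, hf]
    have h := typePart_typeVec hε ((contractR (b z (0 + 1))).comp (fderiv ℝ Z z)) w
    rw [← hW] at h
    rw [h]
    simp only [add_apply, ContinuousLinearMap.comp_apply, contractL_apply, contractR_apply]
    module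
  | succ k =>
    rw [dolbeaultLie_succ hε hWb hZd hZ, contractVec_alternatizeUncurryFin, hf]
    have h2 : (contractL (W z)).comp (typePart ε ((contractR (b z (k + 1 + 1))).comp
        (fderiv ℝ Z z))) =
        -typePart ε ((contractR (contrField W b z (k + 1))).comp (fderiv ℝ Z z)) := by
      rw [← typePart_contractL]
      have : (contractL (W z)).comp ((contractR (b z (k + 1 + 1))).comp (fderiv ℝ Z z)) =
          -(contractR (contrField W b z (k + 1))).comp (fderiv ℝ Z z) := by
        ext1 v
        exact contractVec_contractVec _ _ _
      rw [this]
      ext1 v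
      simp only [typePart_apply, neg_apply]
      module
    rw [h2, alternatizeUncurryFin_neg]
    have h := typePart_typeVec hε ((contractR (b z (k + 1 + 1))).comp (fderiv ℝ Z z)) w
    rw [← hW] at h
    rw [h]
    simp only [add_apply, ContinuousLinearMap.comp_apply, contractL_apply, contractR_apply]
    module

/-- Contraction by the conjugate of a holomorphic field anticommutes with `∂`. -/
theorem contrG_dolbeault_of_opposite (hε : ε * ε = 1) {η : E → E} {b : E → GAlt E} {z : E}
    (hb : ∀ k, DifferentiableAt ℝ (fun y => b y k) z) (hη : DifferentiableAt ℂ η z) :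
    contrG (typeVec (-ε) (η z)) (dolbeault ε b z) =
      -dolbeault ε (contrField (fun y => typeVec (-ε) (η y)) b) z := by
  have hd : HasFDerivAt (fun y => typeVec (-ε) (η y))
      ((typeVecL (-ε)).comp ((fderiv ℂ η z).restrictScalars ℝ)) z :=
    (typeVecL (E := E) (-ε)).hasFDerivAt.comp z (hη.hasFDerivAt.restrictScalars ℝ)
  funext k
  rw [contrG_apply, Pi.neg_apply]
  cases k with
  | zero =>
    simp only [dolbeault]
    rw [contractVec_alternatizeUncurryFin_zero, typePart_typeVec_neg hε, neg_zero]
  | succ k =>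
    simp only [dolbeault, contrField, contrG_apply]
    rw [contractVec_alternatizeUncurryFin, typePart_typeVec_neg hε,
      (hasFDerivAt_contractVec hd.differentiableAt (hb (k + 1))).fderiv, typePart_add,
      typePart_contractL, hd.fderiv, typePart_contractR_typeVecL hε, add_zero, zero_sub]

/-- A holomorphic field commutes with the conjugate of a holomorphic field. -/
theorem localBracket_typeVec_opposite (hε : ε * ε = 1) {ξ η : E → E} {z : E}
    (hξ : DifferentiableAt ℂ ξ z) (hη : DifferentiableAt ℂ η z) :
    localBracket (fun y => typeVec ε (ξ y)) (fun y => typeVec (-ε) (η y)) z = 0 := by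
  have hd (δ : ℝ) {ζ : E → E} (hζ : DifferentiableAt ℂ ζ z) :
      HasFDerivAt (fun y => typeVec δ (ζ y))
        ((typeVecL δ).comp ((fderiv ℂ ζ z).restrictScalars ℝ)) z :=
    (typeVecL (E := E) δ).hasFDerivAt.comp z (hζ.hasFDerivAt.restrictScalars ℝ)
  have key (δ : ℝ) (hδ : δ * δ = 1) (L : E →L[ℂ] E) (v : E) :
      typeVec (-δ) (L (typeVec δ v).1) + mulIVec (typeVec (-δ) (L (typeVec δ v).2)) = 0 := by
    have h1 : (typeVec δ v).2 = (-δ) • Complex.I • (typeVec δ v).1 := by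
      simp only [typeVec]
      rw [smul_comm Complex.I, smul_smul, ← neg_smul]
      congr 1
      ring
    have h2 (r : ℝ) (v : E) : typeVec (-δ) (r • v) = r • typeVec (-δ) v :=
      (typeVecL (-δ)).map_smul r v
    have h3 : L ((-δ) • Complex.I • (typeVec δ v).1) =
        (-δ) • Complex.I • L (typeVec δ v).1 := by
      rw [← Complex.coe_smul, map_smul, map_smul, Complex.coe_smul]
    rw [h1, h3, h2, typeVec_I_smul (by linarith), smul_smul]
    rw [show -δ * -δ = 1 by linarith, one_smul, show mulIVec (mulIVec _) = -_ from rfl, add_neg_cancel]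
  rw [localBracket, (hd ε hξ).fderiv, (hd (-ε) hη).fderiv]
  have h1 := key ε hε (fderiv ℂ η z) (ξ z)
  have h2 := key (-ε) (by linarith) (fderiv ℂ ξ z) (η z)
  rw [neg_neg] at h2
  exact (congrArg₂ (· - ·) h1 h2).trans (sub_zero 0)

end LocalCalculus

/-! ### Iterated contraction of `∂b` -/

section IteratedContraction

variable {E : Type*} [NormedAddCommGroup E] [NormedSpace ℂ E] {k m : ℕ} {ε : ℝ}

/-- The list `Z_m, …, Z_1` with the entries failing `p` omitted. -/
def descList {α : Type*} {m : ℕ} (Z : Fin m → α) (p : Fin m → Bool) : List α :=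
  ((List.finRange m).reverse.filter p).map Z

theorem descList_succ {α : Type*} (Z : Fin (m + 1) → α) (p : Fin (m + 1) → Bool) :
    descList Z p = (if p (Fin.last m) then [Z (Fin.last m)] else []) ++
      descList (fun i => Z i.castSucc) (fun i => p i.castSucc) := by
  simp only [descList, List.finRange_succ_last, List.reverse_append, List.reverse_cons,
    List.reverse_nil, List.nil_append, List.filter_append, List.map_append]
  congr 1
  · by_cases h : p (Fin.last m) <;> simp [h]
  · rw [← List.map_reverse, List.filter_map, List.map_map]
    rfl

theorem map_descList {α β : Type*} (g : α → β) (Z : Fin m → α) (p : Fin m → Bool) :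
    (descList Z p).map g = descList (fun i => g (Z i)) p := by
  simp [descList]

theorem length_descList_true {α : Type*} (Z : Fin m → α) :
    (descList Z (fun _ => true)).length = m := by
  simp [descList]

/-- Iterated contraction of an inhomogeneous form on `E` by complex vector fields. -/
def contrFields (L : List (E → E × E)) (b : E → GAlt E) (y : E) : GAlt E :=
  contrListG (L.map (fun Z => Z y)) (b y)

theorem contrFields_cons (Z : E → E × E) (L : List (E → E × E)) (b : E → GAlt E) :
    contrFields (Z :: L) b = contrField Z (contrFields L b) := rfl

theorem differentiableAt_contrFields {L : List (E → E × E)} {b : E → GAlt E} {z : E}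
    (hL : ∀ Z ∈ L, DifferentiableAt ℝ Z z) (hb : ∀ k, DifferentiableAt ℝ (fun y => b y k) z)
    (k : ℕ) : DifferentiableAt ℝ (fun y => contrFields L b y k) z := by
  induction L generalizing k with
  | nil => exact hb k
  | cons Z L ih =>
    exact (hasFDerivAt_contractVec (hL Z (by simp))
      (ih (fun Z hZ => hL Z (by simp [hZ])) (k + 1))).differentiableAt

theorem localBracket_swap (Z W : E → E × E) (z : E) :
    localBracket Z W z = -localBracket W Z z := by
  simp [localBracket]

theorem mem_descList {α : Type*} {Z : Fin m → α} {p : Fin m → Bool} {a : α}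
    (h : a ∈ descList Z p) : ∃ i, Z i = a := by
  simp only [descList, List.mem_map] at h
  obtain ⟨i, -, hi⟩ := h
  exact ⟨i, hi⟩

theorem sum_lt_castSucc {G : Type*} [AddCommMonoid G] (f : Fin (m + 1) → Fin (m + 1) → G) :
    ∑ s, ∑ r ∈ Finset.univ.filter (fun r => r < s), f s r =
      ∑ s : Fin m, ∑ r ∈ Finset.univ.filter (fun r : Fin m => r < s), f s.castSucc r.castSucc +
      ∑ r : Fin m, f (Fin.last m) r.castSucc := by
  have c2 (s : Fin m) : ¬ Fin.last m < s.castSucc := by simp [Fin.le_last]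
  simp only [Finset.sum_filter, Fin.sum_univ_castSucc, Fin.castSucc_lt_castSucc_iff,
    Fin.castSucc_lt_last, if_true, lt_irrefl, if_false, add_zero, c2]

/-- Moving `∂` through an iterated contraction by fields of type `(1,0)`: besides the term with
`∂` on the outside there are Lie derivatives along each field and one contraction by the bracket of
each pair of fields. -/
theorem contrListG_dolbeault (hε : ε * ε = 1) (Z : Fin m → E → E × E) {b : E → GAlt E} {z : E}
    (hb : ∀ k, DifferentiableAt ℝ (fun y => b y k) z)
    (hZd : ∀ i, DifferentiableAt ℝ (Z i) z) (hZ : ∀ i, ∃ v, Z i z = typeVec ε v) :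
    contrListG (descList (fun i => Z i z) (fun _ => true)) (dolbeault ε b z) =
      (-1 : ℤ) ^ m • dolbeault ε (contrFields (descList Z (fun _ => true)) b) z +
      ∑ s : Fin m, (-1 : ℤ) ^ (s : ℕ) •
        dolbeaultLie ε (Z s) (contrFields (descList Z (fun i => i ≠ s)) b) z +
      (-1 : ℤ) ^ m • ∑ s : Fin m, ∑ r ∈ Finset.univ.filter (fun r : Fin m => r < s),
        (-1 : ℤ) ^ ((s : ℕ) + 1 + ((r : ℕ) + 1) + 1) •
          contrListG (localBracket (Z s) (Z r) z ::
            descList (fun i => Z i z) (fun i => i ≠ s ∧ i ≠ r)) (b z) := by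
  induction m with
  | zero => simp [descList]; rfl
  | succ m ih =>
    obtain ⟨v, hv⟩ := hZ (Fin.last m)
    set T := Z (Fin.last m) with hT
    set Y : Fin m → E → E × E := fun i => Z i.castSucc with hY
    have hd (p : Fin m → Bool) (k : ℕ) :
        DifferentiableAt ℝ (fun y => contrFields (descList Y p) b y k) z :=
      differentiableAt_contrFields
        (fun W hW => by obtain ⟨i, rfl⟩ := mem_descList hW; exact hZd _) hb k
    have e1 : descList (fun i => Z i z) (fun _ => true) =
        T z :: descList (fun i => Y i z) (fun _ => true) := by rw [descList_succ]; rfl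
    have e2 : descList Z (fun _ => true) = T :: descList Y (fun _ => true) := by
      rw [descList_succ]; rfl
    have e3 (s : Fin m) : descList Z (fun i => i ≠ s.castSucc) =
        T :: descList Y (fun i => i ≠ s) := by
      rw [descList_succ]; simp [hT, hY, (Fin.castSucc_lt_last s).ne']
    have e4 : descList Z (fun i => i ≠ Fin.last m) = descList Y (fun _ => true) := by
      rw [descList_succ]; simp [hY]
    have e5 (s r : Fin m) : descList (fun i => Z i z) (fun i => i ≠ s.castSucc ∧ i ≠ r.castSucc) =
        T z :: descList (fun i => Y i z) (fun i => i ≠ s ∧ i ≠ r) := by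
      rw [descList_succ]
      simp [hT, hY, (Fin.castSucc_lt_last s).ne', (Fin.castSucc_lt_last r).ne']
    have e6 (r : Fin m) : descList (fun i => Z i z) (fun i => i ≠ Fin.last m ∧ i ≠ r.castSucc) =
        descList (fun i => Y i z) (fun i => i ≠ r) := by
      rw [descList_succ]; simp [hY]
    -- contracting each of the three kinds of terms by the new last field `T`
    have t1 : contrG (T z) (dolbeault ε (contrFields (descList Y (fun _ => true)) b) z) =
        dolbeaultLie ε T (contrFields (descList Y (fun _ => true)) b) z -
        dolbeault ε (contrFields (T :: descList Y (fun _ => true)) b) z := by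
      rw [dolbeaultLie, contrFields_cons, add_sub_cancel_right]
    have t2 (s : Fin m) : contrG (T z)
        (dolbeaultLie ε (Y s) (contrFields (descList Y (fun i => i ≠ s)) b) z) =
        dolbeaultLie ε (Y s) (contrFields (T :: descList Y (fun i => i ≠ s)) b) z +
        contrListG (localBracket T (Y s) z :: descList (fun i => Y i z) (fun i => i ≠ s)) (b z) := by
      obtain ⟨w, hw⟩ := hZ s.castSucc
      rw [contrG_dolbeaultLie hε (hd _) (hZd _) hw (hZd _) hv, contrFields_cons, localBracket_swap,
        contrListG_cons, sub_eq_add_neg]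
      congr 1
      funext k
      simp only [Pi.neg_apply, contrG_apply, contractVec_neg_left, neg_neg, contrFields,
        map_descList]
      rfl
    have t3 (s r : Fin m) : contrG (T z) (contrListG (localBracket (Y s) (Y r) z ::
            descList (fun i => Y i z) (fun i => i ≠ s ∧ i ≠ r)) (b z)) =
        -contrListG (localBracket (Y s) (Y r) z :: T z ::
            descList (fun i => Y i z) (fun i => i ≠ s ∧ i ≠ r)) (b z) := by
      rw [contrListG_cons, contrG_contrG]; rfl
    rw [e1, e2, contrListG_cons, ih Y (fun i => hZd _) (fun i => hZ _), sum_lt_castSucc,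
      Fin.sum_univ_castSucc, map_add, map_add, map_zsmul, map_zsmul, map_sum, map_sum, t1]
    simp only [map_zsmul, map_sum, t2, t3, e3, e4, e5, e6, Fin.val_castSucc, Fin.val_last]
    set A := dolbeault ε (contrFields (T :: descList Y fun x => true) b) z
    set C := dolbeaultLie ε T (contrFields (descList Y fun x => true) b) z
    -- the sign of the bracket terms containing the new last field
    have c1 (r : Fin m) (Q : GAlt E) : (-1 : ℤ) ^ (m + 1 + ((r : ℕ) + 1) + 1) • Q =
        -((-1 : ℤ) ^ m • (-1 : ℤ) ^ (r : ℕ) • Q) := by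
      rw [smul_smul, ← neg_smul]
      congr 1
      ring
    have c3 (Q : GAlt E) : (-1 : ℤ) ^ (m + 1) • Q = -((-1 : ℤ) ^ m • Q) := by
      rw [pow_succ, mul_neg_one, neg_smul]
    have c4 (Q : GAlt E) : (-1 : ℤ) ^ m • (-1 : ℤ) ^ m • Q = Q := by
      rw [smul_smul, ← mul_pow]; simp
    simp only [c1, c3, smul_add, smul_sub, smul_neg, Finset.sum_neg_distrib,
      Finset.sum_add_distrib, ← Finset.smul_sum, neg_neg, neg_add, c4]
    abel

end IteratedContraction

/-! ### Transition maps of the preferred charts -/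

section Charts

set_option linter.unusedSectionVars false

variable {E S : Type*} [NormedAddCommGroup E] [NormedSpace ℂ E]
  [TopologicalSpace S] [ChartedSpace E S]

/-- The transition map from the preferred chart at `x₀` to the preferred chart at `x₁`. -/
def trans (x₀ x₁ : S) : E → E := fun z => chartAt E x₁ ((chartAt E x₀).symm z)

/-- The domain of the transition map `trans x₀ x₁`. -/
def transDomain (E : Type*) [NormedAddCommGroup E] {S : Type*} [TopologicalSpace S]
    [ChartedSpace E S] (x₀ x₁ : S) : Set E :=
  (chartAt E x₀).target ∩ (chartAt E x₀).symm ⁻¹' (chartAt E x₁).source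

theorem isOpen_transDomain (x₀ x₁ : S) : IsOpen (transDomain E x₀ x₁) :=
  (chartAt E x₀).isOpen_inter_preimage_symm (chartAt E x₁).open_source

theorem symm_trans {x₀ x₁ : S} {z : E} (hz : z ∈ transDomain E x₀ x₁) :
    (chartAt E x₁).symm (trans x₀ x₁ z) = (chartAt E x₀).symm z :=
  (chartAt E x₁).left_inv hz.2

theorem trans_mem {x₀ x₁ : S} {z : E} (hz : z ∈ transDomain E x₀ x₁) :
    trans x₀ x₁ z ∈ transDomain E x₁ x₀ := by
  refine ⟨(chartAt E x₁).map_source hz.2, ?_⟩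
  rw [Set.mem_preimage, symm_trans hz]
  exact (chartAt E x₀).map_target hz.1

theorem trans_trans {x₀ x₁ x₂ : S} {z : E} (hz : z ∈ transDomain E x₀ x₁) :
    trans x₁ x₂ (trans x₀ x₁ z) = trans x₀ x₂ z := by
  rw [trans, symm_trans hz]
  rfl

theorem trans_self {x₀ : S} {z : E} (hz : z ∈ (chartAt E x₀).target) : trans x₀ x₀ z = z :=
  (chartAt E x₀).right_inv hz

theorem mem_transDomain_self {x₀ : S} {z : E} (hz : z ∈ (chartAt E x₀).target) :
    z ∈ transDomain E x₀ ((chartAt E x₀).symm z) :=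
  ⟨hz, mem_chart_source E _⟩

section

variable [IsManifold 𝓘(ℂ, E) ω S]

theorem contDiffOn_trans_complex (x₀ x₁ : S) :
    ContDiffOn ℂ ω (trans x₀ x₁) (transDomain E x₀ x₁) := by
  have := contDiffOn_ext_coord_change (I := 𝓘(ℂ, E)) (n := ω) x₁ x₀
  simp only [mfld_simps] at this
  exact this

/-- The underlying real analytic manifold. -/
theorem isManifold_real : IsManifold 𝓘(ℝ, E) ω S := by
  refine isManifold_of_contDiffOn _ _ _ fun e e' he he' => ?_
  have h := HasGroupoid.compatible (G := contDiffGroupoid ω 𝓘(ℂ, E)) he he'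
  rw [contDiffGroupoid, mem_groupoid_of_pregroupoid] at h
  have h1 := ContDiffOn.restrict_scalars ℝ (𝕜' := ℂ) h.1
  simpa only [mfld_simps] using h1

theorem contDiffOn_trans (x₀ x₁ : S) : ContDiffOn ℝ ω (trans x₀ x₁) (transDomain E x₀ x₁) :=
  (contDiffOn_trans_complex x₀ x₁).restrict_scalars ℝ

theorem contDiffAt_trans {x₀ x₁ : S} {z : E} (hz : z ∈ transDomain E x₀ x₁) :
    ContDiffAt ℝ ω (trans x₀ x₁) z :=
  (contDiffOn_trans x₀ x₁).contDiffAt ((isOpen_transDomain x₀ x₁).mem_nhds hz)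

theorem differentiableAt_trans_complex {x₀ x₁ : S} {z : E} (hz : z ∈ transDomain E x₀ x₁) :
    DifferentiableAt ℂ (trans x₀ x₁) z :=
  ((contDiffOn_trans_complex x₀ x₁).contDiffAt
    ((isOpen_transDomain x₀ x₁).mem_nhds hz)).differentiableAt (by simp)

theorem differentiableAt_trans {x₀ x₁ : S} {z : E} (hz : z ∈ transDomain E x₀ x₁) :
    DifferentiableAt ℝ (trans x₀ x₁) z :=
  (contDiffAt_trans hz).differentiableAt (by simp)

/-- The derivative of a transition map is complex linear. -/
theorem fderiv_trans_eq {x₀ x₁ : S} {z : E} (hz : z ∈ transDomain E x₀ x₁) :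
    fderiv ℝ (trans x₀ x₁) z = (fderiv ℂ (trans x₀ x₁) z).restrictScalars ℝ :=
  ((differentiableAt_trans_complex hz).hasFDerivAt.restrictScalars ℝ).fderiv

/-- The chain rule for transition maps. -/
theorem fderiv_trans_comp {x₀ x₁ x₂ : S} {z : E} (h1 : z ∈ transDomain E x₀ x₁)
    (h2 : z ∈ transDomain E x₀ x₂) :
    (fderiv ℝ (trans x₁ x₂) (trans x₀ x₁ z)).comp (fderiv ℝ (trans x₀ x₁) z) =
      fderiv ℝ (trans x₀ x₂) z := by
  have h3 : trans x₀ x₁ z ∈ transDomain E x₁ x₂ := by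
    refine ⟨(trans_mem h1).1, ?_⟩
    rw [Set.mem_preimage, symm_trans h1]
    exact h2.2
  have := (differentiableAt_trans h3).hasFDerivAt.comp z (differentiableAt_trans h1).hasFDerivAt
  rw [← this.fderiv]
  refine Filter.EventuallyEq.fderiv_eq ?_
  filter_upwards [(isOpen_transDomain x₀ x₁).mem_nhds h1] with y hy
  exact trans_trans hy

theorem fderiv_trans_self {x₀ : S} {z : E} (hz : z ∈ (chartAt E x₀).target) :
    fderiv ℝ (trans x₀ x₀) z = ContinuousLinearMap.id ℝ E := by
  rw [← fderiv_id (𝕜 := ℝ) (x := z)]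
  refine Filter.EventuallyEq.fderiv_eq ?_
  filter_upwards [(chartAt E x₀).open_target.mem_nhds hz] with y hy
  exact trans_self hy

theorem fderiv_trans_inv {x₀ x₁ : S} {z : E} (h1 : z ∈ transDomain E x₀ x₁) :
    (fderiv ℝ (trans x₁ x₀) (trans x₀ x₁ z)).comp (fderiv ℝ (trans x₀ x₁) z) =
      ContinuousLinearMap.id ℝ E := by
  rw [fderiv_trans_comp h1 ⟨h1.1, (chartAt E x₀).map_target h1.1⟩, fderiv_trans_self h1.1]

/-- The differential of the inverse of the preferred chart at `x₀`. -/
def chartD (x₀ : S) (z : E) : E →L[ℝ] E :=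
  mfderiv 𝓘(ℝ, E) 𝓘(ℝ, E) (chartAt E x₀).symm z

/-- Tangent vectors at `x` are read in the preferred chart at `x`, so the differential of the
inverse chart is the derivative of a transition map. -/
theorem chartD_eq {x₀ : S} {z : E} (hz : z ∈ (chartAt E x₀).target) :
    chartD x₀ z = fderiv ℝ (trans x₀ ((chartAt E x₀).symm z)) z := by
  have := isManifold_real (E := E) (S := S)
  have : IsManifold 𝓘(ℝ, E) 1 S := .of_le (n := ω) le_top
  have h : MDifferentiableAt 𝓘(ℝ, E) 𝓘(ℝ, E) (chartAt E x₀).symm z :=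
    mdifferentiableAt_atlas_symm (chart_mem_atlas E x₀) hz
  refine (MDifferentiableAt.mfderiv h).trans ?_
  simp only [mfld_simps, fderivWithin_univ]
  rfl

theorem chartD_trans {x₀ x₁ : S} {z : E} (hz : z ∈ transDomain E x₀ x₁) :
    chartD x₀ z = (chartD x₁ (trans x₀ x₁ z)).comp (fderiv ℝ (trans x₀ x₁) z) := by
  rw [chartD_eq hz.1, chartD_eq (trans_mem hz).1, symm_trans hz,
    fderiv_trans_comp hz (mem_transDomain_self hz.1)]

theorem chartD_self (x : S) : chartD x (chartAt E x x) = ContinuousLinearMap.id ℝ E := by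
  rw [chartD_eq (mem_chart_target E x), (chartAt E x).left_inv (mem_chart_source E x),
    fderiv_trans_self (mem_chart_target E x)]

/-- The inverse of `chartD x₀ z`. -/
def chartDInv (x₀ : S) (z : E) : E →L[ℝ] E :=
  fderiv ℝ (trans ((chartAt E x₀).symm z) x₀)
    (trans x₀ ((chartAt E x₀).symm z) z)

theorem chartDInv_comp_chartD {x₀ : S} {z : E} (hz : z ∈ (chartAt E x₀).target) :
    (chartDInv x₀ z).comp (chartD x₀ z) = ContinuousLinearMap.id ℝ E := by
  rw [chartD_eq hz]
  exact fderiv_trans_inv (mem_transDomain_self hz)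

theorem chartD_comp_chartDInv {x₀ : S} {z : E} (hz : z ∈ (chartAt E x₀).target) :
    (chartD x₀ z).comp (chartDInv x₀ z) = ContinuousLinearMap.id ℝ E := by
  rw [chartD_eq hz]
  have h := fderiv_trans_inv (trans_mem (mem_transDomain_self hz))
  rw [trans_trans (mem_transDomain_self hz), trans_self hz] at h
  exact h

theorem inverse_chartD {x₀ : S} {z : E} (hz : z ∈ (chartAt E x₀).target) :
    (chartD x₀ z).inverse = chartDInv x₀ z :=
  ContinuousLinearMap.inverse_eq (chartD_comp_chartDInv hz) (chartDInv_comp_chartD hz)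

theorem chartD_I_smul {x₀ : S} {z : E} (hz : z ∈ (chartAt E x₀).target) (v : E) :
    chartD x₀ z (Complex.I • v) = Complex.I • chartD x₀ z v := by
  rw [chartD_eq hz, fderiv_trans_eq (mem_transDomain_self hz)]
  simp

theorem chartDInv_I_smul {x₀ : S} {z : E} (hz : z ∈ (chartAt E x₀).target) (v : E) :
    chartDInv x₀ z (Complex.I • v) = Complex.I • chartDInv x₀ z v := by
  rw [chartDInv, fderiv_trans_eq (trans_mem (mem_transDomain_self hz))]
  simp

end
end Charts

/-! ### The operators `∂` and `∂̄` on a manifold -/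

section FormsInCharts

set_option linter.unusedSectionVars false

variable {E S : Type*} [NormedAddCommGroup E] [NormedSpace ℂ E]
  [TopologicalSpace S] [ChartedSpace E S] {k m : ℕ} {ε : ℝ}

theorem inChart_eq (x₀ : S) (α : DForm E S k) (z : E) :
    inChart x₀ α z = (α ((chartAt E x₀).symm z)).compContinuousLinearMap (chartD x₀ z) := rfl

theorem IsSmooth.contDiffAt {α : DForm E S k} (hα : IsSmooth α) {x₀ : S} {z : E}
    (hz : z ∈ (chartAt E x₀).target) : ContDiffAt ℝ ∞ (inChart x₀ α) z :=
  (hα x₀).contDiffAt ((chartAt E x₀).open_target.mem_nhds hz)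

theorem IsSmooth.differentiableAt {α : DForm E S k} (hα : IsSmooth α) {x₀ : S} {z : E}
    (hz : z ∈ (chartAt E x₀).target) : DifferentiableAt ℝ (inChart x₀ α) z :=
  (hα.contDiffAt hz).differentiableAt (by simp)

/-- The operator `∂` (`ε = 1`) or `∂̄` (`ε = -1`) on forms on a manifold. -/
def dolbeaultForm (ε : ℝ) (α : DForm E S k) : DForm E S (k + 1) := fun x =>
  .alternatizeUncurryFin (typePart ε (fderiv ℝ (inChart x α) (chartAt E x x)))

theorem dolbeaultForm_one (α : DForm E S k) : dolbeaultForm 1 α = del α := by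
  funext x
  rw [dolbeaultForm, typePart_one, del]

theorem dolbeaultForm_neg_one (α : DForm E S k) : dolbeaultForm (-1) α = delbar α := by
  funext x
  rw [dolbeaultForm, typePart_neg_one, delbar]

/-- Antisymmetrising `D b ∘ J` gives the conjugate of the exterior derivative by `J`. -/
theorem alternatizeUncurryFin_comp_J {b : E → E [⋀^Fin k]→L[ℝ] ℂ} {z : E}
    (hb : DifferentiableAt ℝ b z) :
    ContinuousAlternatingMap.alternatizeUncurryFin ((fderiv ℝ b z).comp J) =
      -(extDeriv (fun y => (b y).compContinuousLinearMap J) z).compContinuousLinearMap (-J) := by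
  have h : fderiv ℝ (fun y => (b y).compContinuousLinearMap J) z =
      (ContinuousAlternatingMap.compContinuousLinearMapCLM J).comp (fderiv ℝ b z) :=
    ((ContinuousAlternatingMap.compContinuousLinearMapCLM (F := ℂ) (ι := Fin k)
      (J : E →L[ℝ] E)).hasFDerivAt.comp z hb.hasFDerivAt).fderiv
  have hJ (v : E) : J (J v) = -v := by
    change Complex.I • Complex.I • v = -v
    rw [smul_smul, Complex.I_mul_I, neg_one_smul]
  ext v
  simp only [extDeriv, ContinuousAlternatingMap.alternatizeUncurryFin_apply, h,
    ContinuousAlternatingMap.neg_apply, ContinuousAlternatingMap.compContinuousLinearMap_apply,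
    ContinuousLinearMap.comp_apply, ← Finset.sum_neg_distrib]
  refine Finset.sum_congr rfl fun i _ => ?_
  have h1 : (⇑(-J : E →L[ℝ] E) ∘ v) i = -J (v i) := rfl
  have h2 : (J : E →L[ℝ] E) ∘ i.removeNth (⇑(-J : E →L[ℝ] E) ∘ v) = i.removeNth v := by
    funext j
    change J (-J (v _)) = v _
    rw [map_neg, hJ, neg_neg]
  rw [h1, map_neg, map_neg]
  simp only [ContinuousAlternatingMap.neg_apply, smul_neg, neg_neg]
  congr 1
  exact congrArg _ h2.symm

/-- The operators `∂` and `∂̄` in terms of `d` and its conjugate by `J`, both of which are natural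
under holomorphic maps. -/
theorem alternatizeUncurryFin_typePart {b : E → E [⋀^Fin k]→L[ℝ] ℂ} {z : E}
    (hb : DifferentiableAt ℝ b z) :
    ContinuousAlternatingMap.alternatizeUncurryFin (typePart ε (fderiv ℝ b z)) =
      (1 / 2 : ℂ) • (extDeriv b z + ((ε : ℂ) * Complex.I) •
        (extDeriv (fun y => (b y).compContinuousLinearMap J) z).compContinuousLinearMap (-J)) := by
  rw [typePart, ContinuousAlternatingMap.alternatizeUncurryFin_smul, alternatizeUncurryFin_sub,
    ContinuousAlternatingMap.alternatizeUncurryFin_smul, alternatizeUncurryFin_comp_J hb]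
  simp only [extDeriv]
  module

theorem typePart_sub (D D' : E →L[ℝ] E [⋀^Fin k]→L[ℝ] ℂ) :
    typePart ε (D - D') = typePart ε D - typePart ε D' := by
  ext1 v
  simp only [typePart_apply, sub_apply]
  module

theorem IsSmooth.sub {α β : DForm E S k} (hα : IsSmooth α) (hβ : IsSmooth β) :
    IsSmooth (α - β) := fun x₀ => (hα x₀).sub (hβ x₀)

theorem dolbeaultForm_sub {α β : DForm E S k} (hα : IsSmooth α) (hβ : IsSmooth β) :
    dolbeaultForm ε (α - β) = dolbeaultForm ε α - dolbeaultForm ε β := by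
  funext x
  have h : inChart x (α - β) = inChart x α - inChart x β := rfl
  have hx := mem_chart_target E x
  rw [dolbeaultForm, h, fderiv_sub (hα.differentiableAt hx) (hβ.differentiableAt hx), typePart_sub,
    alternatizeUncurryFin_sub]
  rfl

section

variable [IsManifold 𝓘(ℂ, E) ω S]

theorem inChart_trans {x₀ x₁ : S} (α : DForm E S k) {z : E} (hz : z ∈ transDomain E x₀ x₁) :
    inChart x₀ α z =
      (inChart x₁ α (trans x₀ x₁ z)).compContinuousLinearMap (fderiv ℝ (trans x₀ x₁) z) := by
  rw [inChart_eq, inChart_eq, chartD_trans hz, symm_trans hz]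
  rfl

theorem inChart_self (x : S) (α : DForm E S k) : inChart x α (chartAt E x x) = α x := by
  rw [inChart_eq, chartD_self, (chartAt E x).left_inv (mem_chart_source E x)]
  rfl

theorem inChart_trans_eventuallyEq {x₀ x₁ : S} (α : DForm E S k) {z : E}
    (hz : z ∈ transDomain E x₀ x₁) :
    inChart x₀ α =ᶠ[𝓝 z] fun y =>
      (inChart x₁ α (trans x₀ x₁ y)).compContinuousLinearMap (fderiv ℝ (trans x₀ x₁) y) := by
  filter_upwards [(isOpen_transDomain x₀ x₁).mem_nhds hz] with y hy
  exact inChart_trans α hy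

/-- The exterior derivative does not depend on the chart. -/
theorem extDeriv_inChart_trans {α : DForm E S k} (hα : IsSmooth α) {x₀ x₁ : S} {z : E}
    (hz : z ∈ transDomain E x₀ x₁) :
    extDeriv (inChart x₀ α) z =
      (extDeriv (inChart x₁ α) (trans x₀ x₁ z)).compContinuousLinearMap
        (fderiv ℝ (trans x₀ x₁) z) := by
  rw [(inChart_trans_eventuallyEq α hz).extDeriv_eq]
  exact extDeriv_pullback (hα.differentiableAt (trans_mem hz).1) (contDiffAt_trans hz) (by simp)

/-- The operators `∂` and `∂̄` do not depend on the chart, since `∂ - ∂̄` is up to a constant the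
conjugate of `d` by the complex structure, which commutes with holomorphic pullback. -/
theorem dolbeault_inChart_trans {α : DForm E S k} (hα : IsSmooth α) {x₀ x₁ : S} {z : E}
    (hz : z ∈ transDomain E x₀ x₁) :
    ContinuousAlternatingMap.alternatizeUncurryFin (typePart ε (fderiv ℝ (inChart x₀ α) z)) =
      (ContinuousAlternatingMap.alternatizeUncurryFin (typePart ε
        (fderiv ℝ (inChart x₁ α) (trans x₀ x₁ z)))).compContinuousLinearMap
        (fderiv ℝ (trans x₀ x₁) z) := by
  have hd1 := hα.differentiableAt (trans_mem hz).1
  have hcomm {y : E} (hy : y ∈ transDomain E x₀ x₁) :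
      (fderiv ℝ (trans x₀ x₁) y).comp J = J.comp (fderiv ℝ (trans x₀ x₁) y) := by
    ext v
    rw [fderiv_trans_eq hy]
    exact (fderiv ℂ (trans x₀ x₁) y).map_smul Complex.I v
  have hJ : (fun y => (inChart x₀ α y).compContinuousLinearMap J) =ᶠ[𝓝 z] fun y =>
      ((fun y => (inChart x₁ α y).compContinuousLinearMap J)
        (trans x₀ x₁ y)).compContinuousLinearMap (fderiv ℝ (trans x₀ x₁) y) := by
    filter_upwards [(isOpen_transDomain x₀ x₁).mem_nhds hz] with y hy
    rw [inChart_trans α hy]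
    ext v
    simp only [ContinuousAlternatingMap.compContinuousLinearMap_apply]
    congr 1
    funext i
    exact DFunLike.congr_fun (hcomm hy) (v i)
  have hd2 : DifferentiableAt ℝ (fun y => (inChart x₁ α y).compContinuousLinearMap J)
      (trans x₀ x₁ z) :=
    ((ContinuousAlternatingMap.compContinuousLinearMapCLM (F := ℂ) (ι := Fin k)
      (J : E →L[ℝ] E)).hasFDerivAt.comp _ hd1.hasFDerivAt).differentiableAt
  rw [alternatizeUncurryFin_typePart (hα.differentiableAt hz.1),
    alternatizeUncurryFin_typePart hd1, extDeriv_inChart_trans hα hz, hJ.extDeriv_eq,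
    extDeriv_pullback hd2 (contDiffAt_trans hz) (by simp)]
  ext v
  simp only [ContinuousAlternatingMap.smul_apply, ContinuousAlternatingMap.add_apply,
    ContinuousAlternatingMap.compContinuousLinearMap_apply]
  congr 4
  funext i
  change fderiv ℝ (trans x₀ x₁) z (-J (v i)) = -J (fderiv ℝ (trans x₀ x₁) z (v i))
  rw [map_neg]
  exact congrArg _ (DFunLike.congr_fun (hcomm hz) (v i))

theorem inChart_dolbeaultForm {α : DForm E S k} (hα : IsSmooth α) {x₀ : S} {z : E}
    (hz : z ∈ (chartAt E x₀).target) :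
    inChart x₀ (dolbeaultForm ε α) z =
      ContinuousAlternatingMap.alternatizeUncurryFin (typePart ε (fderiv ℝ (inChart x₀ α) z)) := by
  rw [dolbeault_inChart_trans hα (mem_transDomain_self hz), inChart_eq, chartD_eq hz]
  rfl

theorem IsSmooth.dolbeaultForm {α : DForm E S k} (hα : IsSmooth α) :
    IsSmooth (dolbeaultForm ε α) := by
  intro x₀
  refine ContDiffOn.congr ?_ fun z hz => inChart_dolbeaultForm hα hz
  have h1 : ContDiffOn ℝ ∞ (fderiv ℝ (inChart x₀ α)) (chartAt E x₀).target :=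
    (hα x₀).fderiv_of_isOpen (chartAt E x₀).open_target (by simp)
  have h2 : ContDiff ℝ ∞ fun D : E →L[ℝ] E [⋀^Fin k]→L[ℝ] ℂ =>
      ContinuousAlternatingMap.alternatizeUncurryFin (typePart ε D) := by
    have h3 : ContDiff ℝ ∞ fun D : E →L[ℝ] E [⋀^Fin k]→L[ℝ] ℂ =>
        (1 / 2 : ℂ) • (D - ((ε : ℂ) * Complex.I) • D.comp J) :=
      (contDiff_id.sub ((contDiff_id.clm_comp contDiff_const).const_smul _)).const_smul _
    exact (ContinuousLinearMap.contDiff (E := E →L[ℝ] E [⋀^Fin k]→L[ℝ] ℂ)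
      (F := E [⋀^Fin (k + 1)]→L[ℝ] ℂ)
      (ContinuousAlternatingMap.alternatizeUncurryFinCLM ℝ E ℂ)).comp h3
  exact h2.comp_contDiffOn h1

end
end FormsInCharts

/-! ### Vector fields in charts -/

section FieldsInCharts

set_option linter.unusedSectionVars false

variable {E S : Type*} [NormedAddCommGroup E] [NormedSpace ℂ E]
  [TopologicalSpace S] [ChartedSpace E S] {k m : ℕ} {ε : ℝ}

/-- The expression of a vector field in the preferred chart at `x₀`. -/
def locVec (x₀ : S) (V : S → E) (z : E) : E := chartDInv x₀ z (V ((chartAt E x₀).symm z))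

/-- The expression of a complex vector field in the preferred chart at `x₀`. -/
def locField (x₀ : S) (Z : S → E × E) (z : E) : E × E :=
  (locVec x₀ (fun x => (Z x).1) z, locVec x₀ (fun x => (Z x).2) z)

/-- The field of type `(1,0)` (`ε = 1`) or `(0,1)` (`ε = -1`) given by a real field. -/
def typeField (ε : ℝ) (ξ : S → E) : S → E × E := fun x => typeVec ε (ξ x)

theorem typeField_one (ξ : S → E) : typeField 1 ξ = hol ξ := funext fun x => typeVec_one (ξ x)

theorem typeField_neg_one (ξ : S → E) : typeField (-1) ξ = antihol ξ :=
  funext fun x => typeVec_neg_one (ξ x)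

/-- The expression of an inhomogeneous form in a chart. -/
def inChartG (x₀ : S) (u : GForm E S) (z : E) : GAlt E := fun k => inChart x₀ (u k) z

/-- The operator `∂` or `∂̄` on inhomogeneous forms. -/
def dolbeaultG (ε : ℝ) (u : GForm E S) : GForm E S
  | 0 => 0
  | k + 1 => dolbeaultForm ε (u k)

theorem dolbeaultG_apply (u : GForm E S) (x : S) :
    (fun k => dolbeaultG ε u k x) = dolbeault ε (inChartG x u) (chartAt E x x) := by
  funext k
  cases k <;> rfl

theorem contractList_apply (L : List (S → E × E)) (u : GForm E S) (x : S) :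
    (fun k => contractList L u k x) = contrListG (L.map fun Z => Z x) (fun k => u k x) := by
  induction L with
  | nil => rfl
  | cons Z L ih =>
    rw [List.map_cons, contrListG_cons, ← ih]
    rfl

theorem contractList_append (L L' : List (S → E × E)) (u : GForm E S) :
    contractList (L ++ L') u = contractList L (contractList L' u) := by
  simp [contractList]

section

variable [IsManifold 𝓘(ℂ, E) ω S]

theorem locVec_self (x : S) (V : S → E) : locVec x V (chartAt E x x) = V x := by
  have h := chartDInv_comp_chartD (mem_chart_target E x)
  rw [chartD_self, ContinuousLinearMap.comp_id] at h
  rw [locVec, h, (chartAt E x).left_inv (mem_chart_source E x)]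
  rfl

theorem locField_self (x : S) (Z : S → E × E) : locField x Z (chartAt E x x) = Z x := by
  rw [locField, locVec_self, locVec_self]

theorem chartD_locVec {x₀ : S} {z : E} (hz : z ∈ (chartAt E x₀).target) (V : S → E) :
    chartD x₀ z (locVec x₀ V z) = V ((chartAt E x₀).symm z) :=
  DFunLike.congr_fun (chartD_comp_chartDInv hz) _

theorem locVec_I_smul {x₀ : S} {z : E} (hz : z ∈ (chartAt E x₀).target) (V : S → E) :
    locVec x₀ (fun x => Complex.I • V x) z = Complex.I • locVec x₀ V z :=
  chartDInv_I_smul hz _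

theorem locField_typeField {x₀ : S} {z : E} (hz : z ∈ (chartAt E x₀).target) (ξ : S → E) :
    locField x₀ (typeField ε ξ) z = typeVec ε (locVec x₀ ξ z) := by
  simp only [locField, typeField, typeVec, locVec, map_neg, map_smul, chartDInv_I_smul hz]

theorem inChart_contract {x₀ : S} {z : E} (hz : z ∈ (chartAt E x₀).target) (Z : S → E × E)
    (u : DForm E S (k + 1)) :
    inChart x₀ (contract Z u) z = contractVec (locField x₀ Z z) (inChart x₀ u z) := by
  rw [inChart_eq, inChart_eq, contractVec_compContinuousLinearMap, locField, chartD_locVec hz,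
    chartD_locVec hz]
  rfl

/-- Smooth complex vector fields. -/
def IsSmoothField (Z : S → E × E) : Prop :=
  ∀ x₀ : S, ContDiffOn ℝ ∞ (locField x₀ Z) (chartAt E x₀).target

theorem IsSmooth.contract {Z : S → E × E} (hZ : IsSmoothField Z) {u : DForm E S (k + 1)}
    (hu : IsSmooth u) : IsSmooth (contract Z u) := fun x₀ =>
  (contDiffOn_contractVec (hZ x₀) (hu x₀)).congr fun _ hz => inChart_contract hz Z u

theorem isSmooth_contractList {L : List (S → E × E)} (hL : ∀ Z ∈ L, IsSmoothField Z)
    {u : GForm E S} (hu : ∀ k, IsSmooth (u k)) (k : ℕ) : IsSmooth (contractList L u k) := by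
  induction L generalizing k with
  | nil => exact hu k
  | cons Z L ih =>
    exact IsSmooth.contract (hL Z (by simp)) (ih (fun W hW => hL W (by simp [hW])) (k + 1))

theorem inChartG_contractList {x₀ : S} {z : E} (hz : z ∈ (chartAt E x₀).target)
    (L : List (S → E × E)) (u : GForm E S) :
    inChartG x₀ (contractList L u) z = contrFields (L.map (locField x₀)) (inChartG x₀ u) z := by
  induction L with
  | nil => rfl
  | cons Z L ih =>
    rw [List.map_cons, contrFields_cons, contrField, ← ih]
    funext k
    exact inChart_contract hz Z _

/-- A holomorphic section of the tangent bundle is holomorphic in every chart: the trivialisation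
of the tangent bundle at `x₀` is given by the derivatives of the transition maps to the chart at
`x₀`. -/
theorem IsHolomorphicField.contDiffOn {ξ : S → E} (hξ : IsHolomorphicField ξ) (x₀ : S) :
    ContDiffOn ℂ ω (locVec x₀ ξ) (chartAt E x₀).target := by
  have h1 : ContMDiffOn 𝓘(ℂ, E) 𝓘(ℂ, E) ω
      (fun y => (trivializationAt E (TangentSpace 𝓘(ℂ, E)) x₀ ⟨y, ξ y⟩).2)
      (chartAt E x₀).source :=
    ((trivializationAt E (TangentSpace 𝓘(ℂ, E) : S → Type _) x₀).contMDiffOn_section_baseSet_iff).1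
      hξ.contMDiffOn
  have h2 : ContMDiffOn 𝓘(ℂ, E) 𝓘(ℂ, E) ω
      (fun z => (trivializationAt E (TangentSpace 𝓘(ℂ, E)) x₀
        ⟨(chartAt E x₀).symm z, ξ ((chartAt E x₀).symm z)⟩).2) (chartAt E x₀).target :=
    h1.comp (contMDiffOn_chart_symm (I := 𝓘(ℂ, E))) fun z hz => (chartAt E x₀).map_target hz
  rw [contMDiffOn_iff_contDiffOn] at h2
  refine h2.congr fun z hz => ?_
  rw [TangentBundle.trivializationAt_apply, locVec, chartDInv,
    fderiv_trans_eq (trans_mem (mem_transDomain_self hz))]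
  simp only [mfld_simps, fderivWithin_univ]
  rfl

theorem IsHolomorphicField.differentiableAt {ξ : S → E} (hξ : IsHolomorphicField ξ) {x₀ : S} {z : E}
    (hz : z ∈ (chartAt E x₀).target) : DifferentiableAt ℂ (locVec x₀ ξ) z :=
  ((hξ.contDiffOn x₀).contDiffAt ((chartAt E x₀).open_target.mem_nhds hz)).differentiableAt
    (by simp)

theorem IsHolomorphicField.isSmoothField {ξ : S → E} (hξ : IsHolomorphicField ξ) :
    IsSmoothField (typeField ε ξ) := fun x₀ =>
  ContDiffOn.congr ((typeVecL (E := E) ε).contDiff.comp_contDiffOn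
    (((hξ.contDiffOn x₀).restrict_scalars ℝ).of_le le_top)) fun _ hz => locField_typeField hz ξ

theorem IsSmoothField.differentiableAt {Z : S → E × E} (hZ : IsSmoothField Z) {x₀ : S} {z : E}
    (hz : z ∈ (chartAt E x₀).target) : DifferentiableAt ℝ (locField x₀ Z) z :=
  ((hZ x₀).contDiffAt ((chartAt E x₀).open_target.mem_nhds hz)).differentiableAt (by simp)

/-- The Lie bracket of real fields at `x` is their bracket in the preferred chart at `x`. -/
theorem realBracket_eq (U V : S → E) (x : S) :
    realBracket U V x = VectorField.lieBracket ℝ (locVec x U) (locVec x V) (chartAt E x x) := by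
  have := isManifold_real (E := E) (S := S)
  have : IsManifold 𝓘(ℝ, E) 1 S := .of_le (n := ω) le_top
  have h : MDifferentiableAt 𝓘(ℝ, E) 𝓘(ℝ, E) (chartAt E x) x :=
    mdifferentiableAt_atlas (chart_mem_atlas E x) (mem_chart_source E x)
  have e1 : (extChartAt 𝓘(ℝ, E) x : S → E) = chartAt E x := by simp only [mfld_simps]
  have e2 : ((extChartAt 𝓘(ℝ, E) x).symm : E → S) = (chartAt E x).symm := by
    simp only [mfld_simps]
  have e3 : Set.range (𝓘(ℝ, E)) = (Set.univ : Set E) := by simp only [mfld_simps]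
  let A : E →L[ℝ] E := mfderiv 𝓘(ℝ, E) 𝓘(ℝ, E) (extChartAt 𝓘(ℝ, E) x) x
  let B (z : E) : E →L[ℝ] E :=
    mfderivWithin 𝓘(ℝ, E) 𝓘(ℝ, E) (extChartAt 𝓘(ℝ, E) x).symm (Set.range (𝓘(ℝ, E))) z
  have hA : A = ContinuousLinearMap.id ℝ E := by
    simp only [A]
    refine (MDifferentiableAt.mfderiv h).trans ?_
    simp only [mfld_simps, fderivWithin_univ]
    exact fderiv_trans_self (mem_chart_target E x)
  have hB (z : E) : B z = chartD x z := by
    simp only [B, e3, mfderivWithin_univ]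
    rfl
  have hl (V : S → E) : (fun z : E => (B z).inverse (V ((extChartAt 𝓘(ℝ, E) x).symm z)))
      =ᶠ[𝓝 (chartAt E x x)] locVec x V := by
    filter_upwards [(chartAt E x).open_target.mem_nhds (mem_chart_target E x)] with z hz
    rw [hB, inverse_chartD hz, e2]
    rfl
  change A.inverse (VectorField.lieBracketWithin (E := E) ℝ
      (fun z : E => (B z).inverse (U ((extChartAt 𝓘(ℝ, E) x).symm z)))
      (fun z : E => (B z).inverse (V ((extChartAt 𝓘(ℝ, E) x).symm z)))
      ((extChartAt 𝓘(ℝ, E) x).symm ⁻¹' Set.univ ∩ Set.range (𝓘(ℝ, E)))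
      (extChartAt 𝓘(ℝ, E) x x)) = _
  rw [e3, e1, hA, Set.preimage_univ, Set.univ_inter, VectorField.lieBracketWithin_univ,
    (hl U).lieBracket_vectorField_eq (hl V), ContinuousLinearMap.inverse_id]
  rfl

theorem bracket_eq {Z W : S → E × E} (hZ : IsSmoothField Z) (hW : IsSmoothField W) (x : S) :
    bracket Z W x = localBracket (locField x Z) (locField x W) (chartAt E x x) := by
  have hx := mem_chart_target E x
  have h1 {Z : S → E × E} (hZ : IsSmoothField Z) (v : E) :
      fderiv ℝ (locField x Z) (chartAt E x x) v =
        (fderiv ℝ (locVec x fun y => (Z y).1) (chartAt E x x) v,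
          fderiv ℝ (locVec x fun y => (Z y).2) (chartAt E x x) v) := by
    have hd := hZ.differentiableAt hx
    have e : locField x Z = fun z => (locVec x (fun y => (Z y).1) z, locVec x (fun y => (Z y).2) z) :=
      rfl
    have h1 : DifferentiableAt ℝ (locVec x fun y => (Z y).1) (chartAt E x x) := hd.fst
    have h2 : DifferentiableAt ℝ (locVec x fun y => (Z y).2) (chartAt E x x) := hd.snd
    rw [e, DifferentiableAt.fderiv_prodMk h1 h2]
    rfl
  simp only [bracket, realBracket_eq, VectorField.lieBracket, localBracket, h1 hZ, h1 hW, mulIVec,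
    locField, locVec_self]
  ext1
  · simp only [Prod.fst_sub, Prod.fst_add]
    abel
  · simp only [Prod.snd_sub, Prod.snd_add]
    abel

/-- A holomorphic field commutes with the conjugate of a holomorphic field. -/
theorem bracket_typeField_opposite (hε : ε * ε = 1) {ξ η : S → E} (hξ : IsHolomorphicField ξ)
    (hη : IsHolomorphicField η) : bracket (typeField ε ξ) (typeField (-ε) η) = 0 := by
  funext x
  have hx := mem_chart_target E x
  have e (δ : ℝ) (ζ : S → E) : locField x (typeField δ ζ) =ᶠ[𝓝 (chartAt E x x)]
      fun z => typeVec δ (locVec x ζ z) := by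
    filter_upwards [(chartAt E x).open_target.mem_nhds hx] with z hz
    exact locField_typeField hz ζ
  rw [bracket_eq hξ.isSmoothField hη.isSmoothField, localBracket, (e ε ξ).fderiv_eq,
    (e (-ε) η).fderiv_eq, (e ε ξ).self_of_nhds, (e (-ε) η).self_of_nhds]
  exact localBracket_typeVec_opposite hε (hξ.differentiableAt hx) (hη.differentiableAt hx)

/-- Contracting by conjugates of holomorphic fields anticommutes with `∂`. -/
theorem contractList_dolbeaultG_of_opposite (hε : ε * ε = 1) {u : GForm E S}
    (hu : ∀ k, IsSmooth (u k)) (L : List (S → E)) (hL : ∀ η ∈ L, IsHolomorphicField η) :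
    contractList (L.map (typeField (-ε))) (dolbeaultG ε u) =
      (-1 : ℤ) ^ L.length • dolbeaultG ε (contractList (L.map (typeField (-ε))) u) := by
  induction L with
  | nil => simp [contractList]
  | cons η L ih =>
    have hL' : ∀ η ∈ L, IsHolomorphicField η := fun ζ hζ => hL ζ (by simp [hζ])
    have hη : IsHolomorphicField η := hL η (by simp)
    set v := contractList (L.map (typeField (-ε))) u with hv
    have hvs : ∀ k, IsSmooth (v k) := isSmooth_contractList (by
      intro Z hZ
      obtain ⟨ζ, hζ, rfl⟩ := List.mem_map.1 hZ
      exact (hL' ζ hζ).isSmoothField) hu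
    have key : (fun k => contract (typeField (-ε) η) (dolbeaultG ε v (k + 1))) =
        -dolbeaultG ε (fun k => contract (typeField (-ε) η) (v (k + 1))) := by
      have hxx (x : S) : (fun k => contract (typeField (-ε) η) (dolbeaultG ε v (k + 1)) x) =
          fun k => (-dolbeaultG ε (fun k => contract (typeField (-ε) η) (v (k + 1)))) k x := by
        have hx := mem_chart_target E x
        have e1 := contrG_dolbeault_of_opposite (b := inChartG x v) (z := chartAt E x x) hε
          (fun k => (hvs k).differentiableAt hx) (hη.differentiableAt hx)
        rw [locVec_self, ← dolbeaultG_apply] at e1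
        refine e1.trans ?_
        have e2 : (fun k => (-dolbeaultG ε (fun k => contract (typeField (-ε) η) (v (k + 1)))) k x) =
            -fun k => (dolbeaultG ε (fun k => contract (typeField (-ε) η) (v (k + 1)))) k x := rfl
        rw [e2, dolbeaultG_apply]
        congr 1
        funext k
        cases k with
        | zero => rfl
        | succ k =>
          simp only [dolbeault]
          congr 2
          refine Filter.EventuallyEq.fderiv_eq ?_
          filter_upwards [(chartAt E x).open_target.mem_nhds hx] with z hz
          rw [inChartG, inChart_contract hz, locField_typeField hz]
          rfl
      funext k x
      exact congrFun (hxx x) k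
    have e3 : contractList ((η :: L).map (typeField (-ε))) (dolbeaultG ε u) =
        fun k => contract (typeField (-ε) η)
          (contractList (L.map (typeField (-ε))) (dolbeaultG ε u) (k + 1)) := rfl
    have e4 : contractList ((η :: L).map (typeField (-ε))) u =
        fun k => contract (typeField (-ε) η) (v (k + 1)) := rfl
    rw [e3, ih hL', e4, List.length_cons, pow_succ, mul_neg_one, neg_smul, ← smul_neg, ← key]
    funext k x
    exact map_zsmul (contractL (typeField (-ε) η x)) _ _

end
end FieldsInCharts

/-! ### Contraction of `∂β` under the bracket condition -/

section BracketCondition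

set_option linter.unusedSectionVars false

variable {E S : Type*} [NormedAddCommGroup E] [NormedSpace ℂ E]
  [TopologicalSpace S] [ChartedSpace E S] {k m : ℕ} {ε : ℝ}

theorem length_descList_ne_ne {α : Type*} (Z : Fin m → α) {s r : Fin m} (h : r < s) :
    (descList Z (fun i => i ≠ s ∧ i ≠ r)).length = m - 2 := by
  rw [descList, List.length_map]
  have hn : ((List.finRange m).reverse.filter (fun i => decide (i ≠ s ∧ i ≠ r))).Nodup :=
    (List.nodup_reverse.2 (List.nodup_finRange m)).filter _
  rw [← List.toFinset_card_of_nodup hn]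
  have : ((List.finRange m).reverse.filter (fun i => decide (i ≠ s ∧ i ≠ r))).toFinset =
      Finset.univ \ {s, r} := by
    ext i; simp
  rw [this, Finset.card_sdiff_of_subset (Finset.subset_univ _), Finset.card_pair h.ne', Finset.card_univ,
    Fintype.card_fin]

theorem contractList_zero_cons (L : List (S → E × E)) (u : GForm E S) :
    contractList (0 :: L) u = 0 := by
  funext k x
  exact contractVec_zero_left _

/-- When the brackets `[Z_s, W_r]` vanish, only the brackets `[Z_s, Z_r]` contribute. -/
theorem bracketForm_apply (Z W : Fin m → S → E × E) (hZW : ∀ s r, bracket (Z s) (W r) = 0)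
    (u : GForm E S) (x : S) :
    (fun k => bracketForm Z W u k x) =
      ∑ s : Fin m, ∑ r ∈ Finset.univ.filter (fun r : Fin m => r < s),
        (-1 : ℤ) ^ ((s : ℕ) + 1 + ((r : ℕ) + 1) + 1) •
          contrListG (bracket (Z s) (Z r) x :: (descList (fun i => Z i x) (fun i => i ≠ s ∧ i ≠ r) ++
            descList (fun i => W i x) (fun _ => true))) (fun k => u k x) := by
  have h (s r : Fin m) : contractList (bracket (Z s) (W r) ::
      (descending Z (fun i => i ≠ s) ++ descending W (fun i => i ≠ r))) u = 0 := by
    rw [hZW, contractList_zero_cons]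
  have h0 : ∑ s : Fin m, ∑ r : Fin m,
      (-1 : ℤ) ^ (m + 2 - ((s : ℕ) + 1) + ((r : ℕ) + 1) + 1) •
      contractList (bracket (Z s) (W r) ::
        (descending Z (fun i => i ≠ s) ++ descending W (fun i => i ≠ r))) u = 0 :=
    Finset.sum_eq_zero fun s _ => Finset.sum_eq_zero fun r _ => by rw [h, zsmul_zero]
  funext k
  rw [bracketForm, h0, add_zero]
  simp only [Finset.sum_apply]
  refine Finset.sum_congr rfl fun s _ => Finset.sum_congr rfl fun r _ => ?_
  simp only [Pi.smul_apply]
  congr 1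
  have := congrFun (contractList_apply (bracket (Z s) (Z r) ::
        (descending Z (fun i => i ≠ s ∧ i ≠ r) ++ descending W (fun _ => true))) u x) k
  rw [this, List.map_cons, List.map_append]
  simp only [descending, descList, List.map_map]
  rfl

theorem isSmooth_zero : IsSmooth (0 : DForm E S k) := fun x₀ => by
  have : inChart x₀ (0 : DForm E S k) = fun _ => 0 := rfl
  rw [this]
  exact contDiffOn_const

theorem isSmooth_ofDegree {β : DForm E S k} (hβ : IsSmooth β) (j : ℕ) :
    IsSmooth (ofDegree β j) := by
  by_cases h : j = k
  · subst h
    simpa [ofDegree] using hβ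
  · rw [ofDegree, Pi.single_eq_of_ne h]
    exact isSmooth_zero

theorem ofDegree_apply (β : DForm E S k) (x : S) :
    (fun j => ofDegree β j x) = (Pi.single k (β x) : GAlt E) := by
  funext j
  by_cases h : j = k
  · subst h
    simp [ofDegree]
  · rw [ofDegree, Pi.single_eq_of_ne h, Pi.single_eq_of_ne h]
    rfl

variable [IsManifold 𝓘(ℂ, E) ω S]

/-- Under the bracket condition the contraction of `∂β` (or `∂̄β`) by all the fields is a sum of
derivatives of functions along the fields of the type of the operator. -/
theorem contractList_dolbeaultG [FiniteDimensional ℂ E] (hε : ε * ε = 1) {ξ η : Fin m → S → E}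
    (hξ : ∀ i, IsHolomorphicField (ξ i)) (hη : ∀ i, IsHolomorphicField (η i))
    {dV : DForm E S (2 * finrank ℂ E)} (hdV : ∀ x, dV x ≠ 0)
    (hB : bracketForm (fun i => typeField ε (ξ i)) (fun i => typeField (-ε) (η i))
      (ofDegree dV) = 0)
    {β : DForm E S k} (hβ : IsSmooth β) (x : S) :
    contractList (descending (fun i => typeField ε (ξ i)) (fun _ => true) ++
      descending (fun i => typeField (-ε) (η i)) (fun _ => true)) (dolbeaultG ε (ofDegree β)) 0 x =
    (-1 : ℤ) ^ m • ∑ s : Fin m, (-1 : ℤ) ^ (s : ℕ) •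
      (fderiv ℝ (inChart x (contractList
        (descending (fun i => typeField ε (ξ i)) (fun i => i ≠ s) ++
          descending (fun i => typeField (-ε) (η i)) (fun _ => true)) (ofDegree β) 0))
          (chartAt E x x) (typeField ε (ξ s) x).1 +
       Complex.I • fderiv ℝ (inChart x (contractList
        (descending (fun i => typeField ε (ξ i)) (fun i => i ≠ s) ++
          descending (fun i => typeField (-ε) (η i)) (fun _ => true)) (ofDegree β) 0))
          (chartAt E x x) (typeField ε (ξ s) x).2) := by
  have hx := mem_chart_target E x
  set Z : Fin m → S → E × E := fun i => typeField ε (ξ i) with hZdef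
  set W : Fin m → S → E × E := fun i => typeField (-ε) (η i) with hWdef
  have hZs (i) : IsSmoothField (Z i) := (hξ i).isSmoothField
  have hWs (i) : IsSmoothField (W i) := (hη i).isSmoothField
  have hdW : descending W (fun _ => true) =
      (descList η (fun _ => true)).map (typeField (-ε)) := by
    rw [map_descList]; rfl
  set v : GForm E S := contractList (descending W (fun _ => true)) (ofDegree β) with hv
  have hvs (k) : IsSmooth (v k) := isSmooth_contractList (fun T hT => by
    obtain ⟨i, rfl⟩ := mem_descList hT; exact hWs i) (isSmooth_ofDegree hβ) k
  -- the fields of type `-ε` pass through the operator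
  have h1 : contractList (descending W (fun _ => true)) (dolbeaultG ε (ofDegree β)) =
      (-1 : ℤ) ^ m • dolbeaultG ε v := by
    rw [hv, hdW, contractList_dolbeaultG_of_opposite hε (isSmooth_ofDegree hβ) _ (fun ζ hζ => by
      obtain ⟨i, rfl⟩ := mem_descList hζ; exact hη i), length_descList_true]
  set b := inChartG x v with hb
  set z := chartAt E x x with hz
  set Y : Fin m → E → E × E := fun i => locField x (Z i) with hY
  have hYz : (fun i => Y i z) = fun i => Z i x := funext fun i => locField_self x (Z i)
  have hbz : b z = contrListG (descList (fun i => W i x) (fun _ => true))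
      (Pi.single k (β x)) := by
    have e1 : b z = fun k => v k x := funext fun k => inChart_self x (v k)
    rw [e1, hv, contractList_apply, ofDegree_apply]
    congr 2
    exact map_descList _ _ _
  -- the local formula in the chart at `x`
  have key := contrListG_dolbeault hε Y (b := b) (z := z) (fun k => (hvs k).differentiableAt hx)
    (fun i => (hZs i).differentiableAt hx) (fun i => ⟨_, locField_typeField hx (ξ i)⟩)
  -- the bracket terms vanish on every form because they vanish on `dV`
  have h3 : ∑ s : Fin m, ∑ r ∈ Finset.univ.filter (fun r : Fin m => r < s),
        (-1 : ℤ) ^ ((s : ℕ) + 1 + ((r : ℕ) + 1) + 1) •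
          contrListG (localBracket (Y s) (Y r) z ::
            descList (fun i => Y i z) (fun i => i ≠ s ∧ i ≠ r)) (b z) = 0 := by
    have hB' := bracketForm_apply Z W
      (fun s r => bracket_typeField_opposite hε (hξ s) (hη r)) (ofDegree dV) x
    rw [hB, ofDegree_apply, Finset.sum_sigma'] at hB'
    have := contrListG_sum_eq_zero _ _ _ (1 + (m - 2) + m) (fun p hp => ?_)
      (finrank_real_of_complex E).symm (hdV x) hB'.symm (β x)
    · rw [Finset.sum_sigma']
      refine (Finset.sum_congr rfl fun p _ => ?_).trans this
      rw [hbz, hYz, ← contrListG_append, bracket_eq (hZs _) (hZs _)]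
      rfl
    · have hlt : p.2 < p.1 := by simpa using hp
      rw [List.length_cons, List.length_append, length_descList_ne_ne _ hlt, length_descList_true]
      omega
  rw [h3, hYz] at key
  have e2 := congrFun key 0
  have e3 : contractList (descending Z (fun _ => true) ++ descending W (fun _ => true))
      (dolbeaultG ε (ofDegree β)) 0 x = (-1 : ℤ) ^ m •
        contrListG (descList (fun i => Z i x) (fun _ => true)) (dolbeault ε b z) 0 := by
    rw [contractList_append, h1]
    have e4 := congrFun (contractList_apply (descending Z (fun _ => true))
      ((-1 : ℤ) ^ m • dolbeaultG ε v) x) 0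
    have e5 : (fun k => ((-1 : ℤ) ^ m • dolbeaultG ε v) k x) =
        (-1 : ℤ) ^ m • fun k => dolbeaultG ε v k x := rfl
    have e6 : (descending Z (fun _ => true)).map (fun Z => Z x) =
      descList (fun i => Z i x) (fun _ => true) := map_descList _ _ _
    rw [e5, map_zsmul, dolbeaultG_apply, e6] at e4
    exact e4
  rw [e3, e2]
  congr 1
  -- on functions the Lie derivative is the derivative along the field
  have e7 (s : Fin m) : dolbeaultLie ε (Y s) (contrFields (descList Y (fun i => i ≠ s)) b) z 0 =
      fderiv ℝ (inChart x (contractList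
        (descending Z (fun i => i ≠ s) ++ descending W (fun _ => true)) (ofDegree β) 0)) z
          (Z s x).1 +
       Complex.I • fderiv ℝ (inChart x (contractList
        (descending Z (fun i => i ≠ s) ++ descending W (fun _ => true)) (ofDegree β) 0)) z
          (Z s x).2 := by
    rw [dolbeaultLie_zero hε (locField_typeField hx (ξ s)), contractList_append, ← hv]
    have e8 : (fun y => contrFields (descList Y (fun i => i ≠ s)) b y 0) =ᶠ[𝓝 z]
        inChart x (contractList (descending Z (fun i => i ≠ s)) v 0) := by
      filter_upwards [(chartAt E x).open_target.mem_nhds hx] with y hy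
      have := congrFun (inChartG_contractList hy (descending Z (fun i => i ≠ s)) v) 0
      rw [show (descending Z (fun i => i ≠ s)).map (locField x) = descList Y (fun i => i ≠ s) from
        map_descList _ _ _] at this
      exact this.symm
    have e9 := locField_self x (typeField ε (ξ s))
    rw [← hz] at e9
    rw [e8.fderiv_eq, e9]
  simp only [Pi.add_apply, Finset.sum_apply, Pi.smul_apply, e7, zsmul_zero, Pi.zero_apply, add_zero]
  simp only [dolbeault]
  rw [zsmul_zero, zero_add]

end BracketCondition

/-! ### The divergence of a field preserving `dV` -/

section Divergence

set_option linter.unusedSectionVars false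

variable {E S : Type*} [NormedAddCommGroup E] [NormedSpace ℂ E]
  [TopologicalSpace S] [ChartedSpace E S] {k m : ℕ} {ε : ℝ}

/-- Replacing the `i`-th vector of a basis by `x` multiplies the value of a top form by the `i`-th
coordinate of `x`. -/
theorem curryLeft_update_basis (α : E [⋀^Fin (k + 1)]→L[ℝ] ℂ) (e : Basis (Fin (k + 1)) ℝ E)
    (i : Fin (k + 1)) (x : E) :
    (-1 : ℤ) ^ (i : ℕ) • α.curryLeft x (i.removeNth e) = e.coord i x • α e := by
  have h1 : (-1 : ℤ) ^ (i : ℕ) • α.curryLeft x (i.removeNth e) = α (Function.update e i x) := by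
    rw [← Fin.insertNth_removeNth]
    exact (α.toAlternatingMap.map_insertNth i x (i.removeNth e)).symm
  rw [h1]
  have h2 : α.toMultilinearMap.toLinearMap e i = (e.coord i).smulRight (α e) := by
    refine e.ext fun j => ?_
    by_cases hj : j = i
    · subst hj
      simp
    · have : α (Function.update e i (e j)) = 0 :=
        α.toAlternatingMap.map_update_self e (Ne.symm hj)
      simpa [Finsupp.single_eq_of_ne hj, Finsupp.single_eq_of_ne (Ne.symm hj)] using this
  exact LinearMap.congr_fun h2 x

/-- Letting an endomorphism act as a derivation on a top form multiplies it by the trace. -/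
theorem alternatizeUncurryFin_curryLeft_comp (α : E [⋀^Fin (k + 1)]→L[ℝ] ℂ)
    (e : Basis (Fin (k + 1)) ℝ E) (A : E →L[ℝ] E) :
    ContinuousAlternatingMap.alternatizeUncurryFin (α.curryLeft.comp A) e =
      (∑ i, e.coord i (A (e i))) • α e := by
  rw [ContinuousAlternatingMap.alternatizeUncurryFin_apply, Finset.sum_smul]
  exact Finset.sum_congr rfl fun i _ => curryLeft_update_basis α e i _

variable [IsManifold 𝓘(ℂ, E) ω S]

/-- The `(1,0)`-Lie derivative in a chart. -/
theorem inChart_lieDerivOneZero {ξ : S → E} (hξ : IsHolomorphicField ξ)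
    {u : DForm E S (k + 1)} (hu : IsSmooth u) {x₀ : S} {z : E} (hz : z ∈ (chartAt E x₀).target) :
    inChart x₀ (lieDerivOneZero (hol ξ) u) z =
      dolbeaultLie 1 (locField x₀ (hol ξ)) (inChartG x₀ (ofDegree u)) z (k + 1) := by
  have hs : IsSmoothField (hol ξ) := typeField_one ξ ▸ hξ.isSmoothField
  have h1 : inChart x₀ (lieDerivOneZero (hol ξ) u) z =
      inChart x₀ (contract (hol ξ) (dolbeaultForm 1 u)) z +
        inChart x₀ (dolbeaultForm 1 (contract (hol ξ) u)) z := by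
    rw [dolbeaultForm_one, dolbeaultForm_one]
    rfl
  have h2 : (fun y => inChartG x₀ (ofDegree u) y (k + 1)) = inChart x₀ u := by
    simp only [inChartG, ofDegree, Pi.single_eq_same]
  have h3 : (fun y => contrField (locField x₀ (hol ξ)) (inChartG x₀ (ofDegree u)) y k) =ᶠ[𝓝 z]
      inChart x₀ (contract (hol ξ) u) := by
    filter_upwards [(chartAt E x₀).open_target.mem_nhds hz] with y hy
    rw [inChart_contract hy, ← h2]
    rfl
  rw [h1, inChart_contract hz, inChart_dolbeaultForm hu hz, inChart_dolbeaultForm (hu.contract hs) hz]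
  simp only [dolbeaultLie, Pi.add_apply, contrG_apply, dolbeault]
  rw [h2, h3.fderiv_eq]

/-- If `L^{1,0}_ξ dV = 0` then the divergences of `ξ` and of `J ξ` with respect to `dV` vanish:
they are the real and minus the imaginary part of the density of `2 L^{1,0}_ξ dV`. -/
theorem divergence_eq_zero (hk0 : k ≠ 0)
    {dV : DForm E S k} (hs : IsSmooth dV) (hr : IsReal dV) {ξ : S → E}
    (hξ : IsHolomorphicField ξ) (hL : lieDerivOneZero (hol ξ) dV = 0) (e : Basis (Fin k) ℝ E)
    {x₀ : S} {z : E} (hz : z ∈ (chartAt E x₀).target) :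
    (fderiv ℝ (inChart x₀ dV) z (locVec x₀ ξ z) e +
      (∑ i, e.coord i (fderiv ℝ (locVec x₀ ξ) z (e i))) • inChart x₀ dV z e = 0) ∧
    (fderiv ℝ (inChart x₀ dV) z (Complex.I • locVec x₀ ξ z) e +
      (∑ i, e.coord i (Complex.I • fderiv ℝ (locVec x₀ ξ) z (e i))) • inChart x₀ dV z e = 0) := by
  obtain ⟨k, rfl⟩ := Nat.exists_eq_add_one_of_ne_zero hk0
  have hd := hξ.differentiableAt hz
  set M := fderiv ℂ (locVec x₀ ξ) z with hM
  have hMr : fderiv ℝ (locVec x₀ ξ) z = M.restrictScalars ℝ :=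
    (hd.hasFDerivAt.restrictScalars ℝ).fderiv
  have h2 : (fun y => inChartG x₀ (ofDegree dV) y (k + 1)) = inChart x₀ dV := by
    simp only [inChartG, ofDegree, Pi.single_eq_same]
  have h3 : locField x₀ (hol ξ) z = typeVec 1 (locVec x₀ ξ z) := by
    rw [← typeField_one]
    exact locField_typeField hz ξ
  have h4 : HasFDerivAt (locField x₀ (hol ξ)) ((typeVecL 1).comp (M.restrictScalars ℝ)) z := by
    refine ((typeVecL (E := E) 1).hasFDerivAt.comp z
      (hd.hasFDerivAt.restrictScalars ℝ)).congr_of_eventuallyEq ?_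
    filter_upwards [(chartAt E x₀).open_target.mem_nhds hz] with y hy
    rw [← typeField_one]
    exact locField_typeField hy ξ
  have hbs (j) : DifferentiableAt ℝ (fun y => inChartG x₀ (ofDegree dV) y j) z :=
    (isSmooth_ofDegree hs j).differentiableAt hz
  have key := dolbeaultLie_succ (ε := 1) (by norm_num) hbs h4.differentiableAt h3 k
  rw [← inChart_lieDerivOneZero hξ hs hz, hL, h2, h4.fderiv, h3, congrFun h2 z] at key
  set w := inChart x₀ dV z with hw
  -- the derivative `M` of `ξ` is complex linear, so this term is already of type `(1,0)`; its
  -- antisymmetrisation is `(tr M - i tr (i M)) / 2` times `dV`, with real traces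
  have h5 : typePart 1 ((contractR w).comp ((typeVecL 1).comp (M.restrictScalars ℝ))) =
      (1 / 2 : ℂ) • w.curryLeft.comp (M.restrictScalars ℝ) -
        (Complex.I / 2) • w.curryLeft.comp ((Complex.I • M).restrictScalars ℝ) := by
    ext1 v
    simp only [typePart_apply, ContinuousLinearMap.comp_apply, contractR_apply, typeVecL_apply,
      ContinuousLinearMap.coe_restrictScalars', map_smul]
    rw [contractVec_typeVec_I_smul (by norm_num)]
    ext y
    simp only [contractVec, typeVec, map_neg, map_smul, ContinuousAlternatingMap.sub_apply,
      ContinuousAlternatingMap.smul_apply, smul_eq_mul, ContinuousAlternatingMap.add_apply,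
      ContinuousAlternatingMap.neg_apply, sub_apply, smul_apply, ContinuousLinearMap.comp_apply,
      ContinuousLinearMap.coe_restrictScalars', Complex.real_smul]
    push_cast
    linear_combination (-(w.curryLeft (M v) y) / 4 +
      Complex.I * (w.curryLeft (Complex.I • M v) y) / 4) * Complex.I_mul_I
  have h6 := congrArg (fun α : E [⋀^Fin (k + 1)]→L[ℝ] ℂ => α e) key
  rw [h5, alternatizeUncurryFin_sub, ContinuousAlternatingMap.alternatizeUncurryFin_smul,
    ContinuousAlternatingMap.alternatizeUncurryFin_smul] at h6
  simp only [ContinuousAlternatingMap.add_apply, ContinuousAlternatingMap.sub_apply,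
    ContinuousAlternatingMap.smul_apply, alternatizeUncurryFin_curryLeft_comp] at h6
  have h7 : inChart x₀ (0 : DForm E S (k + 1)) z e = 0 := rfl
  rw [h7] at h6
  have hreal : (w e).im = 0 := hr _ _
  have hreal' (v : E) : (fderiv ℝ (inChart x₀ dV) z v e).im = 0 := by
    have h8 : HasFDerivAt (fun y => (inChart x₀ dV y e).im)
        (Complex.imCLM.comp ((ContinuousAlternatingMap.apply ℝ E ℂ e).comp
          (fderiv ℝ (inChart x₀ dV) z))) z :=
      (Complex.imCLM.comp (ContinuousAlternatingMap.apply ℝ E ℂ e)).hasFDerivAt.comp z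
        (hs.differentiableAt hz).hasFDerivAt
    have h9 : (fun y => (inChart x₀ dV y e).im) = fun _ => 0 := funext fun y => hr _ _
    rw [h9] at h8
    exact DFunLike.congr_fun (h8.unique (hasFDerivAt_const 0 z)) v
  have hM1 (i) : (M.restrictScalars ℝ) (e i) = M (e i) := rfl
  have hM2 (i) : ((Complex.I • M).restrictScalars ℝ) (e i) = Complex.I • M (e i) := rfl
  simp only [typeVec, map_neg, map_smul, ContinuousAlternatingMap.neg_apply,
    ContinuousAlternatingMap.smul_apply, smul_eq_mul, Complex.real_smul, hM1, hM2] at h6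
  simp only [hMr, hM1, Complex.real_smul]
  -- separate the real and the imaginary part, the values of `dV` being real
  have h10 := congrArg Complex.re h6
  have h11 := congrArg Complex.im h6
  simp [hreal, hreal'] at h10 h11
  constructor
  · apply Complex.ext
    · simp [hreal]
      linarith
    · simp [hreal, hreal']
  · apply Complex.ext
    · simp [hreal]
      linarith
    · simp [hreal, hreal']

end Divergence

/-! ### The measure of a volume form -/

section VolumeMeasure

set_option linter.unusedSectionVars false

variable {E S : Type*} [NormedAddCommGroup E] [NormedSpace ℂ E]
  [TopologicalSpace S] [ChartedSpace E S] {k m : ℕ} {ε : ℝ}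

/-- Vectors on which a top form does not vanish form a basis. -/
theorem exists_basis_of_ne_zero [FiniteDimensional ℂ E] (hk : k = finrank ℝ E)
    {α : E [⋀^Fin k]→L[ℝ] ℂ} {v : Fin k → E} (h : α v ≠ 0) :
    ∃ e : Basis (Fin k) ℝ E, ⇑e = v := by
  have : FiniteDimensional ℝ E := FiniteDimensional.complexToReal E
  have hv : LinearIndependent ℝ v := by
    by_contra hv
    exact h (α.toAlternatingMap.map_linearDependent v hv)
  subst hk
  by_cases hE : Nonempty (Fin (finrank ℝ E))
  · exact ⟨basisOfLinearIndependentOfCardEqFinrank hv (by simp), by simp⟩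
  · rw [not_nonempty_iff] at hE
    exact ⟨finBasis ℝ E, Subsingleton.elim _ _⟩

/-- A linear map acts on top forms by its determinant. -/
theorem re_apply_comp (α : E [⋀^Fin k]→L[ℝ] ℂ) (e : Basis (Fin k) ℝ E) (A : E →L[ℝ] E) :
    (α fun i => A (e i)).re = A.det * (α e).re := by
  have h := (Complex.reLm.compAlternatingMap α.toAlternatingMap).eq_smul_basis_det e
  have h1 := DFunLike.congr_fun h fun i => A (e i)
  have h2 := e.det_comp (A : E →ₗ[ℝ] E) e
  have h3 : e.det (fun i => A (e i)) = A.det * e.det e := h2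
  have h4 : (α fun i => A (e i)).re = (α e).re * e.det (fun i => A (e i)) := h1
  rw [h4, h3, e.det_self]
  ring

/-- The density of a top form in the preferred chart at `x₀`. -/
def density (dV : DForm E S (2 * finrank ℂ E)) [FiniteDimensional ℂ E] (x₀ : S) (z : E) : ℝ :=
  (inChart x₀ dV z (realFrame (finBasis ℂ E))).re

section

variable [IsManifold 𝓘(ℂ, E) ω S] [FiniteDimensional ℂ E]
  {dV : DForm E S (2 * finrank ℂ E)}

theorem density_pos (hdV : IsVolumeForm dV) {x₀ : S} {z : E} (hz : z ∈ (chartAt E x₀).target) :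
    0 < density dV x₀ z := by
  have hI (v : E) : chartD x₀ z (Complex.I • v) = Complex.I • chartD x₀ z v := chartD_I_smul hz v
  have hl (c : ℂ) (v : E) : chartD x₀ z (c • v) = c • chartD x₀ z v := by
    rw [chartD_eq hz, fderiv_trans_eq (mem_transDomain_self hz)]
    simp
  have hl' (c : ℂ) (v : E) : chartDInv x₀ z (c • v) = c • chartDInv x₀ z v := by
    rw [chartDInv, fderiv_trans_eq (trans_mem (mem_transDomain_self hz))]
    simp
  -- the differential of the chart maps the fixed complex basis to another complex basis
  let T : E ≃ₗ[ℂ] E :=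
    { toFun := chartD x₀ z
      invFun := chartDInv x₀ z
      map_add' := map_add _
      map_smul' := hl
      left_inv := fun v => DFunLike.congr_fun (chartDInv_comp_chartD hz) v
      right_inv := fun v => DFunLike.congr_fun (chartD_comp_chartDInv hz) v }
  have h := hdV.pos ((chartAt E x₀).symm z) ((finBasis ℂ E).map T)
  have e : realFrame ((finBasis ℂ E).map T) =
      fun j => chartD x₀ z (realFrame (finBasis ℂ E) j) := by
    funext j
    simp only [realFrame]
    split_ifs
    · rfl
    · exact (hI _).symm
  rw [e] at h
  exact h

/-- Densities transform by the determinant of the transition map. -/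
theorem density_trans (hdV : IsVolumeForm dV) {x₀ x₁ : S} {z : E} (hz : z ∈ transDomain E x₀ x₁) :
    density dV x₀ z = (fderiv ℝ (trans x₀ x₁) z).det * density dV x₁ (trans x₀ x₁ z) := by
  have h1 := density_pos hdV (trans_mem hz).1
  have h2 : inChart x₁ dV (trans x₀ x₁ z) (realFrame (finBasis ℂ E)) ≠ 0 := fun h => by
    rw [density, h] at h1
    simp at h1
  obtain ⟨e, he⟩ := exists_basis_of_ne_zero (finrank_real_of_complex E).symm h2
  rw [density, density, inChart_trans dV hz, ← he]
  exact re_apply_comp (inChart x₁ dV (trans x₀ x₁ z)) e (fderiv ℝ (trans x₀ x₁) z)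

/-- The determinant of a transition map is positive, since the densities are. -/
theorem density_trans_abs (hdV : IsVolumeForm dV) {x₀ x₁ : S} {z : E}
    (hz : z ∈ transDomain E x₀ x₁) :
    density dV x₀ z = |(fderiv ℝ (trans x₀ x₁) z).det| * density dV x₁ (trans x₀ x₁ z) := by
  have h := density_trans hdV hz
  rw [h, abs_of_pos]
  have h0 := density_pos hdV hz.1
  rw [h] at h0
  exact pos_of_mul_pos_left h0 (density_pos hdV (trans_mem hz).1).le

theorem contDiffOn_density (hdV : IsVolumeForm dV) (x₀ : S) :
    ContDiffOn ℝ ∞ (density dV x₀) (chartAt E x₀).target :=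
  (Complex.reCLM.comp (ContinuousAlternatingMap.apply ℝ E ℂ
    (realFrame (finBasis ℂ E)))).contDiff.comp_contDiffOn (hdV.smooth x₀)

variable [MeasurableSpace E] [BorelSpace E] [MeasurableSpace S] [BorelSpace S]

instance : (lebesgue E).IsAddHaarMeasure := by
  unfold lebesgue
  infer_instance

theorem aemeasurable_chartAt_symm (x₀ : S) :
    AEMeasurable (chartAt E x₀).symm ((lebesgue E).restrict (chartAt E x₀).target) :=
  (chartAt E x₀).continuousOn_symm.aemeasurable (chartAt E x₀).open_target.measurableSet

theorem chartMeasure_eq_map (x₀ : S) : chartMeasure dV x₀ =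
    (((lebesgue E).restrict (chartAt E x₀).target).withDensity
      (fun z => ENNReal.ofReal (density dV x₀ z))).map (chartAt E x₀).symm := rfl

theorem chartMeasure_apply (x₀ : S) {A : Set S} (hA : MeasurableSet A) :
    chartMeasure dV x₀ A = ∫⁻ z in (chartAt E x₀).target ∩ (chartAt E x₀).symm ⁻¹' A,
      ENNReal.ofReal (density dV x₀ z) ∂lebesgue E := by
  have : FiniteDimensional ℝ E := FiniteDimensional.complexToReal E
  rw [chartMeasure_eq_map, Measure.map_apply_of_aemeasurable
    ((aemeasurable_chartAt_symm x₀).mono_ac (withDensity_absolutelyContinuous _ _)) hA,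
    withDensity_apply', Measure.restrict_restrict' (chartAt E x₀).open_target.measurableSet,
    Set.inter_comm]

theorem measurableSet_target_inter (x₀ : S) {A : Set S} (hA : MeasurableSet A) :
    MeasurableSet ((chartAt E x₀).target ∩ (chartAt E x₀).symm ⁻¹' A) := by
  have h : Measurable ((chartAt E x₀).target.domRestrict (chartAt E x₀).symm) :=
    ((chartAt E x₀).continuousOn_symm.domRestrict).measurable
  have := (MeasurableEmbedding.subtype_coe
    (chartAt E x₀).open_target.measurableSet).measurableSet_image.2 (h hA)
  convert this using 1
  ext z
  simp [Set.domRestrict, and_comm]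

/-- The chart measures agree on overlaps of charts. -/
theorem chartMeasure_restrict_le (hdV : IsVolumeForm dV) (x₀ x₁ : S) :
    (chartMeasure dV x₁).restrict (chartAt E x₀).source ≤ chartMeasure dV x₀ := by
  have : FiniteDimensional ℝ E := FiniteDimensional.complexToReal E
  refine Measure.le_iff.2 fun A hA => ?_
  have hs := (chartAt E x₀).open_source.measurableSet
  rw [Measure.restrict_apply hA, chartMeasure_apply x₁ (hA.inter hs), chartMeasure_apply x₀ hA]
  set T := (chartAt E x₀).target ∩ (chartAt E x₀).symm ⁻¹' (A ∩ (chartAt E x₁).source) with hT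
  have hTd : T ⊆ transDomain E x₀ x₁ := fun z hz => ⟨hz.1, hz.2.2⟩
  have hTm : MeasurableSet T :=
    measurableSet_target_inter x₀ (hA.inter (chartAt E x₁).open_source.measurableSet)
  have himg : (chartAt E x₁).target ∩ (chartAt E x₁).symm ⁻¹' (A ∩ (chartAt E x₀).source) =
      trans x₀ x₁ '' T := by
    ext y
    constructor
    · intro hy
      have hy' : y ∈ transDomain E x₁ x₀ := ⟨hy.1, hy.2.2⟩
      refine ⟨trans x₁ x₀ y, ⟨(trans_mem hy').1, ?_, ?_⟩, ?_⟩
      · rw [symm_trans hy']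
        exact hy.2.1
      · exact (trans_mem hy').2
      · rw [trans_trans hy', trans_self hy.1]
    · rintro ⟨z, hz, rfl⟩
      refine ⟨(trans_mem (hTd hz)).1, ?_, (trans_mem (hTd hz)).2⟩
      rw [symm_trans (hTd hz)]
      exact hz.2.1
  have hinj : Set.InjOn (trans x₀ x₁) T := fun z hz y hy h => by
    have h' := congrArg (trans x₁ x₀) h
    rwa [trans_trans (hTd hz), trans_trans (hTd hy), trans_self hz.1, trans_self hy.1] at h'
  rw [himg, lintegral_image_eq_lintegral_abs_det_fderiv_mul (lebesgue E) hTm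
    (fun z hz => (differentiableAt_trans (hTd hz)).hasFDerivAt.hasFDerivWithinAt) hinj]
  calc _ = ∫⁻ z in T, ENNReal.ofReal (density dV x₀ z) ∂lebesgue E := by
        refine setLIntegral_congr_fun hTm fun z hz => ?_
        rw [← ENNReal.ofReal_mul (abs_nonneg _), ← density_trans_abs hdV (hTd hz)]
    _ ≤ _ := lintegral_mono_set (Set.inter_subset_inter_right _
        (Set.preimage_mono Set.inter_subset_left))

theorem chartMeasure_restrict_source (x₀ : S) :
    (chartMeasure dV x₀).restrict (chartAt E x₀).source = chartMeasure dV x₀ := by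
  ext A hA
  rw [Measure.restrict_apply hA, chartMeasure_apply x₀ hA,
    chartMeasure_apply x₀ (hA.inter (chartAt E x₀).open_source.measurableSet)]
  congr 2
  ext z
  exact ⟨fun h => ⟨h.1, h.2.1⟩, fun h => ⟨h.1, h.2, (chartAt E x₀).map_target h.1⟩⟩

/-- The measure of a volume form restricts to the chart measures. -/
theorem volumeMeasure_restrict_source (hdV : IsVolumeForm dV) (x₀ : S) :
    (volumeMeasure dV).restrict (chartAt E x₀).source = chartMeasure dV x₀ := by
  have hs := (chartAt E x₀).open_source.measurableSet
  refine le_antisymm ?_ ?_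
  -- each chart measure splits into its parts inside and outside the domain of the chart at `x₀`
  · have h : volumeMeasure dV ≤ chartMeasure dV x₀ +
        (volumeMeasure dV).restrict (chartAt E x₀).sourceᶜ := by
      refine iSup_le fun x₁ => ?_
      rw [← Measure.restrict_add_restrict_compl (μ := chartMeasure dV x₁) hs]
      exact add_le_add (chartMeasure_restrict_le hdV x₀ x₁)
        (Measure.restrict_mono le_rfl (le_iSup (chartMeasure dV) x₁))
    calc _ ≤ (chartMeasure dV x₀ +
        (volumeMeasure dV).restrict (chartAt E x₀).sourceᶜ).restrict (chartAt E x₀).source :=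
          Measure.restrict_mono le_rfl h
      _ = chartMeasure dV x₀ := by
          rw [Measure.restrict_add, chartMeasure_restrict_source, Measure.restrict_restrict hs]
          simp
  · rw [← chartMeasure_restrict_source x₀]
    exact Measure.restrict_mono le_rfl (le_iSup (chartMeasure dV) x₀)

theorem isFiniteMeasure_volumeMeasure [CompactSpace S] (hdV : IsVolumeForm dV) :
    IsFiniteMeasure (volumeMeasure dV) := by
  have : FiniteDimensional ℝ E := FiniteDimensional.complexToReal E
  have : ProperSpace E := FiniteDimensional.proper ℝ E
  have h : IsLocallyFiniteMeasure (volumeMeasure dV) := by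
    refine ⟨fun x => ?_⟩
    obtain ⟨K, hKc, hKx, hKt⟩ := exists_compact_subset (chartAt E x).open_target
      (mem_chart_target E x)
    have ho : IsOpen ((chartAt E x).source ∩ chartAt E x ⁻¹' interior K) :=
      (chartAt E x).isOpen_inter_preimage isOpen_interior
    refine ⟨_, ho.mem_nhds ⟨mem_chart_source E x, hKx⟩, ?_⟩
    have h1 : (volumeMeasure dV) ((chartAt E x).source ∩ chartAt E x ⁻¹' interior K) =
        chartMeasure dV x ((chartAt E x).source ∩ chartAt E x ⁻¹' interior K) := by
      rw [← volumeMeasure_restrict_source hdV, Measure.restrict_apply ho.measurableSet]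
      congr 1
      ext y
      simp
      tauto
    rw [h1, chartMeasure_apply x ho.measurableSet]
    obtain ⟨C, hC⟩ := hKc.bddAbove_image ((contDiffOn_density hdV x).continuousOn.mono hKt)
    calc _ ≤ ∫⁻ z in K, ENNReal.ofReal (density dV x z) ∂lebesgue E :=
          lintegral_mono_set fun z hz => by
            have := hz.2.2
            rw [Set.mem_preimage, (chartAt E x).right_inv hz.1] at this
            exact interior_subset this
      _ ≤ ∫⁻ z in K, ENNReal.ofReal C ∂lebesgue E := by
          refine setLIntegral_mono' hKc.measurableSet fun z hz => ?_
          exact ENNReal.ofReal_le_ofReal (hC ⟨z, hz, rfl⟩)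
      _ < ⊤ := by
          rw [setLIntegral_const]
          exact ENNReal.mul_lt_top ENNReal.ofReal_lt_top hKc.measure_lt_top
  infer_instance

end
end VolumeMeasure

/-! ### The divergence theorem on `E` -/

section FlatDivergence

variable {E : Type*} [NormedAddCommGroup E] [NormedSpace ℝ E] [FiniteDimensional ℝ E]
  [MeasurableSpace E] [BorelSpace E]

/-- Integration by parts against the constant function `1`. -/
theorem integral_fderiv_eq_zero (μ : Measure E) [μ.IsAddHaarMeasure] {F : E → ℂ}
    (hF : ContDiff ℝ 1 F) (hc : HasCompactSupport F) (v : E) : ∫ z, fderiv ℝ F z v ∂μ = 0 := by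
  have h1 : Continuous fun z => fderiv ℝ F z v :=
    (hF.continuous_fderiv one_ne_zero).clm_apply continuous_const
  have h2 : HasCompactSupport fun z => fderiv ℝ F z v := hc.fderiv_apply ℝ v
  have h := integral_smul_fderiv_eq_neg_fderiv_smul_of_integrable (μ := μ) (f := fun _ : E => (1 : ℝ))
    (g := F) (v := v) (by simp) (by simpa using h1.integrable_of_hasCompactSupport h2)
    (by simpa using hF.continuous.integrable_of_hasCompactSupport hc)
    (fun _ _ => differentiableAt_const _) (fun z _ => hF.differentiable one_ne_zero z)
  simpa using h

/-- The divergence theorem for a function `h` with compact support `K` in an open set `O` and a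
field `X` which is divergence free for the density `ρ`. -/
theorem setIntegral_smul_fderiv_eq_zero (μ : Measure E) [μ.IsAddHaarMeasure] {O K : Set E}
    (hO : IsOpen O) (hK : IsCompact K) (hKO : K ⊆ O) {ρ : E → ℝ} {X : E → E} {h : E → ℂ}
    (hρ : ContDiffOn ℝ 1 ρ O) (hX : ContDiffOn ℝ 1 X O) (hh : ContDiffOn ℝ 1 h O)
    (h0 : ∀ z ∈ O, z ∉ K → h z = 0)
    (hdiv : ∀ z ∈ O, fderiv ℝ ρ z (X z) + LinearMap.trace ℝ E (fderiv ℝ X z) * ρ z = 0) :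
    ∫ z in O, ρ z • fderiv ℝ h z (X z) ∂μ = 0 := by
  let e := finBasis ℝ E
  let c (i) : E →L[ℝ] ℝ := (e.coord i).toContinuousLinearMap
  have hc (x : E) : ∑ i, c i x • e i = x := e.sum_repr x
  -- `F i` is the `i`-th component of the field `h ρ X`, extended by zero; the divergence of the
  -- extended field is `ρ Dh(X)` on `O` and `0` elsewhere
  let F (i) : E → ℂ := O.indicator fun z => (ρ z * c i (X z)) • h z
  have hF0 (i) {z : E} (hz : z ∉ K) : F i z = 0 := by
    by_cases hzO : z ∈ O
    · simp only [F, Set.indicator_of_mem hzO, h0 z hzO hz, smul_zero]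
    · simp only [F, Set.indicator_of_notMem hzO]
  have hFK (i) {z : E} (hz : z ∉ K) : F i =ᶠ[𝓝 z] fun _ => 0 := by
    filter_upwards [hK.isClosed.isOpen_compl.mem_nhds hz] with y hy
    exact hF0 i hy
  have hFO (i) {z : E} (hz : z ∈ O) : F i =ᶠ[𝓝 z] fun z => (ρ z * c i (X z)) • h z := by
    filter_upwards [hO.mem_nhds hz] with y hy
    simp only [F, Set.indicator_of_mem hy]
  have hFs (i) : ContDiff ℝ 1 (F i) := by
    refine contDiff_iff_contDiffAt.2 fun z => ?_
    by_cases hz : z ∈ O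
    · refine ContDiffAt.congr_of_eventuallyEq ?_ (hFO i hz)
      have h1 := hρ.contDiffAt (hO.mem_nhds hz)
      have h2 := hX.contDiffAt (hO.mem_nhds hz)
      have h3 := hh.contDiffAt (hO.mem_nhds hz)
      exact (h1.mul ((c i).contDiff.contDiffAt.comp z h2)).smul h3
    · exact contDiffAt_const.congr_of_eventuallyEq (hFK i fun h => hz (hKO h))
  have hFc (i) : HasCompactSupport (F i) := HasCompactSupport.intro hK fun z hz => hF0 i hz
  have key (z : E) : O.indicator (fun z => ρ z • fderiv ℝ h z (X z)) z =
      ∑ i, fderiv ℝ (F i) z (e i) := by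
    by_cases hz : z ∈ O
    · have h1 := ((hρ.contDiffAt (hO.mem_nhds hz)).differentiableAt one_ne_zero).hasFDerivAt
      have h2 := ((hX.contDiffAt (hO.mem_nhds hz)).differentiableAt one_ne_zero).hasFDerivAt
      have h3 := ((hh.contDiffAt (hO.mem_nhds hz)).differentiableAt one_ne_zero).hasFDerivAt
      have h4 (i) : fderiv ℝ (F i) z (e i) = (ρ z * c i (X z)) • fderiv ℝ h z (e i) +
          (ρ z * c i (fderiv ℝ X z (e i)) + c i (X z) * fderiv ℝ ρ z (e i)) • h z := by
        have h5 : HasFDerivAt (fun z => (ρ z * c i (X z)) • h z) _ z :=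
          (h1.mul ((c i).hasFDerivAt.comp z h2)).smul h3
        rw [(hFO i hz).fderiv_eq, h5.fderiv]
        simp
      have h5 : ∑ i, (ρ z * c i (X z)) • fderiv ℝ h z (e i) = ρ z • fderiv ℝ h z (X z) := by
        conv_rhs => rw [← hc (X z), map_sum, Finset.smul_sum]
        simp only [map_smul, smul_smul]
      have h6 : ∑ i, (ρ z * c i (fderiv ℝ X z (e i)) + c i (X z) * fderiv ℝ ρ z (e i)) = 0 := by
        rw [← hdiv z hz, LinearMap.trace_eq_matrix_trace ℝ e, Matrix.trace, Finset.sum_add_distrib,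
          ← Finset.mul_sum, add_comm, mul_comm]
        congr 1
        · conv_rhs => rw [← hc (X z), map_sum]
          simp only [map_smul, smul_eq_mul]
        · simp [LinearMap.toMatrix_apply, c]
      rw [Set.indicator_of_mem hz, Finset.sum_congr rfl fun i _ => h4 i, Finset.sum_add_distrib, h5,
        ← Finset.sum_smul, h6, zero_smul, add_zero]
    · rw [Set.indicator_of_notMem hz]
      refine (Finset.sum_eq_zero fun i _ => ?_).symm
      rw [(hFK i fun h => hz (hKO h)).fderiv_eq]
      simp
  rw [← integral_indicator hO.measurableSet, integral_congr_ae (.of_forall key),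
    integral_finsetSum]
  · exact Finset.sum_eq_zero fun i _ => integral_fderiv_eq_zero μ (hFs i) (hFc i) _
  · intro i _
    exact (((hFs i).continuous_fderiv one_ne_zero).clm_apply
      continuous_const).integrable_of_hasCompactSupport ((hFc i).fderiv_apply ℝ _)

end FlatDivergence

/-! ### The divergence theorem on a manifold -/

section DivergenceTheorem

set_option linter.unusedSectionVars false

variable {E S : Type*} [NormedAddCommGroup E] [NormedSpace ℂ E]
  [TopologicalSpace S] [ChartedSpace E S]

/-- Smooth complex-valued functions. -/
def IsSmoothFun (E : Type*) [NormedAddCommGroup E] [NormedSpace ℂ E] {S : Type*}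
    [TopologicalSpace S] [ChartedSpace E S] (φ : S → ℂ) : Prop :=
  ∀ x₀ : S, ContDiffOn ℝ ∞ (fun z => φ ((chartAt E x₀).symm z)) (chartAt E x₀).target

/-- The derivative of a function along a real vector field. -/
def dirDeriv (φ : S → ℂ) (U : S → E) (x : S) : ℂ :=
  fderiv ℝ (fun z => φ ((chartAt E x).symm z)) (chartAt E x x) (U x)

theorem IsSmoothFun.differentiableAt {φ : S → ℂ} (hφ : IsSmoothFun E φ) {x₀ : S} {z : E}
    (hz : z ∈ (chartAt E x₀).target) :
    DifferentiableAt ℝ (fun z => φ ((chartAt E x₀).symm z)) z :=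
  ((hφ x₀).contDiffAt ((chartAt E x₀).open_target.mem_nhds hz)).differentiableAt (by simp)

theorem IsSmoothFun.continuous {φ : S → ℂ} (hφ : IsSmoothFun E φ) : Continuous φ := by
  refine continuous_iff_continuousAt.2 fun x => ?_
  have h1 := ((hφ x).contDiffAt
    ((chartAt E x).open_target.mem_nhds (mem_chart_target E x))).continuousAt
  have h2 := h1.comp ((chartAt E x).continuousAt (mem_chart_source E x))
  refine h2.congr ?_
  filter_upwards [(chartAt E x).open_source.mem_nhds (mem_chart_source E x)] with y hy
  simp only [Function.comp, (chartAt E x).left_inv hy]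

theorem dirDeriv_eq_zero_of_notMem {φ : S → ℂ} (U : S → E) {x : S} (hx : x ∉ tsupport φ) :
    dirDeriv φ U x = 0 := by
  have h1 : φ =ᶠ[𝓝 x] 0 := notMem_tsupport_iff_eventuallyEq.1 hx
  have h2 : (fun z => φ ((chartAt E x).symm z)) =ᶠ[𝓝 (chartAt E x x)] fun _ => 0 := by
    have h3 := (chartAt E x).continuousAt_symm (mem_chart_target E x)
    rw [ContinuousAt, (chartAt E x).left_inv (mem_chart_source E x)] at h3
    exact h3.eventually h1
  rw [dirDeriv, h2.fderiv_eq]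
  simp

theorem dirDeriv_sum {ι : Type*} (s : Finset ι) {φ : ι → S → ℂ}
    (hφ : ∀ i ∈ s, IsSmoothFun E (φ i)) (U : S → E) (x : S) :
    dirDeriv (fun x => ∑ i ∈ s, φ i x) U x = ∑ i ∈ s, dirDeriv (φ i) U x := by
  rw [dirDeriv, fderiv_fun_sum fun i hi => (hφ i hi).differentiableAt (mem_chart_target E x)]
  simp [dirDeriv]

section

variable [IsManifold 𝓘(ℂ, E) ω S]

/-- The derivative along a field computed in any chart. -/
theorem dirDeriv_symm {φ : S → ℂ} (hφ : IsSmoothFun E φ) (U : S → E) {x₀ : S} {z : E}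
    (hz : z ∈ (chartAt E x₀).target) :
    dirDeriv φ U ((chartAt E x₀).symm z) =
      fderiv ℝ (fun z => φ ((chartAt E x₀).symm z)) z (locVec x₀ U z) := by
  have ht := mem_transDomain_self hz
  set x := (chartAt E x₀).symm z with hx
  have h1 : (fun z => φ ((chartAt E x₀).symm z)) =ᶠ[𝓝 z]
      (fun y => φ ((chartAt E x).symm y)) ∘ trans x₀ x := by
    filter_upwards [(isOpen_transDomain x₀ x).mem_nhds ht] with y hy
    rw [Function.comp, symm_trans hy]
  have h2 : DifferentiableAt ℝ (fun y => φ ((chartAt E x).symm y)) (trans x₀ x z) :=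
    hφ.differentiableAt (trans_mem ht).1
  rw [h1.fderiv_eq, fderiv_comp z h2 (differentiableAt_trans ht), ContinuousLinearMap.comp_apply,
    ← chartD_eq hz, chartD_locVec hz]
  rfl

/-- Smooth real vector fields whose divergence with respect to `dV` vanishes. -/
structure IsDivergenceFree [FiniteDimensional ℂ E] (dV : DForm E S (2 * finrank ℂ E))
    (U : S → E) : Prop where
  smooth : ∀ x₀ : S, ContDiffOn ℝ ∞ (locVec x₀ U) (chartAt E x₀).target
  divergence : ∀ x₀ : S, ∀ z ∈ (chartAt E x₀).target,
    fderiv ℝ (density dV x₀) z (locVec x₀ U z) +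
      LinearMap.trace ℝ E (fderiv ℝ (locVec x₀ U) z) * density dV x₀ z = 0

variable [FiniteDimensional ℂ E] {dV : DForm E S (2 * finrank ℂ E)}

theorem continuous_dirDeriv {φ : S → ℂ} (hφ : IsSmoothFun E φ) {U : S → E}
    (hU : IsDivergenceFree dV U) : Continuous (dirDeriv φ U) := by
  refine continuous_iff_continuousAt.2 fun x => ?_
  have h1 : ContinuousOn (fun z => fderiv ℝ (fun z => φ ((chartAt E x).symm z)) z (locVec x U z))
      (chartAt E x).target :=
    ((hφ x).continuousOn_fderiv_of_isOpen (chartAt E x).open_target (by simp)).clm_apply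
      (hU.smooth x).continuousOn
  have h2 := (h1.continuousAt ((chartAt E x).open_target.mem_nhds (mem_chart_target E x))).comp
    ((chartAt E x).continuousAt (mem_chart_source E x))
  refine h2.congr ?_
  filter_upwards [(chartAt E x).open_source.mem_nhds (mem_chart_source E x)] with y hy
  rw [Function.comp, ← dirDeriv_symm hφ U ((chartAt E x).map_source hy), (chartAt E x).left_inv hy]

variable [MeasurableSpace E] [BorelSpace E] [MeasurableSpace S] [BorelSpace S]

/-- Integration against a chart measure in the chart. -/
theorem integral_chartMeasure (hdV : IsVolumeForm dV) (x₀ : S) {g : S → ℂ} (hg : Continuous g) :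
    ∫ x, g x ∂chartMeasure dV x₀ =
      ∫ z in (chartAt E x₀).target, density dV x₀ z • g ((chartAt E x₀).symm z) ∂lebesgue E := by
  have hm := (chartAt E x₀).open_target.measurableSet
  rw [chartMeasure_eq_map, integral_map
    ((aemeasurable_chartAt_symm x₀).mono_ac (withDensity_absolutelyContinuous _ _))
    hg.aestronglyMeasurable, integral_withDensity_eq_integral_toReal_smul₀
    (((contDiffOn_density hdV x₀).continuousOn.aemeasurable hm).ennreal_ofReal)
    (.of_forall fun _ => ENNReal.ofReal_lt_top)]
  refine setIntegral_congr_fun hm fun z hz => ?_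
  simp only [ENNReal.toReal_ofReal (density_pos hdV hz).le]

/-- The divergence theorem for a function supported in one chart domain. -/
theorem integral_dirDeriv_of_tsupport_subset [CompactSpace S] (hdV : IsVolumeForm dV) {φ : S → ℂ}
    (hφ : IsSmoothFun E φ) {U : S → E} (hU : IsDivergenceFree dV U) {x₀ : S}
    (hs : tsupport φ ⊆ (chartAt E x₀).source) :
    ∫ x, dirDeriv φ U x ∂volumeMeasure dV = 0 := by
  have : FiniteDimensional ℝ E := FiniteDimensional.complexToReal E
  have hK : IsCompact (chartAt E x₀ '' tsupport φ) :=
    (isClosed_tsupport φ).isCompact.image_of_continuousOn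
      ((chartAt E x₀).continuousOn.mono hs)
  rw [← setIntegral_eq_integral_of_forall_compl_eq_zero (s := (chartAt E x₀).source)
    fun x hx => dirDeriv_eq_zero_of_notMem U fun h => hx (hs h),
    volumeMeasure_restrict_source hdV, integral_chartMeasure hdV x₀ (continuous_dirDeriv hφ hU)]
  refine Eq.trans (setIntegral_congr_fun (chartAt E x₀).open_target.measurableSet fun z hz => ?_)
    (setIntegral_smul_fderiv_eq_zero (lebesgue E) (chartAt E x₀).open_target hK ?_
      ((contDiffOn_density hdV x₀).of_le (by simp)) ((hU.smooth x₀).of_le (by simp))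
      ((hφ x₀).of_le (by simp)) ?_ (hU.divergence x₀))
  · simp only [dirDeriv_symm hφ U hz]
  · rintro _ ⟨x, hx, rfl⟩
    exact (chartAt E x₀).map_source (hs hx)
  · intro z hz hzK
    refine image_eq_zero_of_notMem_tsupport fun h => hzK ⟨_, h, (chartAt E x₀).right_inv hz⟩

theorem contDiffOn_symm_of_contMDiff {χ : S → ℝ} (hχ : ContMDiff 𝓘(ℝ, E) 𝓘(ℝ, ℝ) ∞ χ) (x₀ : S) :
    ContDiffOn ℝ ∞ (fun z => χ ((chartAt E x₀).symm z)) (chartAt E x₀).target := by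
  have := isManifold_real (E := E) (S := S)
  have : IsManifold 𝓘(ℝ, E) ∞ S := .of_le (n := ω) le_top
  rw [← contMDiffOn_iff_contDiffOn]
  exact hχ.comp_contMDiffOn (contMDiffOn_chart_symm (I := 𝓘(ℝ, E)))

/-- The integral of the derivative of a function along a divergence free field vanishes. -/
theorem integral_dirDeriv_eq_zero [T2Space S] [CompactSpace S] (hdV : IsVolumeForm dV) {φ : S → ℂ}
    (hφ : IsSmoothFun E φ) {U : S → E} (hU : IsDivergenceFree dV U) :
    ∫ x, dirDeriv φ U x ∂volumeMeasure dV = 0 := by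
  have : FiniteDimensional ℝ E := FiniteDimensional.complexToReal E
  have := isManifold_real (E := E) (S := S)
  have : IsManifold 𝓘(ℝ, E) ∞ S := .of_le (n := ω) le_top
  have := isFiniteMeasure_volumeMeasure hdV
  obtain ⟨t, ht⟩ := isCompact_univ.elim_finite_subcover (fun x : S => (chartAt E x).source)
    (fun x => (chartAt E x).open_source) fun x _ => Set.mem_iUnion.2 ⟨x, mem_chart_source E x⟩
  obtain ⟨χ, hχ⟩ := SmoothPartitionOfUnity.exists_isSubordinate 𝓘(ℝ, E) isClosed_univ
    (fun i : t => (chartAt E (i : S)).source) (fun i => (chartAt E (i : S)).open_source)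
    (ht.trans (by simp [Set.iUnion_subtype]))
  have hχφ (i : t) : IsSmoothFun E fun x => χ i x • φ x := fun x₀ =>
    (contDiffOn_symm_of_contMDiff (χ i).contMDiff x₀).smul (hφ x₀)
  have hsum : φ = fun x => ∑ i, χ i x • φ x := by
    funext x
    have h := χ.sum_eq_one (Set.mem_univ x)
    rw [finsum_eq_sum_of_fintype] at h
    rw [← Finset.sum_smul, h, one_smul]
  rw [hsum]
  simp only [dirDeriv_sum Finset.univ fun i _ => hχφ i]
  rw [integral_finsetSum]
  · refine Finset.sum_eq_zero fun i _ => integral_dirDeriv_of_tsupport_subset hdV (hχφ i) hU ?_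
      (x₀ := (i : S))
    exact (closure_mono (Function.support_smul_subset_left _ _)).trans (hχ i)
  · intro i _
    exact (continuous_dirDeriv (hχφ i) hU).integrable_of_hasCompactSupport
      (HasCompactSupport.of_compactSpace _)

end
end DivergenceTheorem

/-! ### Integrals of contracted forms -/

section Integrals

set_option linter.unusedSectionVars false

variable {E S : Type*} [NormedAddCommGroup E] [NormedSpace ℂ E]
  [TopologicalSpace S] [ChartedSpace E S] {k m : ℕ} {ε : ℝ}

/-- Evaluation on complex vectors as an iterated contraction: the first vector is contracted first,
so it comes last in the list. -/
theorem evalC_eq_contrListG : ∀ {k : ℕ} (α : E [⋀^Fin k]→L[ℝ] ℂ) (z : Fin k → E × E),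
    evalC α z = contrListG (List.ofFn z).reverse (Pi.single k α) 0 ![]
  | 0, α, z => by simp [evalC]
  | k + 1, α, z => by
    rw [evalC, evalC_eq_contrListG, List.ofFn_succ, List.reverse_cons, contrListG_append,
      contrListG_cons, contrListG_nil, contrG_single]

theorem evalC_sub (α β : E [⋀^Fin k]→L[ℝ] ℂ) (z : Fin k → E × E) :
    evalC (α - β) z = evalC α z - evalC β z := by
  simp only [evalC_eq_contrListG]
  have h : (Pi.single k (α - β) : GAlt E) = Pi.single k α - Pi.single k β := by
    rw [← Pi.single_sub]
  rw [h, map_sub]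
  rfl

theorem descList_true_eq {α : Type*} (Z : Fin m → α) :
    descList Z (fun _ => true) = (List.ofFn Z).reverse := by
  rw [descList, List.ofFn_eq_map, List.filter_true, List.map_reverse]

theorem evalFields_eq (Γ : DForm E S (2 * m)) (ξ η : Fin m → S → E) (x : S) :
    evalFields Γ ξ η x = contractList (descending (fun i => antihol (η i)) (fun _ => true) ++
      descending (fun i => hol (ξ i)) (fun _ => true)) (ofDegree Γ) 0 x ![] := by
  have h1 := congrFun (contractList_apply
    (descending (fun i => antihol (η i)) (fun _ => true) ++
      descending (fun i => hol (ξ i)) (fun _ => true)) (ofDegree Γ) x) 0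
  have h2 (Z : Fin m → S → E × E) : (descending Z (fun _ => true)).map (fun Z => Z x) =
      (List.ofFn fun i => Z i x).reverse := by
    rw [← descList_true_eq]
    exact map_descList _ _ _
  have h3 : (List.ofFn fun i : Fin (2 * m) => if h : (i : ℕ) < m then hol (ξ ⟨i, h⟩) x
      else antihol (η ⟨(i : ℕ) - m, by omega⟩) x) =
      (List.ofFn fun i => hol (ξ i) x) ++ List.ofFn fun i => antihol (η i) x := by
    refine List.ext_getElem (by simp; omega) fun i h3 h4 => ?_
    rw [List.getElem_append, List.getElem_ofFn]
    simp only [List.length_ofFn]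
    split_ifs
    · rw [List.getElem_ofFn]
    · rw [List.getElem_ofFn]
  rw [h1, ofDegree_apply, List.map_append, h2, h2, ← List.reverse_append, evalFields,
    evalC_eq_contrListG, h3]

theorem dolbeaultForm_zero : dolbeaultForm ε (0 : DForm E S k) = 0 := by
  funext x
  have h : inChart x (0 : DForm E S k) = fun _ => 0 := rfl
  ext v
  rw [dolbeaultForm, h]
  simp [ContinuousAlternatingMap.alternatizeUncurryFin_apply, typePart_apply]

theorem dolbeaultG_ofDegree (β : DForm E S k) :
    dolbeaultG ε (ofDegree β) = ofDegree (dolbeaultForm ε β) := by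
  funext j
  cases j with
  | zero => exact (Pi.single_eq_of_ne (Nat.succ_ne_zero k).symm _).symm
  | succ j =>
    simp only [dolbeaultG, ofDegree]
    by_cases h : j = k
    · subst h
      simp only [Pi.single_eq_same]
    · rw [Pi.single_eq_of_ne h, Pi.single_eq_of_ne (by omega), dolbeaultForm_zero]

theorem contractList_ofDegree_add (L : List (S → E × E)) (u v : DForm E S k) (j : ℕ) :
    contractList L (ofDegree (u + v)) j = contractList L (ofDegree u) j +
      contractList L (ofDegree v) j := by
  funext x
  have h (u : DForm E S k) := congrFun (contractList_apply L (ofDegree u) x) j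
  rw [Pi.add_apply, h, h, h]
  simp only [ofDegree_apply]
  rw [Pi.add_apply, Pi.single_add, map_add]
  rfl

/-- Exchanging two blocks of contractions. -/
theorem contractList_append_comm (L L' : List (S → E × E)) (u : GForm E S) (j : ℕ) (x : S) :
    contractList (L ++ L') u j x =
      (-1 : ℤ) ^ (L.length * L'.length) • contractList (L' ++ L) u j x := by
  have h (L) := congrFun (contractList_apply L u x) j
  rw [h, h, List.map_append, contrListG_append, contrListG_comm, ← contrListG_append,
    List.map_append, List.length_map, List.length_map]
  rfl

theorem isSmoothFun_apply {g : DForm E S 0} (hg : IsSmooth g) :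
    IsSmoothFun E fun x => g x ![] := fun x₀ => by
  refine ((ContinuousAlternatingMap.apply ℝ E ℂ ![]).contDiff.comp_contDiffOn (hg x₀)).congr
    fun z _ => ?_
  exact congrArg (g _) (Subsingleton.elim _ _)

theorem dirDeriv_apply {g : DForm E S 0} (hg : IsSmooth g) (U : S → E) (x : S) :
    dirDeriv (fun x => g x ![]) U x = fderiv ℝ (inChart x g) (chartAt E x x) (U x) ![] := by
  have h : (fun z => g ((chartAt E x).symm z) ![]) =
      fun z => ContinuousAlternatingMap.apply ℝ E ℂ ![] (inChart x g z) := by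
    funext z
    exact congrArg (g _) (Subsingleton.elim _ _)
  have h1 : HasFDerivAt (fun z => ContinuousAlternatingMap.apply ℝ E ℂ ![] (inChart x g z)) _
      (chartAt E x x) := (ContinuousAlternatingMap.apply ℝ E ℂ ![]).hasFDerivAt.comp _
    (hg.differentiableAt (mem_chart_target E x)).hasFDerivAt
  rw [dirDeriv, h, h1.fderiv]
  rfl

section

variable [IsManifold 𝓘(ℂ, E) ω S] [FiniteDimensional ℂ E]
  {dV : DForm E S (2 * finrank ℂ E)}

theorem IsVolumeForm.ne_zero (hdV : IsVolumeForm dV) (x : S) : dV x ≠ 0 := fun h => by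
  have := hdV.pos x (finBasis ℂ E)
  rw [h] at this
  simp at this

theorem fderiv_density (hdV : IsVolumeForm dV) {x₀ : S} {z : E} (hz : z ∈ (chartAt E x₀).target)
    (v : E) : fderiv ℝ (density dV x₀) z v =
      (fderiv ℝ (inChart x₀ dV) z v (realFrame (finBasis ℂ E))).re := by
  have h : HasFDerivAt (density dV x₀) _ z :=
    (Complex.reCLM.comp (ContinuousAlternatingMap.apply ℝ E ℂ
      (realFrame (finBasis ℂ E)))).hasFDerivAt.comp z (hdV.smooth.differentiableAt hz).hasFDerivAt
  rw [h.fderiv]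
  rfl

/-- Fields preserving the volume form are divergence free, and so are their images under the
complex structure. -/
theorem isDivergenceFree_of_mem_lieAlg (hdV : IsVolumeForm dV) (hE : finrank ℂ E ≠ 0) {ξ : S → E}
    (hξ : ξ ∈ lieAlg dV) :
    IsDivergenceFree dV ξ ∧ IsDivergenceFree dV fun x => Complex.I • ξ x := by
  have hs (x₀ : S) : ContDiffOn ℝ ∞ (locVec x₀ ξ) (chartAt E x₀).target :=
    ((hξ.1.contDiffOn x₀).restrict_scalars ℝ).of_le le_top
  have hIs (x₀ : S) : ContDiffOn ℝ ∞ (fun z => Complex.I • locVec x₀ ξ z) (chartAt E x₀).target :=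
    (hs x₀).const_smul _
  have key (x₀ : S) (z : E) (hz : z ∈ (chartAt E x₀).target) :
      (fderiv ℝ (density dV x₀) z (locVec x₀ ξ z) +
        LinearMap.trace ℝ E (fderiv ℝ (locVec x₀ ξ) z) * density dV x₀ z = 0) ∧
      (fderiv ℝ (density dV x₀) z (Complex.I • locVec x₀ ξ z) +
        LinearMap.trace ℝ E (Complex.I • fderiv ℝ (locVec x₀ ξ) z : E →L[ℝ] E) *
          density dV x₀ z = 0) := by
    have h2 : inChart x₀ dV z (realFrame (finBasis ℂ E)) ≠ 0 := fun h => by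
      have h1 := density_pos hdV hz
      rw [density, h] at h1
      simp at h1
    obtain ⟨e, he⟩ := exists_basis_of_ne_zero (finrank_real_of_complex E).symm h2
    have h3 := divergence_eq_zero (by omega) hdV.smooth hdV.real hξ.1 hξ.2 e hz
    have htr (A : E →ₗ[ℝ] E) : LinearMap.trace ℝ E A = ∑ i, e.coord i (A (e i)) := by
      rw [LinearMap.trace_eq_matrix_trace ℝ e, Matrix.trace]
      simp [LinearMap.toMatrix_apply]
    rw [fderiv_density hdV hz, fderiv_density hdV hz, density, htr, htr, ← he]
    have h4 := congrArg Complex.re h3.1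
    have h5 := congrArg Complex.re h3.2
    exact ⟨by simpa using h4, by simpa using h5⟩
  refine ⟨⟨hs, fun x₀ z hz => (key x₀ z hz).1⟩, ⟨fun x₀ => ?_, fun x₀ z hz => ?_⟩⟩
  · exact (hIs x₀).congr fun z hz => locVec_I_smul hz ξ
  · have h1 : locVec x₀ (fun x => Complex.I • ξ x) =ᶠ[𝓝 z] fun z => Complex.I • locVec x₀ ξ z := by
      filter_upwards [(chartAt E x₀).open_target.mem_nhds hz] with y hy
      exact locVec_I_smul hy ξ
    have h2 : DifferentiableAt ℝ (locVec x₀ ξ) z :=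
      ((hs x₀).contDiffAt ((chartAt E x₀).open_target.mem_nhds hz)).differentiableAt (by simp)
    rw [h1.fderiv_eq, h1.self_of_nhds, fderiv_fun_const_smul h2]
    exact (key x₀ z hz).2

variable [MeasurableSpace E] [BorelSpace E] [MeasurableSpace S] [BorelSpace S]

theorem integrable_contractList [CompactSpace S] (hdV : IsVolumeForm dV) {L : List (S → E × E)}
    (hL : ∀ Z ∈ L, IsSmoothField Z) {u : DForm E S k} (hu : IsSmooth u) :
    Integrable (fun x => contractList L (ofDegree u) 0 x ![]) (volumeMeasure dV) := by
  have := isFiniteMeasure_volumeMeasure hdV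
  exact (isSmoothFun_apply (isSmooth_contractList hL
    (isSmooth_ofDegree hu) 0)).continuous.integrable_of_hasCompactSupport
      (HasCompactSupport.of_compactSpace _)

variable [T2Space S] [CompactSpace S]

/-- The derivative of a function along the complex field of type `(1,0)` or `(0,1)` given by a field
preserving the volume form has integral zero. -/
theorem integral_dirDeriv_typeField (hdV : IsVolumeForm dV) (hE : finrank ℂ E ≠ 0)
    {ξ : S → E} (hξ : ξ ∈ lieAlg dV) {φ : S → ℂ} (hφ : IsSmoothFun E φ) :
    Integrable (fun x => dirDeriv φ (fun y => (typeField ε ξ y).1) x +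
      Complex.I * dirDeriv φ (fun y => (typeField ε ξ y).2) x) (volumeMeasure dV) ∧
    ∫ x, (dirDeriv φ (fun y => (typeField ε ξ y).1) x +
      Complex.I * dirDeriv φ (fun y => (typeField ε ξ y).2) x) ∂volumeMeasure dV = 0 := by
  have := isFiniteMeasure_volumeMeasure hdV
  obtain ⟨h1, h2⟩ := isDivergenceFree_of_mem_lieAlg hdV hE hξ
  have e (x) : dirDeriv φ (fun y => (typeField ε ξ y).1) x +
      Complex.I * dirDeriv φ (fun y => (typeField ε ξ y).2) x = (1 / 2 : ℂ) * dirDeriv φ ξ x +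
        (-(Complex.I * ε / 2)) * dirDeriv φ (fun y => Complex.I • ξ y) x := by
    simp only [dirDeriv, typeField, typeVec, map_neg, map_smul, Complex.real_smul]
    push_cast
    ring
  have hi {U : S → E} (hU : IsDivergenceFree dV U) :
      Integrable (dirDeriv φ U) (volumeMeasure dV) :=
    (continuous_dirDeriv hφ hU).integrable_of_hasCompactSupport
      (HasCompactSupport.of_compactSpace _)
  simp only [e]
  refine ⟨((hi h1).const_mul _).add ((hi h2).const_mul _), ?_⟩
  rw [integral_add ((hi h1).const_mul _) ((hi h2).const_mul _), integral_const_mul,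
    integral_const_mul, integral_dirDeriv_eq_zero hdV hφ h1, integral_dirDeriv_eq_zero hdV hφ h2]
  simp

/-- The contraction of `∂β` or `∂̄β` by fields satisfying the bracket condition has integral zero. -/
theorem integral_contractList_dolbeaultForm (hε : ε * ε = 1) (hdV : IsVolumeForm dV)
    (hE : finrank ℂ E ≠ 0) {ξ η : Fin m → S → E}
    (hξ : ∀ i, ξ i ∈ lieAlg dV) (hη : ∀ i, η i ∈ lieAlg dV)
    (hB : bracketForm (fun i => typeField ε (ξ i)) (fun i => typeField (-ε) (η i))
      (ofDegree dV) = 0)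
    {β : DForm E S k} (hβ : IsSmooth β) :
    ∫ x, contractList (descending (fun i => typeField ε (ξ i)) (fun _ => true) ++
      descending (fun i => typeField (-ε) (η i)) (fun _ => true))
        (ofDegree (dolbeaultForm ε β)) 0 x ![] ∂volumeMeasure dV = 0 := by
  let g (s : Fin m) : DForm E S 0 := contractList
    (descending (fun i => typeField ε (ξ i)) (fun i => i ≠ s) ++
      descending (fun i => typeField (-ε) (η i)) (fun _ => true)) (ofDegree β) 0
  have hg (s) : IsSmooth (g s) := by
    refine isSmooth_contractList (fun Z hZ => ?_) (isSmooth_ofDegree hβ) 0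
    rcases List.mem_append.1 hZ with h | h
    · obtain ⟨i, rfl⟩ := mem_descList h
      exact (hξ i).1.isSmoothField
    · obtain ⟨i, rfl⟩ := mem_descList h
      exact (hη i).1.isSmoothField
  have key (x : S) : contractList (descending (fun i => typeField ε (ξ i)) (fun _ => true) ++
      descending (fun i => typeField (-ε) (η i)) (fun _ => true))
        (ofDegree (dolbeaultForm ε β)) 0 x ![] = ∑ s : Fin m, ((-1 : ℂ) ^ m * (-1 : ℂ) ^ (s : ℕ)) *
      (dirDeriv (fun x => g s x ![]) (fun y => (typeField ε (ξ s) y).1) x +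
        Complex.I * dirDeriv (fun x => g s x ![]) (fun y => (typeField ε (ξ s) y).2) x) := by
    have h := contractList_dolbeaultG hε (fun i => (hξ i).1) (fun i => (hη i).1) hdV.ne_zero hB hβ x
    rw [← dolbeaultG_ofDegree, h]
    simp only [dirDeriv_apply (hg _)]
    rw [Finset.smul_sum, ContinuousAlternatingMap.sum_apply]
    refine Finset.sum_congr rfl fun s _ => ?_
    rw [smul_smul, ← Int.cast_smul_eq_zsmul ℂ]
    simp only [ContinuousAlternatingMap.smul_apply, ContinuousAlternatingMap.add_apply, smul_eq_mul]
    push_cast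
    rfl
  simp only [key]
  rw [integral_finsetSum _ fun s _ =>
    (integral_dirDeriv_typeField hdV hE (hξ s) (isSmoothFun_apply (hg s))).1.const_mul _]
  refine Finset.sum_eq_zero fun s _ => ?_
  rw [integral_const_mul, (integral_dirDeriv_typeField hdV hE (hξ s)
    (isSmoothFun_apply (hg s))).2, mul_zero]

/-- The contraction of an Aeppli-trivial form has integral zero. -/
theorem integral_contractList_of_isAeppliTrivial (hdV : IsVolumeForm dV)
    (hE : finrank ℂ E ≠ 0) {ξ η : Fin m → S → E} (hξη : (ξ, η) ∈ tupleSpace dV m) {p q : ℤ}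
    {u : DForm E S k} (hu : IsAeppliTrivial p q u) :
    ∫ x, contractList (descending (fun i => antihol (η i)) (fun _ => true) ++
      descending (fun i => hol (ξ i)) (fun _ => true)) (ofDegree u) 0 x ![] ∂volumeMeasure dV =
      0 := by
  obtain ⟨hξ, hη, hB1, hB2⟩ := hξη
  simp only [← typeField_one, ← typeField_neg_one] at hB1 hB2 ⊢
  have hL : ∀ Z ∈ descending (fun i => typeField (-1) (η i)) (fun _ => true) ++
      descending (fun i => typeField 1 (ξ i)) (fun _ => true), IsSmoothField Z := fun Z hZ => by
    rcases List.mem_append.1 hZ with h | h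
    · obtain ⟨i, rfl⟩ := mem_descList h
      exact (hη i).1.isSmoothField
    · obtain ⟨i, rfl⟩ := mem_descList h
      exact (hξ i).1.isSmoothField
  cases k with
  | zero =>
    obtain rfl : u = 0 := hu
    have h := contractList_ofDegree_add (descending (fun i => typeField (-1) (η i))
      (fun _ => true) ++ descending (fun i => typeField 1 (ξ i)) (fun _ => true))
      (0 : DForm E S 0) 0 0
    rw [add_zero, left_eq_add] at h
    rw [h]
    simp
  | succ k =>
    obtain ⟨β, γ, hβ, hγ, rfl⟩ := hu
    rw [← dolbeaultForm_one, ← dolbeaultForm_neg_one, contractList_ofDegree_add]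
    simp only [Pi.add_apply, ContinuousAlternatingMap.add_apply]
    rw [integral_add (integrable_contractList hdV hL hβ.1.dolbeaultForm)
      (integrable_contractList hdV hL hγ.1.dolbeaultForm)]
    -- for `∂β` the roles of `ξ` and `η̄` are exchanged, at the cost of a sign
    have h1 := integral_contractList_dolbeaultForm (ε := 1) (by norm_num) hdV hE hξ hη hB2 hβ.1
    have h2 := integral_contractList_dolbeaultForm (ε := -1) (by norm_num) hdV hE hη hξ
      (by rw [neg_neg]; exact hB1) hγ.1
    rw [neg_neg] at h2
    rw [h2, add_zero]
    simp only [contractList_append_comm (descending (fun i => typeField (-1) (η i)) _)]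
    simp only [← Int.cast_smul_eq_zsmul ℂ, ContinuousAlternatingMap.smul_apply]
    rw [integral_smul, h1, smul_zero]

end
end Integrals

end BalancedMoment

theorem proposition2p2
    {F X : Type*} [NormedAddCommGroup F] [NormedSpace ℂ F] [FiniteDimensional ℂ F]
    [TopologicalSpace X] [T2Space X] [SecondCountableTopology X]
    [ChartedSpace F X] [IsManifold 𝓘(ℂ, F) ω X]
    {E S : Type*} [NormedAddCommGroup E] [NormedSpace ℂ E] [FiniteDimensional ℂ E]
    [MeasurableSpace E] [BorelSpace E]
    [TopologicalSpace S] [T2Space S] [CompactSpace S]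
    [ChartedSpace E S] [IsManifold 𝓘(ℂ, E) ω S]
    [MeasurableSpace S] [BorelSpace S]
    -- `n = m + 2` is the dimension of `X`; the dimension of `S` is at least `n - 1`
    (m : ℕ) (hX : Module.finrank ℂ F = m + 2) (hS : m + 1 ≤ Module.finrank ℂ E)
    (w : BalancedMoment.DForm F X 2) (hw : BalancedMoment.IsBalancedMetric w)
    (dV : BalancedMoment.DForm E S (2 * Module.finrank ℂ E))
    (hdV : BalancedMoment.IsVolumeForm dV)
    (hA : BalancedMoment.AeppliVanishes E S (2 * m) m m)
    (f : S → X) (hf : f ∈ BalancedMoment.mapSpace E w m)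
    (ξ η : Fin m → S → E) (hξη : (ξ, η) ∈ BalancedMoment.tupleSpace dV m)
    (Γ₁ Γ₂ : BalancedMoment.DForm E S (2 * m))
    (hΓ₁ : BalancedMoment.IsRealPotential w f Γ₁)
    (hΓ₂ : BalancedMoment.IsRealPotential w f Γ₂) :
    BalancedMoment.momentValue dV Γ₁ ξ η = BalancedMoment.momentValue dV Γ₂ ξ η := by
  open BalancedMoment in
  have hE : finrank ℂ E ≠ 0 := by omega
  have hs₁ : IsSmooth Γ₁ := hΓ₁.1.1
  have hs₂ : IsSmooth Γ₂ := hΓ₂.1.1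
  have hclosed : del (delbar (Γ₁ - Γ₂)) = 0 := by
    have h : del (delbar Γ₁) = del (delbar Γ₂) := by
      have h1 : Complex.I • del (delbar Γ₁) = Complex.I • del (delbar Γ₂) :=
        hΓ₁.2.2.symm.trans hΓ₂.2.2
      funext x
      ext v
      have h2 := congrArg (fun α : E [⋀^Fin (2 * m + 1 + 1)]→L[ℝ] ℂ => α v) (congrFun h1 x)
      exact mul_left_cancel₀ Complex.I_ne_zero h2
    rw [← dolbeaultForm_neg_one, ← dolbeaultForm_one, dolbeaultForm_sub hs₁ hs₂,
      dolbeaultForm_sub hs₁.dolbeaultForm hs₂.dolbeaultForm]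
    simp only [dolbeaultForm_one, dolbeaultForm_neg_one, h, sub_self]
  have htype : IsSmoothOfType (m : ℤ) (m : ℤ) (Γ₁ - Γ₂) :=
    ⟨hs₁.sub hs₂, fun x => ⟨(hΓ₁.1.2 x).1, fun s v hv => by
      rw [Pi.sub_apply, evalC_sub, (hΓ₁.1.2 x).2 s v hv, (hΓ₂.1.2 x).2 s v hv, sub_zero]⟩⟩
  -- `Γ₁ - Γ₂` is Aeppli trivial
  have hint := integral_contractList_of_isAeppliTrivial hdV hE hξη (hA _ htype hclosed)
  have hL : ∀ Z ∈ descending (fun i => antihol (η i)) (fun _ => true) ++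
      descending (fun i => hol (ξ i)) (fun _ => true), IsSmoothField Z := fun Z hZ => by
    rcases List.mem_append.1 hZ with h | h
    · obtain ⟨i, rfl⟩ := mem_descList h
      exact typeField_neg_one (η i) ▸ (hξη.2.1 i).1.isSmoothField
    · obtain ⟨i, rfl⟩ := mem_descList h
      exact typeField_one (ξ i) ▸ (hξη.1 i).1.isSmoothField
  have hadd := contractList_ofDegree_add (descending (fun i => antihol (η i)) (fun _ => true) ++
      descending (fun i => hol (ξ i)) (fun _ => true)) (Γ₁ - Γ₂) Γ₂ 0
  rw [sub_add_cancel] at hadd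
  simp only [momentValue, evalFields_eq]
  rw [hadd]
  simp only [Pi.add_apply, ContinuousAlternatingMap.add_apply]
  rw [integral_add (integrable_contractList hdV hL (hs₁.sub hs₂))
    (integrable_contractList hdV hL hs₂), hint, zero_add]

end
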